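/- **Setting.** Fix integers $M,N\ge 1$ and $m\ge 0$. Let $\mathbf t=(\mathbf t^{(1)},\mathbf t^{(2)})$, $\mathbf t^{(a)}=(t^{(a)}_1,t^{(a)}_2,\dots)$, and let all functions of $(n,\mathbf t)$, $n\in\mathbb Z$, take values in the ring $\mathbb C[[\mathbf t]]$ of formal power series for each $n$. Let $\Lambda(f)(n)=f(n+1)$, $\Delta=\Lambda-1$, $\Delta^*=\Lambda^{-1}-1$, $(\sum_j a_j\Lambda^j)^*=\sum_j\Lambda^{-j}a_j$, $\iota_\Lambda\Delta^{-1}=-\sum_{j\ge0}\Lambda^j$, $\iota_{\Lambda^{-1}}\Delta^{-1}=\sum_{j\ge1}\Lambda^{-j}$. For $A$ bounded above (resp. below) in powers of $\Lambda$, $A_{\Delta,\ge1}$ (resp. $A_{\Delta^*,\ge1}$) is the part of $A$ with positive powers of $\Delta$ (resp. $\Delta^*$). Put $\xi(\mathbf x,z)=\sum_{p\ge1}x_pz^p$, $[z]=(z,z^2/2,z^3/3,\dots)$, and let $\mathbf t\pm[z]_a$ mean that $\mathbf t^{(a)}$ is replaced by $\mathbf t^{(a)}\pm[z]$. The integrals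 $\oint_{C_\infty}\frac{dz}{2\pi\mathbf i z}$, $\oint_{C_0}\frac{dz}{2\pi\mathbf i z}$ are formal: they extract the coefficient of $z^0$ from expansions at $z=\infty$, $z=0$, where a product of two exponentials $e^{\pm\xi}$ at $\mathbf t$ and $\mathbf t'$ is combined to an exponential of the difference. **Lax formulation.** Operators $L_1=u_{-1}\Lambda+\sum_{j\ge0}u_j\Lambda^{-j}$, $L_2=\bar u_{-1}\Lambda^{-1}+\sum_{j\ge0}\bar u_j\Lambda^j$ with $u_{-1}(n),\bar u_{-1}(n)\ne0$ for all $n$, and functions $q_{i,n},r_{i,n}$ ($1\le i\le m$), form a solution of the Lax formulation of the GBMT hierarchy if, for all $a,b\in\{1,2\}$, $p\ge1$ and $1\le i\le m$, $$L_1^M\,\iota_{\Lambda^{-1}}\Delta^{-1}=L_2^N\,\iota_{\Lambda}\Delta^{-1}+\sum_{l\in\mathbb Z}\sum_{i=1}^m q_{i,n}\Lambda^l r_{i,n+1},\qquad \partial_{t_p^{(a)}}L_b=[B_p^{(a)},L_b],$$ $$\partial_{t_p^{(a)}}q_{i,n}=B_p^{(a)}(q_{i,n}),\qquad \partial_{t_p^{(a)}}r_{i,n}=-(\Delta^{-1}B_p^{(a)*}\Delta)(r_{i,n}),$$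 with $B_p^{(1)}=(L_1^p)_{\Delta,\ge1}$, $B_p^{(2)}=(L_2^p)_{\Delta^*,\ge1}$. (Here $\Delta^{-1}B_p^{(a)*}$ is the same finite sum for both expansions of $\Delta^{-1}$.) **Wave operators and wave functions.** Wave operators of $(L_1,L_2)$ are invertible operators $S_1=\sum_{j\ge0}s_{1,j}\Lambda^{-j}$, $S_2=\sum_{j\ge0}s_{2,j}\Lambda^{j}$ (with inverses of the same form) such that $L_1=S_1\Lambda S_1^{-1}$, $L_2=S_2\Lambda^{-1}S_2^{-1}$ and $$\partial_{t^{(1)}_p}S_1=B^{(1)}_pS_1-S_1\Lambda^p,\quad \partial_{t^{(1)}_p}S_2=B^{(1)}_pS_2,\quad \partial_{t^{(2)}_p}S_1=B^{(2)}_pS_1,\quad \partial_{t^{(2)}_p}S_2=B^{(2)}_pS_2-S_2\Lambda^{-p}.$$ Their wave functions are $$\Psi_1=e^{\xi(\mathbf t^{(1)},z)}S_1(z^n),\qquad \Psi_1^*=-e^{-\xi(\mathbf t^{(1)},z)}\,\iota_{\Lambda}\Delta^{-1}(S_1^*)^{-1}(z^{-n}),$$ $$\Psi_2=e^{\xi(\mathbf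 t^{(2)},z^{-1})}S_2(z^n),\qquad \Psi_2^*=e^{-\xi(\mathbf t^{(2)},z^{-1})}\,\iota_{\Lambda^{-1}}\Delta^{-1}(S_2^*)^{-1}(z^{-n}).$$ A tau pair of them is a pair of families $\tau_{0,n},\tau_{1,n}$ of invertible elements of $\mathbb C[[\mathbf t]]$ with $$\Psi_1=\tfrac{\tau_{0,n}(\mathbf t-[z^{-1}]_1)}{\tau_{1,n}(\mathbf t)}z^ne^{\xi(\mathbf t^{(1)},z)},\quad \Psi_1^*=\tfrac{\tau_{1,n}(\mathbf t+[z^{-1}]_1)}{\tau_{0,n}(\mathbf t)}z^{-n}e^{-\xi(\mathbf t^{(1)},z)},$$ $$\Psi_2=\tfrac{\tau_{0,n+1}(\mathbf t-[z]_2)}{\tau_{1,n}(\mathbf t)}z^ne^{\xi(\mathbf t^{(2)},z^{-1})},\quad \Psi_2^*=\tfrac{\tau_{1,n-1}(\mathbf t+[z]_2)}{\tau_{0,n}(\mathbf t)}z^{1-n}e^{-\xi(\mathbf t^{(2)},z^{-1})}.$$ **Bilinear formulation.** For families $f=(f_n)$, $g=(g_n)$ and integers $e_1,e_2$ let $$\langle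 f,g\rangle^{e_1,e_2}_{n,n'}=\oint_{C_\infty}\!\tfrac{dz}{2\pi\mathbf i z}z^{e_1+n-n'}f_n(\mathbf t-[z^{-1}]_1)g_{n'}(\mathbf t'+[z^{-1}]_1)e^{\xi(\mathbf t^{(1)}-\mathbf t'^{(1)},z)}+\oint_{C_0}\!\tfrac{dz}{2\pi\mathbf i z}z^{e_2+n-n'+1}f_{n+1}(\mathbf t-[z]_2)g_{n'-1}(\mathbf t'+[z]_2)e^{\xi(\mathbf t^{(2)}-\mathbf t'^{(2)},z^{-1})}.$$ The tau-function bilinear equations of the GBMT hierarchy for $\tau_0,\tau_1,\rho_i,\sigma_i$ are, for all $n,n'$, all $i$, identically in $\mathbf t,\mathbf t'$, $$\langle\tau_0,\tau_1\rangle^{M,-N}_{n,n'}=\sum_{i=1}^m\rho_{i,n}(\mathbf t)\sigma_{i,n'}(\mathbf t'),\qquad \langle\tau_0,\rho_i\rangle^{0,0}_{n,n'}=\rho_{i,n}(\mathbf t)\tau_{0,n'}(\mathbf t'),$$ $$\langle\sigma_i,\tau_1\rangle^{0,0}_{n,n'}=\tau_{1,n}(\mathbf t)\sigma_{i,n'}(\mathbf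 t'),\qquad \langle\tau_0,\tau_1\rangle^{0,0}_{n,n'}=\tau_{1,n}(\mathbf t)\tau_{0,n'}(\mathbf t').$$ **Theorem.** (1) Let $(L_1,L_2,q_i,r_i)$ be a solution of the Lax formulation. Then $(L_1,L_2)$ has wave operators, and for every choice of wave operators the wave functions satisfy, for all $n,n'\in\mathbb Z$ and $1\le i\le m$, identically in $\mathbf t,\mathbf t'$ (operators $\Delta$, $\iota\Delta^{-1}$ acting on $n$), $$\oint_{C_\infty}\!\tfrac{dz}{2\pi\mathbf iz}\,\iota_\Lambda\Delta^{-1}\big(\Delta(q_{i,n}(\mathbf t))\Psi_1^*(n+1,\mathbf t,z)\big)\Psi_1(n',\mathbf t',z)+\oint_{C_0}\!\tfrac{dz}{2\pi\mathbf iz}\,\iota_{\Lambda^{-1}}\Delta^{-1}\big(\Delta(q_{i,n}(\mathbf t))\Psi_2^*(n+1,\mathbf t,z)\big)\Psi_2(n',\mathbf t',z)=q_{i,n}(\mathbf t)-q_{i,n'}(\mathbf t'),$$ $$\oint_{C_\infty}\!\tfrac{dz}{2\pi\mathbf iz}\,\iota_{\Lambda^{-1}}\Delta^{-1}\big(\Delta(r_{i,n}(\mathbf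 t))\Psi_1(n,\mathbf t,z)\big)\Psi_1^*(n',\mathbf t',z)+\oint_{C_0}\!\tfrac{dz}{2\pi\mathbf iz}\,\iota_{\Lambda}\Delta^{-1}\big(\Delta(r_{i,n}(\mathbf t))\Psi_2(n,\mathbf t,z)\big)\Psi_2^*(n',\mathbf t',z)=r_{i,n}(\mathbf t)-r_{i,n'}(\mathbf t'),$$ $$\oint_{C_\infty}\!\tfrac{dz}{2\pi\mathbf iz}\,z^M\Psi_1(n,\mathbf t,z)\Psi_1^*(n',\mathbf t',z)+\oint_{C_0}\!\tfrac{dz}{2\pi\mathbf iz}\,z^{-N}\Psi_2(n,\mathbf t,z)\Psi_2^*(n',\mathbf t',z)=\sum_{i=1}^m q_{i,n}(\mathbf t)r_{i,n'}(\mathbf t').$$ Moreover the wave functions have a tau pair, and for every tau pair $(\tau_0,\tau_1)$ of them the functions $\tau_0,\tau_1$, $\rho_{i,n}=q_{i,n}\tau_{1,n}$, $\sigma_{i,n}=r_{i,n}\tau_{0,n}$ satisfy the tau-function bilinear equations. (2) Conversely, let $\tau_{0,n},\tau_{1,n}\in\mathbb C[[\mathbf t]]$ be invertible for all $n$ and let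 them, with $\rho_{i,n},\sigma_{i,n}\in\mathbb C[[\mathbf t]]$, satisfy the tau-function bilinear equations. Then there are a solution $(L_1,L_2,q_i,r_i)$ of the Lax formulation and wave operators of $(L_1,L_2)$ such that $(\tau_0,\tau_1)$ is a tau pair of their wave functions, $\rho_{i,n}=q_{i,n}\tau_{1,n}$ and $\sigma_{i,n}=r_{i,n}\tau_{0,n}$. Thus the bilinear and the Lax formulations of the GBMT hierarchy are equivalent. -/

import Mathlib

noncomputable section

namespace GBMT

/-! ### Times and coefficient rings -/

/-- The times `t^{(a)}_p`, `a = 1, 2`, `p ≥ 1`; the pair `(0, p)` stands for `t^{(1)}_p` and the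
pair `(1, p)` for `t^{(2)}_p`. -/
abbrev Time : Type := Fin 2 × ℕ+

/-- Formal power series in the times `t`. -/
abbrev PS : Type := MvPowerSeries Time ℂ

/-- Formal power series in two independent sets of times, `t` (left) and `t'` (right). -/
abbrev PS2 : Type := MvPowerSeries (Time ⊕ Time) ℂ

/-- `f(t)` as a series in `(t, t')`. -/
def atT (f : PS) : PS2 := MvPowerSeries.rename (Function.Embedding.inl : Time ↪ Time ⊕ Time) f

/-- `f(t')` as a series in `(t, t')`. -/
def atT' (f : PS) : PS2 := MvPowerSeries.rename (Function.Embedding.inr : Time ↪ Time ⊕ Time) f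

/-- The family `t^{(a)} - t'^{(a)}`. -/
def dT (a : Fin 2) : ℕ+ → PS2 := fun p =>
  MvPowerSeries.X (Sum.inl (a, p)) - MvPowerSeries.X (Sum.inr (a, p))

/-- The partial derivative with respect to a time. -/
def dt (s : Time) (f : PS) : PS := MvPowerSeries.pderiv ℂ s f

/-! ### Formal operators in the shift `Λ`, `Λ(f)(n) = f(n+1)` -/

/-- Formal operators `∑_{j ∈ ℤ} a_j(n) Λ^j`, infinite in both directions in general; `A j n` is the
coefficient `a_j(n)`. -/
abbrev ShiftOp : Type := ℤ → ℤ → PS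

/-- The composition `A · B`, with `Λ^i · b(n) = b(n+i) Λ^i`. The sum has finitely many nonzero terms
in all products that are used: both factors are bounded above in `Λ`, or both are bounded
below, or one of them is a finite sum. -/
def comp (A B : ShiftOp) : ShiftOp := fun k n => ∑ᶠ i : ℤ, A i n * B (k - i) (n + i)

/-- The monomial `Λ^j`. -/
def shift (j : ℤ) : ShiftOp := fun i _ => if i = j then 1 else 0

/-- The power `A^p`. -/
def opPow (A : ShiftOp) : ℕ → ShiftOp
  | 0 => shift 0
  | p + 1 => comp (opPow A p) A

/-- The commutator `[A, B]`. -/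
def comm (A B : ShiftOp) : ShiftOp := comp A B - comp B A

/-- The formal adjoint `(∑ a_j Λ^j)^* = ∑ Λ^{-j} a_j`. -/
def adj (A : ShiftOp) : ShiftOp := fun k n => A (-k) (n + k)

/-- The action of an operator on a function of `n`. -/
def act (A : ShiftOp) (f : ℤ → PS) : ℤ → PS := fun n => ∑ᶠ j : ℤ, A j n * f (n + j)

/-- The derivative of all coefficients of an operator with respect to a time. -/
def dtOp (s : Time) (A : ShiftOp) : ShiftOp := fun j n => dt s (A j n)

/-- The difference operator `Δ = Λ - 1`. -/
def Delta : ShiftOp := shift 1 - shift 0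

/-- `ι_Λ Δ^{-1} = -∑_{j ≥ 0} Λ^j`. -/
def iotaUp : ShiftOp := fun j _ => if 0 ≤ j then -1 else 0

/-- `ι_{Λ^{-1}} Δ^{-1} = ∑_{j ≥ 1} Λ^{-j}`. -/
def iotaDown : ShiftOp := fun j _ => if j ≤ -1 then 1 else 0

/-- `A_{Δ, ≥ 1}`, the part with positive powers of `Δ`, for `A = ∑ a_j Λ^j` bounded above in `Λ`.
As `Λ^j = (1 + Δ)^j`, a term with `j > 0` contributes `a_j (Λ^j - 1)`, and a term with `j ≤ 0`
contributes nothing. -/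
def truncDelta (A : ShiftOp) : ShiftOp := fun j n =>
  if 1 ≤ j then A j n else if j = 0 then -∑ᶠ (i : ℤ) (_ : 1 ≤ i), A i n else 0

/-- `A_{Δ^*, ≥ 1}`, the part with positive powers of `Δ^* = Λ^{-1} - 1`, for `A = ∑ a_j Λ^j` bounded
below in `Λ`. As `Λ^{-j} = (1 + Δ^*)^j`, a term with `j < 0` contributes `a_j (Λ^j - 1)`, and a term
with `j ≥ 0` contributes nothing. -/
def truncDeltaStar (A : ShiftOp) : ShiftOp := fun j n =>
  if j ≤ -1 then A j n else if j = 0 then -∑ᶠ (i : ℤ) (_ : i ≤ -1), A i n else 0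

/-! ### The Lax formulation -/

/-- `B_p^{(1)} = (L_1^p)_{Δ, ≥ 1}` and `B_p^{(2)} = (L_2^p)_{Δ^*, ≥ 1}`; the index `(0, p)` gives
`B_p^{(1)}` and `(1, p)` gives `B_p^{(2)}`. -/
def Bop (L1 L2 : ShiftOp) (s : Time) : ShiftOp :=
  if s.1 = 0 then truncDelta (opPow L1 s.2) else truncDeltaStar (opPow L2 s.2)

/-- The operator `∑_{l ∈ ℤ} ∑_i q_{i,n} Λ^l r_{i,n+1}`. -/
def sourceOp {m : ℕ} (q r : Fin m → ℤ → PS) : ShiftOp := fun l n =>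
  ∑ i, q i n * r i (n + l + 1)

/-- The Lax formulation of the GBMT hierarchy. -/
structure IsLaxSolution (M N : ℕ) {m : ℕ} (L1 L2 : ShiftOp) (q r : Fin m → ℤ → PS) : Prop where
  /-- `L_1 = u_{-1} Λ + ∑_{j ≥ 0} u_j Λ^{-j}`. -/
  form_one : ∀ j n : ℤ, 1 < j → L1 j n = 0
  lead_one : ∀ n : ℤ, L1 1 n ≠ 0
  /-- `L_2 = ū_{-1} Λ^{-1} + ∑_{j ≥ 0} ū_j Λ^j`. -/
  form_two : ∀ j n : ℤ, j < -1 → L2 j n = 0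
  lead_two : ∀ n : ℤ, L2 (-1) n ≠ 0
  constraint : comp (opPow L1 M) iotaDown = comp (opPow L2 N) iotaUp + sourceOp q r
  lax_one : ∀ s : Time, dtOp s L1 = comm (Bop L1 L2 s) L1
  lax_two : ∀ s : Time, dtOp s L2 = comm (Bop L1 L2 s) L2
  eigen : ∀ (s : Time) (i : Fin m) (n : ℤ), dt s (q i n) = act (Bop L1 L2 s) (q i) n
  /-- `Δ^{-1} B^*` is a finite sum and both expansions of `Δ^{-1}` give the same, as `B(1) = 0`. -/
  adjoint_eigen : ∀ (s : Time) (i : Fin m) (n : ℤ),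
    dt s (r i n) = -act (comp (comp iotaDown (adj (Bop L1 L2 s))) Delta) (r i) n

/-! ### Wave operators and wave functions -/

/-- Operators `S_1, S_2` together with operators `T_1, T_2`, meant to be their inverses. -/
structure WaveOps where
  S1 : ShiftOp
  T1 : ShiftOp
  S2 : ShiftOp
  T2 : ShiftOp

/-- `W` consists of wave operators `S_1 = ∑_{j ≥ 0} s_{1,j} Λ^{-j}`, `S_2 = ∑_{j ≥ 0} s_{2,j} Λ^j`
of the Lax operators `L_1, L_2`, with their inverses. -/
structure IsWaveOps (L1 L2 : ShiftOp) (W : WaveOps) : Prop where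
  form_S1 : ∀ j n : ℤ, 0 < j → W.S1 j n = 0
  form_T1 : ∀ j n : ℤ, 0 < j → W.T1 j n = 0
  form_S2 : ∀ j n : ℤ, j < 0 → W.S2 j n = 0
  form_T2 : ∀ j n : ℤ, j < 0 → W.T2 j n = 0
  S1_T1 : comp W.S1 W.T1 = shift 0
  T1_S1 : comp W.T1 W.S1 = shift 0
  S2_T2 : comp W.S2 W.T2 = shift 0
  T2_S2 : comp W.T2 W.S2 = shift 0
  dress_one : L1 = comp (comp W.S1 (shift 1)) W.T1
  dress_two : L2 = comp (comp W.S2 (shift (-1))) W.T2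
  evol_one_S1 : ∀ p : ℕ+,
    dtOp (0, p) W.S1 = comp (Bop L1 L2 (0, p)) W.S1 - comp W.S1 (shift (p : ℤ))
  evol_one_S2 : ∀ p : ℕ+, dtOp (0, p) W.S2 = comp (Bop L1 L2 (0, p)) W.S2
  evol_two_S1 : ∀ p : ℕ+, dtOp (1, p) W.S1 = comp (Bop L1 L2 (1, p)) W.S1
  evol_two_S2 : ∀ p : ℕ+,
    dtOp (1, p) W.S2 = comp (Bop L1 L2 (1, p)) W.S2 - comp W.S2 (shift (-(p : ℤ)))

/-- The coefficient of `z^j` in `A(z^n)`, where `Λ(z^n) = z^{n+1}`. -/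
def onZPow (A : ShiftOp) (n j : ℤ) : PS := A (j - n) n

/-- The coefficient of `z^j` in `A(z^{-n})`, where `Λ(z^{-n}) = z^{-n-1}`. -/
def onZNegPow (A : ShiftOp) (n j : ℤ) : PS := A (-j - n) n

/-- The coefficient of `z^j` in `e^{-ξ(t^{(1)},z)} Ψ_1(n,t,z) = S_1(z^n)`. -/
def Psi1 (W : WaveOps) (n j : ℤ) : PS := onZPow W.S1 n j

/-- The coefficient of `z^j` in `e^{ξ(t^{(1)},z)} Ψ_1^*(n,t,z) = -ι_Λ Δ^{-1} (S_1^*)^{-1}(z^{-n})`. -/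
def Psi1Star (W : WaveOps) (n j : ℤ) : PS := onZNegPow (-comp iotaUp (adj W.T1)) n j

/-- The coefficient of `z^j` in `e^{-ξ(t^{(2)},z^{-1})} Ψ_2(n,t,z) = S_2(z^n)`. -/
def Psi2 (W : WaveOps) (n j : ℤ) : PS := onZPow W.S2 n j

/-- The coefficient of `z^j` in
`e^{ξ(t^{(2)},z^{-1})} Ψ_2^*(n,t,z) = ι_{Λ^{-1}} Δ^{-1} (S_2^*)^{-1}(z^{-n})`. -/
def Psi2Star (W : WaveOps) (n j : ℤ) : PS := onZNegPow (comp iotaDown (adj W.T2)) n j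

/-! ### Formal contour integrals -/

/-- `ξ(x, w) = ∑_{p ≥ 1} x_p w^p`. -/
def xi (x : ℕ+ → PS2) : PowerSeries PS2 :=
  PowerSeries.mk fun k => if h : 0 < k then x ⟨k, h⟩ else 0

/-- The coefficient of `w^k` in `e^{ξ(x, w)}`. -/
def expXi (x : ℕ+ → PS2) (k : ℤ) : PS2 :=
  if 0 ≤ k then PowerSeries.coeff k.toNat ((PowerSeries.exp ℚ).subst (xi x)) else 0

/-- The integral `∮_{C_∞} dz/(2πiz) (∑ c_i z^i) (∑ d_j z^j) e^{ξ(x,z)}`, that is the coefficient of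
`z^0`. The sum is taken for each monomial in `(t, t')` separately, where it is finite if `c`, `d` are
bounded above and `x` is one of the families `± (t^{(a)} - t'^{(a)})`. -/
def intInf (c d : ℤ → PS2) (x : ℕ+ → PS2) : PS2 := fun μ =>
  ∑ᶠ ij : ℤ × ℤ, MvPowerSeries.coeff μ (c ij.1 * d ij.2 * expXi x (-(ij.1 + ij.2)))

/-- The integral `∮_{C_0} dz/(2πiz) (∑ c_i z^i) (∑ d_j z^j) e^{ξ(x,z^{-1})}`, that is the coefficient
of `z^0`; here `c`, `d` are bounded below. -/
def intZero (c d : ℤ → PS2) (x : ℕ+ → PS2) : PS2 := fun μ =>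
  ∑ᶠ ij : ℤ × ℤ, MvPowerSeries.coeff μ (c ij.1 * d ij.2 * expXi x (ij.1 + ij.2))

/-- Multiplication of `∑ c_i z^i` by `z^e`. -/
def zMul {R : Type} (e : ℤ) (c : ℤ → R) : ℤ → R := fun i => c (i - e)

/-! ### Bilinear identities for the wave functions

The factors `e^{± ξ}` of `Ψ_a`, `Ψ_a^*` do not depend on `n`; in each product the two of them combine
to `e^{± ξ(t - t')}`. -/

/-- The spectral representation of `q_n`. -/
def WaveIdentityQ (W : WaveOps) (q : ℤ → PS) : Prop := ∀ n n' : ℤ,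
  intInf (fun j => atT (act iotaUp (fun k => (q (k + 1) - q k) * Psi1Star W (k + 1) j) n))
      (fun j => atT' (Psi1 W n' j)) (-dT 0)
    + intZero (fun j => atT (act iotaDown (fun k => (q (k + 1) - q k) * Psi2Star W (k + 1) j) n))
      (fun j => atT' (Psi2 W n' j)) (-dT 1)
    = atT (q n) - atT' (q n')

/-- The spectral representation of `r_n`. -/
def WaveIdentityR (W : WaveOps) (r : ℤ → PS) : Prop := ∀ n n' : ℤ,
  intInf (fun j => atT (act iotaDown (fun k => (r (k + 1) - r k) * Psi1 W k j) n))
      (fun j => atT' (Psi1Star W n' j)) (dT 0)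
    + intZero (fun j => atT (act iotaUp (fun k => (r (k + 1) - r k) * Psi2 W k j) n))
      (fun j => atT' (Psi2Star W n' j)) (dT 1)
    = atT (r n) - atT' (r n')

/-- The bilinear identity that corresponds to the constraint. -/
def WaveIdentityConstraint (M N : ℕ) {m : ℕ} (W : WaveOps) (q r : Fin m → ℤ → PS) : Prop :=
  ∀ n n' : ℤ,
    intInf (zMul M fun j => atT (Psi1 W n j)) (fun j => atT' (Psi1Star W n' j)) (dT 0)
      + intZero (zMul (-N) fun j => atT (Psi2 W n j)) (fun j => atT' (Psi2Star W n' j)) (dT 1)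
      = ∑ i, atT (q i n) * atT' (r i n')

/-! ### Tau functions -/

/-- The substitution `t^{(a)}_p ↦ t^{(a)}_p + ε w^p / p`, other times fixed; `w` is the variable with
index `none`. -/
def miwa (a : Fin 2) (ε : ℂ) : Time → MvPowerSeries (Option Time) ℂ := fun s =>
  MvPowerSeries.X (some s) +
    if s.1 = a then
      MvPowerSeries.C (ε / ((s.2 : ℕ) : ℂ)) * MvPowerSeries.X none ^ (s.2 : ℕ)
    else 0

/-- The coefficient of `w^k` in `f(t + ε [w]_a)`, where `[w] = (w, w^2/2, w^3/3, …)`. -/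
def miwaCoeff (a : Fin 2) (ε : ℂ) (f : PS) (k : ℕ) : PS := fun μ =>
  MvPowerSeries.coeff (μ.embDomain Function.Embedding.some + Finsupp.single none k)
    (MvPowerSeries.subst (miwa a ε) f)

/-- The coefficient of `z^j` in `f(t + ε [z^{-1}]_1)`. -/
def shiftOne (ε : ℂ) (f : PS) (j : ℤ) : PS := if j ≤ 0 then miwaCoeff 0 ε f (-j).toNat else 0

/-- The coefficient of `z^j` in `f(t + ε [z]_2)`. -/
def shiftTwo (ε : ℂ) (f : PS) (j : ℤ) : PS := if 0 ≤ j then miwaCoeff 1 ε f j.toNat else 0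

/-- `(τ_0, τ_1)` is a tau pair of the wave functions:
`Ψ_1 = τ_{0,n}(t - [z^{-1}]_1) / τ_{1,n}(t) z^n e^{ξ(t^{(1)},z)}`,
`Ψ_1^* = τ_{1,n}(t + [z^{-1}]_1) / τ_{0,n}(t) z^{-n} e^{-ξ(t^{(1)},z)}`,
`Ψ_2 = τ_{0,n+1}(t - [z]_2) / τ_{1,n}(t) z^n e^{ξ(t^{(2)},z^{-1})}`,
`Ψ_2^* = τ_{1,n-1}(t + [z]_2) / τ_{0,n}(t) z^{1-n} e^{-ξ(t^{(2)},z^{-1})}`. -/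
structure IsTauPair (W : WaveOps) (τ0 τ1 : ℤ → PS) : Prop where
  unit_zero : ∀ n, IsUnit (τ0 n)
  unit_one : ∀ n, IsUnit (τ1 n)
  psi1 : ∀ n j, Psi1 W n j * τ1 n = zMul n (shiftOne (-1) (τ0 n)) j
  psi1_star : ∀ n j, Psi1Star W n j * τ0 n = zMul (-n) (shiftOne 1 (τ1 n)) j
  psi2 : ∀ n j, Psi2 W n j * τ1 n = zMul n (shiftTwo (-1) (τ0 (n + 1))) j
  psi2_star : ∀ n j, Psi2Star W n j * τ0 n = zMul (1 - n) (shiftTwo 1 (τ1 (n - 1))) j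

/-- The bilinear expression
`∮_{C_∞} dz/(2πiz) z^{e₁+n-n'} f_n(t-[z^{-1}]_1) g_{n'}(t'+[z^{-1}]_1) e^{ξ(t^{(1)}-t'^{(1)},z)}
 + ∮_{C_0} dz/(2πiz) z^{e₂+n-n'+1} f_{n+1}(t-[z]_2) g_{n'-1}(t'+[z]_2) e^{ξ(t^{(2)}-t'^{(2)},z^{-1})}`.
-/
def tauPairing (e₁ e₂ : ℤ) (f g : ℤ → PS) (n n' : ℤ) : PS2 :=
  intInf (zMul (e₁ + n - n') fun j => atT (shiftOne (-1) (f n) j))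
      (fun j => atT' (shiftOne 1 (g n') j)) (dT 0)
    + intZero (zMul (e₂ + n - n' + 1) fun j => atT (shiftTwo (-1) (f (n + 1)) j))
      (fun j => atT' (shiftTwo 1 (g (n' - 1)) j)) (dT 1)

/-- The bilinear equations of the GBMT hierarchy in terms of tau functions. -/
structure IsTauSolution (M N : ℕ) {m : ℕ} (τ0 τ1 : ℤ → PS) (ρ σ : Fin m → ℤ → PS) : Prop where
  constraint : ∀ n n' : ℤ,
    tauPairing M (-N) τ0 τ1 n n' = ∑ i, atT (ρ i n) * atT' (σ i n')
  rho : ∀ (i : Fin m) (n n' : ℤ),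
    tauPairing 0 0 τ0 (ρ i) n n' = atT (ρ i n) * atT' (τ0 n')
  sigma : ∀ (i : Fin m) (n n' : ℤ),
    tauPairing 0 0 (σ i) τ1 n n' = atT (τ1 n) * atT' (σ i n')
  mToda : ∀ n n' : ℤ,
    tauPairing 0 0 τ0 τ1 n n' = atT (τ1 n) * atT' (τ0 n')

end GBMT

end

noncomputable section

namespace GBMT

/-! An operator `∑ a_j Λ^j` is treated as the matrix with entry `a_j(n)` at `(n, n + j)`. Both sets
of times are handled together by an index `a : Fin 2`: `a = 0` belongs to the expansion at `z = ∞`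
and to matrices bounded above, `a = 1` to the expansion at `z = 0` and to matrices bounded below.
Wave functions are the rows of `S a`, dual wave functions the columns of `T a * half a` with `T a`
inverse to `S a`. Here `half 0` and `half 1` are the lower and the strictly upper triangular matrix
of ones; up to a sign and a shift they are the two expansions of `Δ^{-1}`, and their sum has all
entries equal to `1`. The operators `B_s` annihilate constants, hence this sum, and the constraint
becomes `L_1^M * half 0 + L_2^N * half 1 = ∑ q_i ⊗ r_i`.

From Lax to bilinear equations: at `t' = t` the formal integrals become matrix products, and each
bilinear identity reduces to `half_add_half` or to the constraint. For general `t, t'` both sides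
solve the same linear system in one set of times, and a solution that vanishes at `t' = t` vanishes
(`eq_zero_of_flow`).

Existence of wave operators: the curvature of the `B_s` has order at most `0` in both directions, so
it is diagonal; it annihilates constants, so it is zero (`IsLaxPair.curv_eq_zero`). The flat
connection `B_s - L^p` then has a horizontal column (`exists_solution`, `exists_column`), and the
images of this column under the powers of `L` are the columns of `S` (`IsLaxPair.exists_dressing`).

Existence of tau functions: the quotient `S(t - [z]_a) (1 - z Λ^{±1}) S(t)^{-1}`, with the middle
factor only for the type `a`, has the same entries for both types, hence only two non-zero diagonals
(`IsDressed.exists_shift_eq`). The resulting relations between shifted and neighbouring wave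
functions give a symmetry in two spectral variables. This is the compatibility condition under which
a family of series has the form `τ(t - [z]_a) / τ(t)` (`exists_potential`). The bilinear identity at
shifted times says that a wave function times the suitably shifted dual one is `1`, so the relations
for the dual wave functions need no separate construction.

Conversely, tau functions define `S` and candidates `P` for the dual wave functions. At equal times
the last bilinear equation says that `S 0 * P 0` and `S 1 * P 1` add up to the matrix of ones, and
their triangular shapes force `S a * P a = half a`. Its derivative at `t' = t` gives the evolution
of `S`, with `B_s` recognised as the truncation of `L^p` by its shape (`isDressed_of_opPairing`).
The other equations give the eigenfunctions, the adjoint eigenfunctions and the constraint. -/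

open MvPowerSeries in
/-- An additive map between power series rings is local if each coefficient of the image depends on
finitely many coefficients of the argument. -/
def IsLocal {σ τ : Type*} (Φ : MvPowerSeries σ ℂ →+ MvPowerSeries τ ℂ) : Prop :=
  ∀ μ : τ →₀ ℕ, ∃ D : Finset (σ →₀ ℕ), ∀ f, (∀ d ∈ D, coeff d f = 0) → coeff μ (Φ f) = 0

/-! ### Local additive maps between power series rings -/

namespace IsLocal

open MvPowerSeries

variable {σ τ υ : Type*}

theorem comp {Ψ : MvPowerSeries τ ℂ →+ MvPowerSeries υ ℂ} {Φ : MvPowerSeries σ ℂ →+ MvPowerSeries τ ℂ}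
    (hΨ : IsLocal Ψ) (hΦ : IsLocal Φ) : IsLocal (Ψ.comp Φ) := by
  classical
  intro μ
  obtain ⟨D, hD⟩ := hΨ μ
  choose E hE using hΦ
  exact ⟨D.biUnion E, fun f hf => hD _ fun d hd => hE d f fun e he =>
    hf e (Finset.mem_biUnion.2 ⟨d, hd, he⟩)⟩

theorem add {Φ Ψ : MvPowerSeries σ ℂ →+ MvPowerSeries τ ℂ} (hΦ : IsLocal Φ) (hΨ : IsLocal Ψ) :
    IsLocal (Φ + Ψ) := by
  classical
  intro μ
  obtain ⟨D, hD⟩ := hΦ μ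
  obtain ⟨E, hE⟩ := hΨ μ
  refine ⟨D ∪ E, fun f hf => ?_⟩
  simp [hD f fun d hd => hf d (Finset.mem_union_left _ hd),
    hE f fun d hd => hf d (Finset.mem_union_right _ hd)]

theorem zero : IsLocal (0 : MvPowerSeries σ ℂ →+ MvPowerSeries τ ℂ) :=
  fun _ => ⟨∅, fun _ _ => rfl⟩

theorem id : IsLocal (AddMonoidHom.id (MvPowerSeries σ ℂ)) :=
  fun μ => ⟨{μ}, fun _ hf => hf μ (Finset.mem_singleton_self μ)⟩

theorem sum {ι : Type*} (s : Finset ι) {Φ : ι → MvPowerSeries σ ℂ →+ MvPowerSeries τ ℂ}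
    (h : ∀ i ∈ s, IsLocal (Φ i)) : IsLocal (∑ i ∈ s, Φ i) := by
  classical
  induction s using Finset.induction_on with
  | empty => simpa using zero
  | insert a s ha ih =>
    rw [Finset.sum_insert ha]
    exact (h a (Finset.mem_insert_self a s)).add (ih fun i hi => h i (Finset.mem_insert_of_mem hi))

theorem mulLeft (a : MvPowerSeries σ ℂ) : IsLocal (AddMonoidHom.mulLeft a) := by
  classical
  intro μ
  refine ⟨(Finset.HasAntidiagonal.antidiagonal μ).image Prod.snd, fun f hf => ?_⟩
  rw [AddMonoidHom.coe_mulLeft, coeff_mul]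
  exact Finset.sum_eq_zero fun p hp => by rw [hf p.2 (Finset.mem_image_of_mem _ hp), mul_zero]

theorem pderiv (s : σ) : IsLocal (pderiv ℂ s).toLinearMap.toAddMonoidHom := by
  intro μ
  refine ⟨{μ + Finsupp.single s 1}, fun f hf => ?_⟩
  change coeff μ (MvPowerSeries.pderiv ℂ s f) = 0
  rw [coeff_pderiv, hf _ (Finset.mem_singleton_self _), zero_mul]

theorem rename (e : σ → τ) [Filter.TendstoCofinite e] :
    IsLocal (rename (R := ℂ) e).toAddMonoidHom := by
  intro μ
  refine ⟨(Filter.TendstoCofinite.finite_preimage_singleton (Finsupp.mapDomain e) μ).toFinset,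
    fun f hf => ?_⟩
  change coeff μ (MvPowerSeries.rename (R := ℂ) e f) = 0
  rw [coeff_rename]
  exact Finset.sum_eq_zero hf

theorem subst {a : σ → MvPowerSeries τ ℂ} (ha : HasSubst a) :
    IsLocal (substAlgHom (R := ℂ) ha).toAddMonoidHom := by
  intro μ
  -- The finiteness of substitution, applied to the series with all coefficients `1`, bounds the
  -- relevant monomials uniformly in `f`.
  have hfin : {d : σ →₀ ℕ | coeff μ (d.prod fun s e => a s ^ e) ≠ 0}.Finite := by
    refine (coeff_subst_finite ha (fun _ => (1 : ℂ) : MvPowerSeries σ ℂ) μ).subset fun d hd => ?_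
    change (1 : ℂ) • _ ≠ 0
    rwa [one_smul]
  refine ⟨hfin.toFinset, fun f hf => ?_⟩
  change coeff μ (substAlgHom (R := ℂ) ha f) = 0
  rw [substAlgHom_apply, coeff_subst ha]
  refine finsum_eq_zero_of_forall_eq_zero fun d => ?_
  by_cases hd : coeff μ (d.prod fun s e => a s ^ e) = 0
  · rw [hd, smul_zero]
  · rw [hf d (hfin.mem_toFinset.2 hd), zero_smul]

/-- A local map that vanishes on monomials vanishes. -/
theorem eq_zero {Φ : MvPowerSeries σ ℂ →+ MvPowerSeries τ ℂ} (hΦ : IsLocal Φ)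
    {μ : τ →₀ ℕ} (h : ∀ d r, coeff μ (Φ (monomial d r)) = 0) (f : MvPowerSeries σ ℂ) :
    coeff μ (Φ f) = 0 := by
  classical
  obtain ⟨D, hD⟩ := hΦ μ
  -- After the terms in `D` are removed, the coefficient at `μ` of the image does not see the rest,
  -- so `f` may be replaced by a polynomial.
  have h1 := hD (f - ∑ d ∈ D, monomial d (coeff d f)) fun d hd => by
    rw [map_sub, map_sum, Finset.sum_eq_single_of_mem d hd, coeff_monomial_same, sub_self]
    intro b _ hb
    rw [coeff_monomial_ne hb.symm]
  rw [map_sub, map_sum, map_sub, map_sum, sub_eq_zero] at h1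
  rw [h1]
  exact Finset.sum_eq_zero fun d _ => h d _

end IsLocal

/-! ### Locally finite sums -/

section LocallyFinite

open MvPowerSeries

variable {σ τ ι κ : Type*}

/-- Each monomial occurs in finitely many members of the family. -/
def LocFin (f : ι → MvPowerSeries σ ℂ) : Prop := ∀ μ, {i | coeff μ (f i) ≠ 0}.Finite

/-- The sum of a locally finite family. -/
def lsum (f : ι → MvPowerSeries σ ℂ) : MvPowerSeries σ ℂ := fun μ => ∑ᶠ i, coeff μ (f i)

theorem coeff_lsum (f : ι → MvPowerSeries σ ℂ) (μ : σ →₀ ℕ) :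
    coeff μ (lsum f) = ∑ᶠ i, coeff μ (f i) := rfl

theorem LocFin.finite_union {f : ι → MvPowerSeries σ ℂ} (hf : LocFin f) (D : Finset (σ →₀ ℕ)) :
    {i | ∃ d ∈ D, coeff d (f i) ≠ 0}.Finite := by
  have : {i | ∃ d ∈ D, coeff d (f i) ≠ 0} = ⋃ d ∈ D, {i | coeff d (f i) ≠ 0} := by
    ext i; simp
  rw [this]
  exact D.finite_toSet.biUnion fun d _ => hf d

theorem LocFin.map {f : ι → MvPowerSeries σ ℂ} (hf : LocFin f)
    {Φ : MvPowerSeries σ ℂ →+ MvPowerSeries τ ℂ} (hΦ : IsLocal Φ) : LocFin fun i => Φ (f i) := by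
  intro μ
  obtain ⟨D, hD⟩ := hΦ μ
  refine (hf.finite_union D).subset fun i hi => ?_
  by_contra hc
  simp only [Set.mem_ofPred_eq, not_exists, not_and, not_not] at hc
  exact hi (hD _ hc)

/-- Locality plays the role of continuity: a coefficient of the image sees finitely many
coefficients of the sum, and only finitely many members contribute to these, so the sum can be
replaced by a finite one. -/
theorem map_lsum {f : ι → MvPowerSeries σ ℂ} (hf : LocFin f)
    {Φ : MvPowerSeries σ ℂ →+ MvPowerSeries τ ℂ} (hΦ : IsLocal Φ) :
    Φ (lsum f) = lsum fun i => Φ (f i) := by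
  ext μ
  obtain ⟨D, hD⟩ := hΦ μ
  have hF := hf.finite_union D
  have h1 := hD (lsum f - ∑ i ∈ hF.toFinset, f i) fun d hd => by
    rw [map_sub, map_sum, coeff_lsum, finsum_eq_sum_of_support_subset (s := hF.toFinset), sub_self]
    intro i hi
    simpa using ⟨d, hd, hi⟩
  rw [map_sub, map_sum, map_sub, map_sum, sub_eq_zero] at h1
  rw [h1, coeff_lsum, finsum_eq_sum_of_support_subset]
  intro i hi
  by_contra hc
  simp only [Set.Finite.coe_toFinset, Set.mem_ofPred_eq, not_exists, not_and, not_not] at hc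
  exact hi (hD _ hc)

theorem LocFin.add {f g : ι → MvPowerSeries σ ℂ} (hf : LocFin f) (hg : LocFin g) :
    LocFin fun i => f i + g i := fun μ => ((hf μ).union (hg μ)).subset fun i hi => by
  by_contra hc
  simp only [Set.mem_union, Set.mem_ofPred_eq, not_or, not_not] at hc
  exact hi (by rw [map_add, hc.1, hc.2, add_zero])

theorem lsum_add {f g : ι → MvPowerSeries σ ℂ} (hf : LocFin f) (hg : LocFin g) :
    lsum (fun i => f i + g i) = lsum f + lsum g := by
  ext μ
  rw [map_add, coeff_lsum, coeff_lsum, coeff_lsum, ← finsum_add_distrib (hf μ) (hg μ)]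
  simp

theorem lsum_mul_left (a : MvPowerSeries σ ℂ) {f : ι → MvPowerSeries σ ℂ} (hf : LocFin f) :
    lsum (fun i => a * f i) = a * lsum f :=
  (map_lsum hf (IsLocal.mulLeft a)).symm

theorem LocFin.mul_left (a : MvPowerSeries σ ℂ) {f : ι → MvPowerSeries σ ℂ} (hf : LocFin f) :
    LocFin fun i => a * f i :=
  hf.map (IsLocal.mulLeft a)

theorem lsum_equiv (e : ι ≃ κ) (f : κ → MvPowerSeries σ ℂ) : lsum (fun i => f (e i)) = lsum f := by
  ext μ
  exact finsum_comp_equiv (f := fun i => coeff μ (f i)) e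

theorem LocFin.equiv (e : ι ≃ κ) {f : κ → MvPowerSeries σ ℂ} (hf : LocFin f) :
    LocFin fun i => f (e i) := fun μ => (hf μ).preimage e.injective.injOn

theorem LocFin.zero : LocFin fun _ : ι => (0 : MvPowerSeries σ ℂ) := fun μ => by simp

theorem lsum_zero : lsum (fun _ : ι => (0 : MvPowerSeries σ ℂ)) = 0 := by
  ext μ; simp [coeff_lsum]

theorem LocFin.sum {s : Finset κ} {f : κ → ι → MvPowerSeries σ ℂ} (hf : ∀ k ∈ s, LocFin (f k)) :
    LocFin fun i => ∑ k ∈ s, f k i := by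
  classical
  induction s using Finset.induction_on with
  | empty => simpa using LocFin.zero
  | insert a s ha ih =>
    simp only [Finset.sum_insert ha]
    exact (hf a (Finset.mem_insert_self a s)).add (ih fun i hi => hf i (Finset.mem_insert_of_mem hi))

theorem lsum_sum {s : Finset κ} {f : κ → ι → MvPowerSeries σ ℂ} (hf : ∀ k ∈ s, LocFin (f k)) :
    lsum (fun i => ∑ k ∈ s, f k i) = ∑ k ∈ s, lsum (f k) := by
  classical
  induction s using Finset.induction_on with
  | empty => simpa using lsum_zero
  | insert a s ha ih =>
    have hs : ∀ k ∈ s, LocFin (f k) := fun i hi => hf i (Finset.mem_insert_of_mem hi)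
    simp only [Finset.sum_insert ha]
    rw [lsum_add (hf a (Finset.mem_insert_self a s)) (LocFin.sum hs), ih hs]

end LocallyFinite

end GBMT

namespace GBMT

/-! ### Shifts of Miwa type, `f ↦ exp(ε ∑ w^p ∂_p / p) f` -/

section Miwa

set_option linter.unusedSectionVars false

open PowerSeries
open Finset hiding antidiagonal mem_antidiagonal
open Finset.HasAntidiagonal

variable {A : Type*} [CommRing A] [Algebra ℂ A]

/-- The coefficientwise action of a derivation on power series. -/
def coeffDer (δ : Derivation ℂ A A) : Derivation ℂ A⟦X⟧ A⟦X⟧ :=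
  Derivation.mk'
    { toFun := fun F => PowerSeries.mk fun k => δ (coeff k F)
      map_add' := fun F G => by ext; simp
      map_smul' := fun c F => by ext; simp }
    fun F G => by
      ext k
      simp only [LinearMap.coe_mk, AddHom.coe_mk, coeff_mk, coeff_mul, map_sum, Derivation.leibniz,
        sum_add_distrib, smul_eq_mul, map_add]
      congr 1
      rw [← Nat.sum_antidiagonal_swap]
      rfl

@[simp] theorem coeff_coeffDer (δ : Derivation ℂ A A) (F : A⟦X⟧) (k : ℕ) :
    coeff k (coeffDer δ F) = δ (coeff k F) := by
  simp [coeffDer]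

theorem coeffDer_C (δ : Derivation ℂ A A) (f : A) : coeffDer δ (C f) = C (δ f) := by
  ext k
  rw [coeff_coeffDer, coeff_C, coeff_C]
  split_ifs <;> simp

/-- `∑_p w^{p-1} ∂_p`, where `d i` stands for `∂_{i+1}`. -/
def genDer (d : ℕ → Derivation ℂ A A) : Derivation ℂ A⟦X⟧ A⟦X⟧ :=
  -- Up to degree `k` the infinite sum of derivations agrees with a finite one, for which the
  -- Leibniz rule is available.
  have key (F : A⟦X⟧) (j k : ℕ) (h : j ≤ k) :
      ∑ p ∈ antidiagonal j, d p.1 (coeff p.2 F) =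
        coeff j (∑ i ∈ range (k + 1), X ^ i * coeffDer (d i) F) := by
    simp only [map_sum, coeff_X_pow_mul', coeff_coeffDer]
    rw [← sum_filter, Nat.sum_antidiagonal_eq_sum_range_succ_mk]
    refine sum_congr ?_ fun _ _ => rfl
    ext i; simp; omega
  Derivation.mk'
    { toFun := fun F => PowerSeries.mk fun k => ∑ p ∈ antidiagonal k, d p.1 (coeff p.2 F)
      map_add' := fun F G => by ext; simp [sum_add_distrib]
      map_smul' := fun c F => by ext; simp [smul_sum] }
    fun F G => by
      ext k
      simp only [LinearMap.coe_mk, AddHom.coe_mk, coeff_mk, smul_eq_mul, map_add]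
      have key2 (F G : A⟦X⟧) : ∑ x ∈ antidiagonal k, coeff x.1 F *
          coeff x.2 (PowerSeries.mk fun k => ∑ p ∈ antidiagonal k, d p.1 (coeff p.2 G)) =
          coeff k (F * ∑ i ∈ range (k + 1), X ^ i * coeffDer (d i) G) := by
        rw [coeff_mul]
        refine sum_congr rfl fun p hp => ?_
        rw [coeff_mk, key G p.2 k ((Nat.le_add_left _ _).trans_eq (mem_antidiagonal.1 hp))]
      rw [key _ k k le_rfl, coeff_mul, coeff_mul, key2, key2, ← map_add, mul_sum, mul_sum,
        ← sum_add_distrib]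
      congr 1
      refine sum_congr rfl fun i _ => ?_
      rw [Derivation.leibniz, smul_eq_mul, smul_eq_mul]
      ring

theorem coeff_genDer (d : ℕ → Derivation ℂ A A) (F : A⟦X⟧) (k : ℕ) :
    coeff k (genDer d F) = ∑ p ∈ antidiagonal k, d p.1 (coeff p.2 F) := by
  simp [genDer]

/-- `d/dw - ε ∑_p w^{p-1} ∂_p`, which annihilates the shifts of Miwa type. -/
def miwaDer (d : ℕ → Derivation ℂ A A) (ε : ℂ) : Derivation ℂ A⟦X⟧ A⟦X⟧ :=
  (derivative A).restrictScalars ℂ - ε • genDer d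

theorem miwaDer_apply (d : ℕ → Derivation ℂ A A) (ε : ℂ) (F : A⟦X⟧) :
    miwaDer d ε F = derivative A F - ε • genDer d F := rfl

theorem coeff_miwaDer (d : ℕ → Derivation ℂ A A) (ε : ℂ) (F : A⟦X⟧) (k : ℕ) :
    coeff k (miwaDer d ε F) =
      coeff (k + 1) F * (k + 1) - ε • ∑ p ∈ antidiagonal k, d p.1 (coeff p.2 F) := by
  rw [miwaDer_apply, map_sub, coeff_derivative, PowerSeries.coeff_smul, coeff_genDer]

theorem cast_succ_mul_cancel {x y : A} (k : ℕ) (h : x * ((k : A) + 1) = y * ((k : A) + 1)) :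
    x = y := by
  have hk : ((k : ℂ) + 1) ≠ 0 := by exact_mod_cast Nat.succ_ne_zero k
  have h2 : ((k : A) + 1) * algebraMap ℂ A ((k : ℂ) + 1)⁻¹ = 1 := by
    have : ((k : A) + 1) = algebraMap ℂ A ((k : ℂ) + 1) := by simp
    rw [this, ← map_mul, mul_inv_cancel₀ hk, map_one]
  calc x = x * ((k : A) + 1) * algebraMap ℂ A ((k : ℂ) + 1)⁻¹ := by rw [mul_assoc, h2, mul_one]
    _ = y := by rw [h, mul_assoc, h2, mul_one]

/-- A series annihilated by `miwaDer` is determined by its constant coefficient. -/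
theorem eq_of_miwaDer {d : ℕ → Derivation ℂ A A} {ε : ℂ} {F G : A⟦X⟧}
    (h : miwaDer d ε F = miwaDer d ε G) (h0 : coeff 0 F = coeff 0 G) : F = G := by
  ext k
  induction k using Nat.strong_induction_on with
  | _ k ih =>
    cases k with
    | zero => exact h0
    | succ k =>
      have h1 := congrArg (coeff k) h
      rw [coeff_miwaDer, coeff_miwaDer] at h1
      have h2 : ∑ p ∈ antidiagonal k, d p.1 (coeff p.2 F) =
          ∑ p ∈ antidiagonal k, d p.1 (coeff p.2 G) :=
        sum_congr rfl fun p hp => by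
          rw [ih p.2 (Nat.lt_succ_of_le ((Nat.le_add_left _ _).trans_eq (mem_antidiagonal.1 hp)))]
      rw [h2] at h1
      exact cast_succ_mul_cancel k (sub_left_injective h1)

/-- The coefficients of `exp(ε ∑ w^p ∂_p / p) f`. -/
def miwaSeq (d : ℕ → Derivation ℂ A A) (ε : ℂ) (f : A) : ℕ → A
  | 0 => f
  | k + 1 => ((k : ℂ) + 1)⁻¹ • ε • ∑ i : Fin (k + 1), d i (miwaSeq d ε f (k - i))

theorem miwaDer_mk_miwaSeq (d : ℕ → Derivation ℂ A A) (ε : ℂ) (f : A) :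
    miwaDer d ε (PowerSeries.mk (miwaSeq d ε f)) = 0 := by
  ext k
  have hk : ((k : ℂ) + 1) ≠ 0 := by exact_mod_cast Nat.succ_ne_zero k
  rw [coeff_miwaDer, coeff_mk, miwaSeq, map_zero, sub_eq_zero]
  simp only [coeff_mk]
  rw [Nat.sum_antidiagonal_eq_sum_range_succ_mk, Finset.sum_range]
  have : ((k : A) + 1) = algebraMap ℂ A ((k : ℂ) + 1) := by simp
  rw [this, mul_comm, ← Algebra.smul_def, smul_smul, mul_inv_cancel₀ hk, one_smul]

/-- The ring homomorphism `f ↦ exp(ε ∑ w^p ∂_p / p) f`. -/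
def miwaHom (d : ℕ → Derivation ℂ A A) (ε : ℂ) : A →+* A⟦X⟧ where
  toFun f := PowerSeries.mk (miwaSeq d ε f)
  -- All laws of a ring homomorphism follow from uniqueness: both sides are annihilated by the
  -- derivation `miwaDer` and have the same constant coefficient.
  map_one' := eq_of_miwaDer (d := d) (ε := ε) (by rw [miwaDer_mk_miwaSeq, Derivation.map_one_eq_zero])
    (by simp [miwaSeq])
  map_mul' f g := eq_of_miwaDer (d := d) (ε := ε)
    (by rw [Derivation.leibniz, miwaDer_mk_miwaSeq, miwaDer_mk_miwaSeq, miwaDer_mk_miwaSeq]; simp)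
    (by simp [miwaSeq, coeff_mul])
  map_zero' := eq_of_miwaDer (d := d) (ε := ε) (by rw [miwaDer_mk_miwaSeq, map_zero])
    (by simp [miwaSeq])
  map_add' f g := eq_of_miwaDer (d := d) (ε := ε)
    (by rw [map_add, miwaDer_mk_miwaSeq, miwaDer_mk_miwaSeq, miwaDer_mk_miwaSeq, add_zero])
    (by simp [miwaSeq])

theorem miwaDer_miwaHom (d : ℕ → Derivation ℂ A A) (ε : ℂ) (f : A) :
    miwaDer d ε (miwaHom d ε f) = 0 := miwaDer_mk_miwaSeq d ε f

@[simp] theorem coeff_zero_miwaHom (d : ℕ → Derivation ℂ A A) (ε : ℂ) (f : A) :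
    coeff 0 (miwaHom d ε f) = f := by
  change coeff 0 (PowerSeries.mk (miwaSeq d ε f)) = f
  rw [coeff_mk, miwaSeq]

theorem eq_miwaHom {d : ℕ → Derivation ℂ A A} {ε : ℂ} {f : A} {F : A⟦X⟧}
    (h : miwaDer d ε F = 0) (h0 : coeff 0 F = f) : F = miwaHom d ε f :=
  eq_of_miwaDer (h.trans (miwaDer_miwaHom d ε f).symm) (h0.trans (coeff_zero_miwaHom d ε f).symm)

theorem miwaHom_succ (d : ℕ → Derivation ℂ A A) (ε : ℂ) (f : A) (k : ℕ) :
    coeff (k + 1) (miwaHom d ε f) * (k + 1) =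
      ε • ∑ p ∈ antidiagonal k, d p.1 (coeff p.2 (miwaHom d ε f)) := by
  have := congrArg (coeff k) (miwaDer_miwaHom d ε f)
  rwa [coeff_miwaDer, map_zero, sub_eq_zero] at this

theorem miwaDer_coeffDer {d : ℕ → Derivation ℂ A A} {δ : Derivation ℂ A A}
    (hδ : ∀ i f, d i (δ f) = δ (d i f)) (ε : ℂ) (F : A⟦X⟧) :
    miwaDer d ε (coeffDer δ F) = coeffDer δ (miwaDer d ε F) := by
  ext k
  have h1 : δ ((k : A) + 1) = 0 := by
    have : ((k : A) + 1) = algebraMap ℂ A ((k : ℂ) + 1) := by simp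
    rw [this, Derivation.map_algebraMap]
  rw [coeff_miwaDer, coeff_coeffDer, coeff_coeffDer, coeff_miwaDer, map_sub, Derivation.leibniz, h1,
    Derivation.map_smul, map_sum, smul_zero, zero_add, smul_eq_mul, mul_comm]
  simp only [coeff_coeffDer, hδ]

theorem miwaHom_der {d : ℕ → Derivation ℂ A A} {δ : Derivation ℂ A A}
    (hδ : ∀ i f, d i (δ f) = δ (d i f)) (ε : ℂ) (f : A) :
    miwaHom d ε (δ f) = coeffDer δ (miwaHom d ε f) :=
  (eq_miwaHom (by rw [miwaDer_coeffDer hδ, miwaDer_miwaHom, map_zero]) (by simp)).symm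

theorem miwaHom_const {d : ℕ → Derivation ℂ A A} {f : A} (hf : ∀ i, d i f = 0) (ε : ℂ) :
    miwaHom d ε f = C f := by
  refine (eq_miwaHom ?_ (by simp)).symm
  ext k
  rw [coeff_miwaDer, coeff_C, if_neg (Nat.succ_ne_zero k), zero_mul, map_zero, zero_sub, neg_eq_zero,
    sum_eq_zero, smul_zero]
  intro p _
  rw [coeff_C]
  split_ifs <;> simp [hf]

/-- The evaluation `∑ F_j y^j ↦ ∑ F_j z^j` of series in `y` with coefficients series in `z`. -/
def evalDiag : A⟦X⟧⟦X⟧ →+ A⟦X⟧ where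
  toFun F := PowerSeries.mk fun k => ∑ p ∈ antidiagonal k, coeff p.2 (coeff p.1 F)
  map_zero' := by ext; simp
  map_add' F G := by ext; simp [sum_add_distrib]

theorem coeff_evalDiag (F : A⟦X⟧⟦X⟧) (k : ℕ) :
    coeff k (evalDiag F) = ∑ p ∈ antidiagonal k, coeff p.2 (coeff p.1 F) := by
  simp [evalDiag]

theorem evalDiag_C_mul (f : A⟦X⟧) (F : A⟦X⟧⟦X⟧) : evalDiag (C f * F) = f * evalDiag F := by
  have key (G : A⟦X⟧⟦X⟧) (j k : ℕ) (h : j ≤ k) :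
      coeff j (evalDiag G) = coeff j (∑ i ∈ range (k + 1), X ^ i * coeff i G) := by
    simp only [map_sum, coeff_X_pow_mul', coeff_evalDiag]
    rw [← sum_filter, Nat.sum_antidiagonal_eq_sum_range_succ_mk]
    refine sum_congr ?_ fun _ _ => rfl
    ext i; simp; omega
  ext k
  have h1 : coeff k (f * evalDiag F) = coeff k (f * ∑ i ∈ range (k + 1), X ^ i * coeff i F) := by
    rw [coeff_mul, coeff_mul]
    refine sum_congr rfl fun p hp => ?_
    rw [key F p.2 k ((Nat.le_add_left _ _).trans_eq (mem_antidiagonal.1 hp))]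
  rw [key _ k k le_rfl, h1, mul_sum]
  congr 1
  refine sum_congr rfl fun i _ => ?_
  rw [coeff_C_mul]
  ring

theorem evalDiag_X_mul (F : A⟦X⟧⟦X⟧) : evalDiag (X * F) = X * evalDiag F := by
  ext k
  cases k with
  | zero => simp [coeff_evalDiag]
  | succ k =>
    rw [coeff_evalDiag, Finset.Nat.antidiagonal_succ, sum_cons, sum_map, coeff_succ_X_mul,
      coeff_evalDiag]
    simp

theorem evalDiag_map_C (F : A⟦X⟧) : evalDiag (PowerSeries.map C F) = F := by
  ext k
  rw [coeff_evalDiag, sum_eq_single_of_mem (k, 0) (by simp)]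
  · simp
  · rintro ⟨i, j⟩ h1 h2
    rw [mem_antidiagonal] at h1
    have : j ≠ 0 := by rintro rfl; exact h2 (by simp_all)
    simp [coeff_C, this]

/-- The shift of all coefficients, `∑ F_j w^j ↦ ∑ w^j exp(ε ∑ w^p ∂_p / p) F_j`. -/
def miwaFull (d : ℕ → Derivation ℂ A A) (ε : ℂ) (F : A⟦X⟧) : A⟦X⟧ :=
  evalDiag (PowerSeries.map (miwaHom d ε) F)

theorem coeff_miwaFull (d : ℕ → Derivation ℂ A A) (ε : ℂ) (F : A⟦X⟧) (k : ℕ) :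
    coeff k (miwaFull d ε F) =
      ∑ p ∈ antidiagonal k, coeff p.2 (miwaHom d ε (coeff p.1 F)) := by
  simp [miwaFull, coeff_evalDiag]

theorem miwaFull_mul_C (d : ℕ → Derivation ℂ A A) (ε : ℂ) (F : A⟦X⟧) (g : A) :
    miwaFull d ε (F * C g) = miwaFull d ε F * miwaHom d ε g := by
  rw [miwaFull, map_mul, PowerSeries.map_C, mul_comm, evalDiag_C_mul, mul_comm, miwaFull]

/-- The shifts by `ε` and `-ε` cancel because the derivations commute. Let `g i j` have degree `i`
from the inner shift and `j` from the outer one. In degree `i + j = k + 1` the sums of `j * g i j`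
and of `i * g i j` are opposite by the two recursions, so `k + 1` times the coefficient is zero. -/
theorem miwaFull_miwaHom {d : ℕ → Derivation ℂ A A} (hd : ∀ i j f, d i (d j f) = d j (d i f))
    (ε : ℂ) (f : A) : miwaFull d ε (miwaHom d (-ε) f) = C f := by
  ext k
  cases k with
  | zero => simp [coeff_miwaFull]
  | succ k =>
    rw [coeff_C, if_neg (Nat.succ_ne_zero k)]
    refine cast_succ_mul_cancel k ?_
    rw [zero_mul, coeff_miwaFull]
    set g : ℕ → ℕ → A := fun i j => coeff j (miwaHom d ε (coeff i (miwaHom d (-ε) f))) with hg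
    have h1 (i j : ℕ) : g i (j + 1) * (j + 1) = ε • ∑ p ∈ antidiagonal j, d p.1 (g i p.2) :=
      miwaHom_succ _ _ _ _
    have h2 (i j : ℕ) : g (i + 1) j * (i + 1) = -(ε • ∑ p ∈ antidiagonal i, d p.1 (g p.2 j)) := by
      have e1 : g (i + 1) j * (i + 1) =
          coeff j (miwaHom d ε (coeff (i + 1) (miwaHom d (-ε) f) * (i + 1))) := by
        rw [map_mul, map_add, map_natCast, map_one, ← Nat.cast_succ, ← Nat.cast_succ,
          ← map_natCast (C (R := A)), coeff_mul_C]
      have e2 : (-ε) • ∑ p ∈ antidiagonal i, d p.1 (coeff p.2 (miwaHom d (-ε) f)) =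
          ∑ p ∈ antidiagonal i, d p.1 ((-ε) • (coeff p.2 (miwaHom d (-ε) f))) := by
        rw [smul_sum]; simp
      rw [e1, miwaHom_succ, e2, map_sum, map_sum, smul_sum, ← sum_neg_distrib]
      refine sum_congr rfl fun p _ => ?_
      rw [miwaHom_der (hd · p.1), coeff_coeffDer, Algebra.smul_def, map_mul,
        miwaHom_const (by simp), coeff_C_mul, ← Algebra.smul_def, Derivation.map_smul, neg_smul]
    have h3 : ∑ p ∈ antidiagonal (k + 1), g p.1 p.2 * (p.2 : A) =
        ε • ∑ p ∈ antidiagonal k, ∑ q ∈ antidiagonal p.2, d q.1 (g p.1 q.2) := by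
      rw [Finset.Nat.sum_antidiagonal_succ', smul_sum]
      simp only [Nat.cast_zero, mul_zero, zero_add, Nat.cast_succ, h1]
    have h4 : ∑ p ∈ antidiagonal (k + 1), g p.1 p.2 * (p.1 : A) =
        -(ε • ∑ p ∈ antidiagonal k, ∑ q ∈ antidiagonal p.1, d q.1 (g q.2 p.2)) := by
      rw [Finset.Nat.sum_antidiagonal_succ, smul_sum, ← sum_neg_distrib]
      simp only [Nat.cast_zero, mul_zero, zero_add, Nat.cast_succ, h2]
    have h5 : ∑ p ∈ antidiagonal k, ∑ q ∈ antidiagonal p.2, d q.1 (g p.1 q.2) =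
        ∑ p ∈ antidiagonal k, ∑ q ∈ antidiagonal p.1, d q.1 (g q.2 p.2) := by
      rw [sum_sigma', sum_sigma']
      refine sum_bij' (fun x _ => ⟨(x.1.1 + x.2.1, x.2.2), (x.2.1, x.1.1)⟩)
        (fun x _ => ⟨(x.2.2, x.2.1 + x.1.2), (x.2.1, x.1.2)⟩) ?_ ?_ ?_ ?_ ?_ <;>
      simp only [mem_sigma, mem_antidiagonal] <;> rintro ⟨⟨a, b⟩, c, e⟩ h <;>
        simp only at h <;> obtain ⟨h1, h2⟩ := h <;> simp <;> omega
    have h6 : (∑ p ∈ antidiagonal (k + 1), g p.1 p.2) * ((k : A) + 1) =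
        ∑ p ∈ antidiagonal (k + 1), g p.1 p.2 * (p.2 : A) +
          ∑ p ∈ antidiagonal (k + 1), g p.1 p.2 * (p.1 : A) := by
      rw [← sum_add_distrib, sum_mul]
      refine sum_congr rfl fun p hp => ?_
      rw [← mul_add, ← Nat.cast_add, add_comm p.2, mem_antidiagonal.1 hp, Nat.cast_succ]
    rw [h6, h3, h4, h5, add_neg_cancel]

end Miwa

end GBMT

namespace GBMT

/-! ### The Miwa substitution -/

section MiwaSubst

open MvPowerSeries

/-- A given monomial occurs in the image of a time only if it is this time itself or the power of
`w` attached to it, which leaves finitely many times. -/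
theorem hasSubst_miwa (a : Fin 2) (ε : ℂ) : HasSubst (miwa a ε) where
  const_coeff s := by
    have : constantCoeff (miwa a ε s) = 0 := by
      unfold miwa
      split_ifs <;> simp
    rw [this]
    exact IsNilpotent.zero
  coeff_zero d := by
    classical
    have h1 : {s : Time | coeff d (X (some s) : MvPowerSeries (Option Time) ℂ) ≠ 0}.Finite := by
      refine Set.Subsingleton.finite fun s hs t ht => ?_
      have e (u : Time) (hu : coeff d (X (some u) : MvPowerSeries (Option Time) ℂ) ≠ 0) :
          d = Finsupp.single (some u) 1 := by
        by_contra hc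
        exact hu (by rw [coeff_X, if_neg hc])
      have := (e s hs).symm.trans (e t ht)
      simpa using Finsupp.single_left_injective one_ne_zero this
    have h2 : {s : Time | d = Finsupp.single (none : Option Time) (s.2 : ℕ)}.Finite := by
      have : {s : Time | d = Finsupp.single (none : Option Time) (s.2 : ℕ)} ⊆
          ((Set.univ : Set (Fin 2)) ×ˢ {p : ℕ+ | (p : ℕ) = d none}) := by
        rintro s hs
        refine ⟨trivial, ?_⟩
        have hs' : d = Finsupp.single (none : Option Time) (s.2 : ℕ) := hs
        simp [hs']
      refine (Set.finite_univ.prod ?_).subset this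
      exact Set.Subsingleton.finite fun s hs t ht => PNat.coe_injective (hs.trans ht.symm)
    refine (h1.union h2).subset fun s hs => ?_
    by_contra hc
    simp only [Set.mem_union, Set.mem_ofPred_eq, not_or, not_not] at hc
    refine hs ?_
    unfold miwa
    rw [map_add, hc.1, zero_add]
    split_ifs
    · rw [coeff_C_mul, coeff_X_pow, if_neg hc.2, mul_zero]
    · exact map_zero _

/-- `w ∂_w - ε ∑_{p ≤ K} w^p ∂_p` on series in the times and `w`. -/
def eulerDer (a : Fin 2) (ε : ℂ) (K : ℕ) :
    Derivation ℂ (MvPowerSeries (Option Time) ℂ) (MvPowerSeries (Option Time) ℂ) :=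
  (X none : MvPowerSeries (Option Time) ℂ) • pderiv ℂ none -
    ∑ i ∈ Finset.range K, (C ε * X none ^ (i + 1) : MvPowerSeries (Option Time) ℂ) •
      pderiv ℂ (some (a, i.succPNat))

theorem eulerDer_apply (a : Fin 2) (ε : ℂ) (K : ℕ) (G : MvPowerSeries (Option Time) ℂ) :
    eulerDer a ε K G = X none * pderiv ℂ none G -
      ∑ i ∈ Finset.range K, C ε * X none ^ (i + 1) * pderiv ℂ (some (a, i.succPNat)) G := by
  rw [eulerDer, Derivation.sub_apply, Derivation.smul_apply]
  congr 1
  rw [← Derivation.coeFnAddMonoidHom_apply, map_sum, Finset.sum_apply]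
  rfl

/-- For `s = (a, p)` the derivation `w ∂_w` produces `ε w^p` from `ε w^p / p`. If `p ≤ K`, the
truncated sum removes this term; if `p > K`, the term is divisible by `w^(K+1)`. -/
theorem dvd_eulerDer_miwa (a : Fin 2) (ε : ℂ) (K : ℕ) (s : Time) :
    (X none : MvPowerSeries (Option Time) ℂ) ^ (K + 1) ∣ eulerDer a ε K (miwa a ε s) := by
  have hX : eulerDer a ε K (X none) = X none := by
    rw [eulerDer_apply, pderiv_X_self, Finset.sum_eq_zero, mul_one, sub_zero]
    intro i _
    rw [pderiv_X_of_ne (by simp), mul_zero]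
  have hp : eulerDer a ε K (X (some s)) =
      -∑ i ∈ Finset.range K, if s = (a, i.succPNat) then C ε * X none ^ (i + 1) else 0 := by
    rw [eulerDer_apply, pderiv_X_of_ne (by simp), mul_zero, zero_sub]
    congr 1
    refine Finset.sum_congr rfl fun i _ => ?_
    split_ifs with h
    · rw [h, pderiv_X_self, mul_one]
    · rw [pderiv_X_of_ne (by simpa using h), mul_zero]
  unfold miwa
  rw [map_add, hp]
  split_ifs with h
  · obtain ⟨b, p⟩ := s
    obtain rfl : b = a := h
    have hpp : ((p : ℕ) : ℂ) ≠ 0 := by exact_mod_cast p.ne_zero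
    have h1 : eulerDer b ε K (C (ε / ((p : ℕ) : ℂ)) * X none ^ (p : ℕ)) =
        C ε * X none ^ (p : ℕ) := by
      rw [Derivation.leibniz, Derivation.leibniz_pow, hX, c_eq_algebraMap,
        Derivation.map_algebraMap, smul_zero, add_zero, smul_eq_mul, smul_eq_mul, nsmul_eq_mul,
        ← c_eq_algebraMap]
      have h2 : (X none : MvPowerSeries (Option Time) ℂ) ^ ((p : ℕ) - 1) * X none =
          X none ^ (p : ℕ) := by
        rw [← pow_succ, Nat.sub_add_cancel p.pos]
      rw [h2, ← mul_assoc, ← map_natCast (C (σ := Option Time)), ← map_mul, div_mul_cancel₀ _ hpp]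
    rw [h1]
    by_cases hK : (p : ℕ) ≤ K
    · rw [Finset.sum_eq_single (p : ℕ).pred]
      · have : (b, p) = (b, ((p : ℕ).pred).succPNat) := by
          rw [Prod.mk.injEq]; refine ⟨rfl, PNat.coe_injective ?_⟩
          have := p.pos
          simp only [Nat.succPNat_coe, Nat.pred_eq_sub_one]; omega
        rw [if_pos this]
        have e : (p : ℕ).pred + 1 = p := Nat.succ_pred p.ne_zero
        rw [e, neg_add_cancel]
        exact dvd_zero _
      · intro i _ hi
        rw [if_neg]
        rintro hc
        have := congrArg (fun s : Time => (s.2 : ℕ)) hc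
        simp only [Nat.succPNat_coe] at this
        exact hi (by rw [this]; rfl)
      · intro hc
        exfalso; apply hc
        have := p.pos
        simp only [Finset.mem_range, Nat.pred_eq_sub_one]; omega
    · rw [Finset.sum_eq_zero, neg_zero, zero_add]
      · exact (pow_dvd_pow _ (by omega)).mul_left _
      · intro i hi
        rw [if_neg]
        rintro hc
        have := congrArg (fun s : Time => (s.2 : ℕ)) hc
        simp only [Nat.succPNat_coe] at this
        have := Finset.mem_range.1 hi
        omega
  · rw [map_zero, add_zero, Finset.sum_eq_zero, neg_zero]
    · exact dvd_zero _
    · intro i _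
      rw [if_neg]
      rintro rfl
      exact h rfl

/-- Divisibility by `w^(K+1)` passes from the times to polynomials by the Leibniz rule, and its
consequence for coefficients passes to power series by locality. -/
theorem coeff_eulerDer_subst (a : Fin 2) (ε : ℂ) (K : ℕ) (f : PS) (m : Option Time →₀ ℕ)
    (hm : m none ≤ K) : coeff m (eulerDer a ε K (subst (miwa a ε) f)) = 0 := by
  have hpoly (P : MvPolynomial Time ℂ) : (X none : MvPowerSeries (Option Time) ℂ) ^ (K + 1) ∣
      eulerDer a ε K (substAlgHom (hasSubst_miwa a ε) (P : PS)) := by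
    rw [substAlgHom_coe]
    induction P using MvPolynomial.induction_on with
    | C r => rw [MvPolynomial.aeval_C, Derivation.map_algebraMap]; exact dvd_zero _
    | add p q hp hq => rw [map_add, map_add]; exact dvd_add hp hq
    | mul_X p s hp =>
      rw [map_mul, MvPolynomial.aeval_X, Derivation.leibniz, smul_eq_mul, smul_eq_mul]
      exact dvd_add ((dvd_eulerDer_miwa a ε K s).mul_left _) (hp.mul_left _)
  have hloc : IsLocal ((eulerDer a ε K).toLinearMap.toAddMonoidHom.comp
      (substAlgHom (R := ℂ) (hasSubst_miwa a ε)).toAddMonoidHom) := by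
    refine IsLocal.comp ?_ (IsLocal.subst _)
    have : (eulerDer a ε K).toLinearMap.toAddMonoidHom =
        (AddMonoidHom.mulLeft (X none)).comp (pderiv ℂ none).toLinearMap.toAddMonoidHom +
        ∑ i ∈ Finset.range K, (AddMonoidHom.mulLeft (-(C ε * X none ^ (i + 1)))).comp
          (pderiv ℂ (some (a, i.succPNat))).toLinearMap.toAddMonoidHom := by
      ext1 G
      rw [AddMonoidHom.add_apply, AddMonoidHom.finsetSum_apply]
      change eulerDer a ε K G = _
      rw [eulerDer_apply, sub_eq_add_neg, ← Finset.sum_neg_distrib]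
      congr 1
      refine Finset.sum_congr rfl fun i _ => ?_
      rw [← neg_mul]
      rfl
    rw [this]
    exact ((IsLocal.mulLeft _).comp (IsLocal.pderiv _)).add
      (IsLocal.sum _ fun i _ => (IsLocal.mulLeft _).comp (IsLocal.pderiv _))
  have := hloc.eq_zero (μ := m) (fun d r => ?_) f
  · rw [← substAlgHom_apply (hasSubst_miwa a ε)]
    exact this
  · have := X_pow_dvd_iff.1 (hpoly (MvPolynomial.monomial d r)) m (Nat.lt_succ_of_le hm)
    rw [MvPolynomial.coe_monomial] at this
    exact this

/-- Setting `w = 0`, that is applying `killCompl`, undoes the substitution on each time, hence on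
polynomials and, by locality, on all series. -/
theorem coeff_embDomain_miwa_zero (a : Fin 2) (ε : ℂ) (f : PS) (μ : Time →₀ ℕ) :
    coeff (μ.embDomain Function.Embedding.some) (subst (miwa a ε) f) = coeff μ f := by
  classical
  set Ev : MvPowerSeries (Option Time) ℂ →ₐ[ℂ] PS := killCompl Function.Embedding.some with hEv
  have hmiwa (s : Time) : Ev (miwa a ε s) = X s := by
    have h0 : Ev (X none) = 0 := killCompl_X_eq_zero (by simp)
    have h1 : Ev (X (some s)) = X s := killCompl_X (e := Function.Embedding.some) s
    unfold miwa
    rw [map_add, h1]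
    split_ifs
    · rw [map_mul, map_pow, h0, zero_pow s.2.ne_zero, mul_zero, add_zero]
    · rw [map_zero, add_zero]
  have hloc : IsLocal (Ev.toAddMonoidHom.comp
      (substAlgHom (R := ℂ) (hasSubst_miwa a ε)).toAddMonoidHom
        + -(AddMonoidHom.id _)) := by
    refine IsLocal.add (IsLocal.comp (fun μ => ⟨{μ.embDomain Function.Embedding.some}, ?_⟩)
      (IsLocal.subst _)) (fun μ => ⟨{μ}, fun f hf => ?_⟩)
    · intro f hf
      change coeff μ (killCompl _ f) = 0
      rw [coeff_killCompl]
      exact hf _ (Finset.mem_singleton_self _)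
    · rw [AddMonoidHom.neg_apply, map_neg, AddMonoidHom.id_apply,
        hf _ (Finset.mem_singleton_self _), neg_zero]
  have hz := hloc.eq_zero (μ := μ) (fun d r => ?_) f
  · rw [AddMonoidHom.add_apply, AddMonoidHom.neg_apply, map_add, map_neg, ← sub_eq_add_neg,
      sub_eq_zero] at hz
    rw [← substAlgHom_apply (hasSubst_miwa a ε)]
    exact (coeff_killCompl _ _).symm.trans hz
  · have h2 : Ev (substAlgHom (hasSubst_miwa a ε) (monomial d r)) = monomial d r := by
      rw [← MvPolynomial.coe_monomial, substAlgHom_coe]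
      induction MvPolynomial.monomial d r using MvPolynomial.induction_on with
      | C c => rw [MvPolynomial.aeval_C, AlgHom.commutes, MvPolynomial.coe_C, c_eq_algebraMap]
      | add p q hp hq => rw [map_add, map_add, hp, hq, MvPolynomial.coe_add]
      | mul_X p s hp =>
        rw [map_mul, map_mul, MvPolynomial.aeval_X, hmiwa, hp, MvPolynomial.coe_mul,
          MvPolynomial.coe_X]
    rw [AddMonoidHom.add_apply, AddMonoidHom.neg_apply, map_add, map_neg, ← sub_eq_add_neg,
      sub_eq_zero]
    exact congrArg (coeff μ) h2

/-- The derivatives `∂_{t^{(a)}_{i+1}}`. -/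
def tder (a : Fin 2) (i : ℕ) : Derivation ℂ PS PS := pderiv ℂ (a, i.succPNat)

theorem pderiv_comm {σ : Type*} (s t : σ) (f : MvPowerSeries σ ℂ) :
    pderiv ℂ s (pderiv ℂ t f) = pderiv ℂ t (pderiv ℂ s f) := by
  classical
  ext μ
  rw [coeff_pderiv, coeff_pderiv, coeff_pderiv, coeff_pderiv, add_right_comm]
  by_cases h : s = t
  · subst h; ring
  · simp [h, Ne.symm h]
    ring

/-- This links the substitution in the definition of Miwa shifts with the exponential of
derivations: the substituted series satisfies the differential equation in `w` and has the initial
value that characterise `miwaHom`. -/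
theorem miwaCoeff_eq (a : Fin 2) (ε : ℂ) (f : PS) (k : ℕ) :
    miwaCoeff a ε f k = PowerSeries.coeff k (miwaHom (tder a) ε f) := by
  classical
  suffices PowerSeries.mk (miwaCoeff a ε f) = miwaHom (tder a) ε f by
    rw [← this, PowerSeries.coeff_mk]
  refine eq_miwaHom ?_ ?_
  · ext k μ
    set G := subst (miwa a ε) f with hG
    -- `eulerDer` contains one factor `w` more than `miwaDer`, so degree `k` there is degree `k + 1`
    -- here, and derivatives beyond the first `k + 1` do not contribute.
    have h1 := coeff_eulerDer_subst a ε (k + 1) f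
      (μ.embDomain Function.Embedding.some + Finsupp.single none (k + 1)) (by
        simp [Finsupp.embDomain_of_notMem_range])
    rw [eulerDer_apply, map_sub, map_sum] at h1
    rw [coeff_miwaDer, map_zero, map_zero, ← h1, map_sub]
    have hn : (μ.embDomain Function.Embedding.some) (none : Option Time) = 0 :=
      Finsupp.embDomain_of_notMem_range _ _ _ (by simp)
    congr 1
    · rw [PowerSeries.coeff_mk]
      have : (X none : MvPowerSeries (Option Time) ℂ) = monomial (Finsupp.single none 1) 1 := rfl
      have e : μ.embDomain Function.Embedding.some + Finsupp.single none (k + 1) =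
        Finsupp.single none 1 + (μ.embDomain Function.Embedding.some + Finsupp.single none k) := by
        rw [add_left_comm, add_comm k, Finsupp.single_add]
      rw [this, e, coeff_add_monomial_mul, one_mul, coeff_pderiv, add_assoc, ← Finsupp.single_add]
      have e2 : ((k : PS) + 1) = C ((k : ℂ) + 1) := by simp
      rw [e2, coeff_mul_C]
      simp [hn, miwaCoeff, coeff_apply]
    · rw [smul_eq_C_mul, coeff_C_mul, map_sum, Finset.Nat.sum_antidiagonal_eq_sum_range_succ_mk,
        Finset.mul_sum]
      refine Finset.sum_congr rfl fun i hi => ?_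
      have hik : i ≤ k := Nat.lt_succ_iff.1 (Finset.mem_range.1 hi)
      rw [PowerSeries.coeff_mk, X_pow_eq, mul_assoc, coeff_C_mul]
      have e : μ.embDomain Function.Embedding.some + Finsupp.single none (k + 1) =
          Finsupp.single none (i + 1) +
            (μ.embDomain Function.Embedding.some + Finsupp.single none (k - i)) := by
        rw [add_left_comm, ← Finsupp.single_add]
        congr 2
        omega
      rw [e, coeff_add_monomial_mul, one_mul, tder, coeff_pderiv, coeff_pderiv]
      congr 2
      · change coeff _ G = _
        congr 1
        rw [Finsupp.embDomain_add, Finsupp.embDomain_single]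
        simp only [Function.Embedding.some_apply]
        rw [add_right_comm]
      · have : (μ.embDomain Function.Embedding.some) (some (a, i.succPNat)) =
          μ (a, i.succPNat) := Finsupp.embDomain_apply_self _ _ _
        simp [this]
  · ext μ
    rw [PowerSeries.coeff_mk]
    change coeff _ (subst (miwa a ε) f) = _
    rw [Finsupp.single_zero, add_zero, coeff_embDomain_miwa_zero]

end MiwaSubst

end GBMT

namespace GBMT

section TwoTimes

open MvPowerSeries

/-! ### Restriction to equal times -/

instance : Filter.TendstoCofinite (Sum.elim id id : Time ⊕ Time → Time) where
  tendsto_cofinite := by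
    rw [← Filter.tendstoCofinite_iff, Filter.tendstoCofinite_iff_finite_preimage_singleton]
    intro s
    refine (Set.toFinite {Sum.inl s, Sum.inr s}).subset ?_
    rintro (t | t) ht <;> simpa using ht

/-- The restriction `t' = t`. -/
def diag : PS2 →ₐ[ℂ] PS := rename (Sum.elim id id : Time ⊕ Time → Time)

theorem rename_eq_self {σ : Type*} (g : σ → σ) [Filter.TendstoCofinite g] (hg : g = id)
    (f : MvPowerSeries σ ℂ) : rename g f = f := by
  subst hg
  exact rename_id_apply f

@[simp] theorem diag_atT (f : PS) : diag (atT f) = f := by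
  rw [diag, atT, rename_rename]
  exact rename_eq_self _ (by ext <;> rfl) f

@[simp] theorem diag_atT' (f : PS) : diag (atT' f) = f := by
  rw [diag, atT', rename_rename]
  exact rename_eq_self _ (by ext <;> rfl) f

theorem mapDomain_elim_apply (x : Time ⊕ Time →₀ ℕ) (s : Time) :
    x.mapDomain (Sum.elim id id) s = x (Sum.inl s) + x (Sum.inr s) := by
  classical
  induction x using Finsupp.induction_linear with
  | zero => simp
  | add x y hx hy => simp only [Finsupp.mapDomain_add, Finsupp.add_apply, hx, hy]; ring
  | single t k => rcases t with t | t <;> simp [Finsupp.mapDomain_single, Finsupp.single_apply]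

/-- A family that satisfies linear equations in one of the two sets of times and vanishes at equal
times vanishes. -/
theorem eq_zero_of_flow {e : Time → Time ⊕ Time} (he : e = Sum.inl ∨ e = Sum.inr) {ι : Type*}
    {F : ι → PS2}
    (hF : ∀ s n, ∃ (D : Finset ι) (b : ι → PS2), pderiv ℂ (e s) (F n) = ∑ k ∈ D, b k * F k)
    (hd : ∀ n, diag (F n) = 0) (n : ι) : F n = 0 := by
  classical
  suffices ∀ (d : ℕ) n μ, μ.degree = d → coeff μ (F n) = 0 by
    ext μ; exact this _ n μ rfl
  intro d
  induction d using Nat.strong_induction_on with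
  | _ d ih =>
    -- If a differentiated time occurs in `μ`, the equation expresses the coefficient through
    -- coefficients of lower degree.
    have h1 (n : ι) (μ : Time ⊕ Time →₀ ℕ) (hμ : μ.degree = d) (s : Time) (hs : μ (e s) ≠ 0) :
        coeff μ (F n) = 0 := by
      obtain ⟨D, b, hb⟩ := hF s n
      have hle : Finsupp.single (e s) 1 ≤ μ := by
        rw [Finsupp.single_le_iff]; omega
      obtain ⟨ν, rfl⟩ := exists_add_of_le hle
      have hdeg : ν.degree + 1 = d := by
        rw [← hμ, map_add, Finsupp.degree_single, add_comm]
      have h2 := congrArg (coeff ν) hb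
      rw [coeff_pderiv, map_sum, Finset.sum_eq_zero, mul_eq_zero] at h2
      · rw [add_comm]
        exact h2.resolve_right (Nat.cast_add_one_ne_zero _)
      · intro k _
        rw [coeff_mul]
        refine Finset.sum_eq_zero fun p hp => ?_
        have hp2 : p.2.degree ≤ ν.degree := by
          rw [← Finset.HasAntidiagonal.mem_antidiagonal.1 hp, map_add]; omega
        rw [ih p.2.degree (by omega) k p.2 rfl, mul_zero]
    intro n μ hμ
    by_cases hs : ∃ s, μ (e s) ≠ 0
    · obtain ⟨s, hs⟩ := hs
      exact h1 n μ hμ s hs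
    -- Now `μ` contains only the other set of times. All other monomials with the same restriction
    -- to equal times contain a differentiated time and have coefficient zero by `h1`, so the
    -- coefficient at `μ` is a coefficient of the restriction.
    · push Not at hs
      have h2 := congrArg (coeff (μ.mapDomain (Sum.elim id id))) (hd n)
      rw [diag, coeff_rename, map_zero, Finset.sum_eq_single_of_mem μ (by simp)] at h2
      · exact h2
      · intro x hx hxμ
        replace hx : x.mapDomain (Sum.elim id id) = μ.mapDomain (Sum.elim id id) := by
          simpa using hx
        have hdx : x.degree = d := by
          rw [← hμ, ← Finsupp.degree_mapDomain (Sum.elim id id) x, hx,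
            Finsupp.degree_mapDomain]
        by_contra hc
        refine hxμ ?_
        have hxs (s : Time) : x (e s) = 0 := by
          by_contra hxs
          exact hc (h1 n x hdx s hxs)
        ext t
        have h3 (s : Time) := DFunLike.congr_fun hx s
        simp only [mapDomain_elim_apply] at h3
        rcases he with rfl | rfl <;> rcases t with t | t
        · rw [hxs, hs]
        · have := h3 t; rw [hxs, hs] at this; omega
        · have := h3 t; rw [hxs, hs] at this; omega
        · rw [hxs, hs]

theorem pderiv_rename_self {σ τ : Type*} (e : σ ↪ τ) (s : σ) (f : MvPowerSeries σ ℂ) :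
    pderiv ℂ (e s) (rename e f) = rename e (pderiv ℂ s f) := by
  classical
  ext μ
  rw [coeff_pderiv]
  by_cases hμ : ∃ ν : σ →₀ ℕ, μ = ν.embDomain e
  · obtain ⟨ν, rfl⟩ := hμ
    have : ν.embDomain e + Finsupp.single (e s) 1 = (ν + Finsupp.single s 1).embDomain e := by
      rw [Finsupp.embDomain_add, Finsupp.embDomain_single]
    rw [this, coeff_embDomain_rename, coeff_embDomain_rename, coeff_pderiv,
      Finsupp.embDomain_apply_self]
  · rw [coeff_rename_eq_zero, coeff_rename_eq_zero, zero_mul]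
    · rintro ⟨ν, hν⟩
      exact hμ ⟨ν, by rw [Finsupp.embDomain_eq_mapDomain]; exact hν.symm⟩
    · rintro ⟨ν, hν⟩
      have hν' : ν.embDomain e = μ + Finsupp.single (e s) 1 := by
        rw [Finsupp.embDomain_eq_mapDomain]; exact hν
      have h1 : Finsupp.single s 1 ≤ ν := by
        rw [Finsupp.single_le_iff, ← Finsupp.embDomain_apply_self e, hν']
        simp
      obtain ⟨κ, rfl⟩ := exists_add_of_le h1
      refine hμ ⟨κ, ?_⟩
      rw [Finsupp.embDomain_add, Finsupp.embDomain_single, add_comm] at hν'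
      exact (add_right_cancel hν').symm

theorem pderiv_rename_of_notMem {σ τ : Type*} (e : σ ↪ τ) {t : τ} (ht : t ∉ Set.range e)
    (f : MvPowerSeries σ ℂ) : pderiv ℂ t (rename e f) = 0 := by
  classical
  ext μ
  rw [coeff_pderiv, coeff_rename_eq_zero, zero_mul, map_zero]
  rintro ⟨ν, hν⟩
  have h := DFunLike.congr_fun hν t
  rw [← Finsupp.embDomain_eq_mapDomain, Finsupp.embDomain_of_notMem_range _ _ _ ht] at h
  simp at h

theorem pderiv_inl_atT (s : Time) (f : PS) : pderiv ℂ (Sum.inl s) (atT f) = atT (dt s f) :=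
  pderiv_rename_self Function.Embedding.inl s f

theorem pderiv_inr_atT' (s : Time) (f : PS) : pderiv ℂ (Sum.inr s) (atT' f) = atT' (dt s f) :=
  pderiv_rename_self Function.Embedding.inr s f

theorem pderiv_inr_atT (s : Time) (f : PS) : pderiv ℂ (Sum.inr s) (atT f) = 0 :=
  pderiv_rename_of_notMem Function.Embedding.inl (by simp) f

theorem pderiv_inl_atT' (s : Time) (f : PS) : pderiv ℂ (Sum.inl s) (atT' f) = 0 :=
  pderiv_rename_of_notMem Function.Embedding.inr (by simp) f

end TwoTimes

/-! ### The exponentials -/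

section ExpXi

open PowerSeries

theorem eq_zero_of_derivative_eq {A : Type*} [CommRing A] [Algebra ℂ A] {a G : A⟦X⟧}
    (h : derivative A G = a * G) (h0 : coeff 0 G = 0) : G = 0 := by
  ext k
  induction k using Nat.strong_induction_on with
  | _ k ih =>
    cases k with
    | zero => simpa using h0
    | succ k =>
      refine cast_succ_mul_cancel k ?_
      rw [← coeff_derivative, h, coeff_mul, map_zero, zero_mul]
      refine Finset.sum_eq_zero fun p hp => ?_
      rw [ih p.2 (Nat.lt_succ_of_le ((Nat.le_add_left _ _).trans_eq
        (Finset.HasAntidiagonal.mem_antidiagonal.1 hp))), map_zero, mul_zero]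

/-- The series `e^{ξ(x,w)}` in `w`. -/
def expSeries (x : ℕ+ → PS2) : PowerSeries PS2 := (PowerSeries.exp ℚ).subst (xi x)

theorem hasSubst_xi (x : ℕ+ → PS2) : HasSubst (xi x) :=
  HasSubst.of_constantCoeff_zero' (by
    rw [← coeff_zero_eq_constantCoeff_apply, xi, coeff_mk, dif_neg (lt_irrefl 0)])

theorem expSeries_eq (x : ℕ+ → PS2) : expSeries x = (PowerSeries.exp PS2).subst (xi x) := by
  ext1 k
  rw [expSeries, coeff_subst' (hasSubst_xi x), coeff_subst' (hasSubst_xi x)]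
  refine finsum_congr fun d => ?_
  rw [coeff_exp, coeff_exp, smul_eq_mul, Algebra.algebraMap_self, RingHom.id_apply, Algebra.smul_def]

theorem coeff_zero_expSeries (x : ℕ+ → PS2) : coeff 0 (expSeries x) = 1 := by
  rw [expSeries, coeff_subst' (hasSubst_xi x), finsum_eq_single _ 0]
  · simp
  · intro d hd
    rw [coeff_zero_eq_constantCoeff_apply, map_pow]
    have : constantCoeff (xi x) = 0 := by
      rw [← coeff_zero_eq_constantCoeff_apply, xi, coeff_mk, dif_neg (lt_irrefl 0)]
    rw [this, zero_pow hd, smul_zero]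

theorem derivative_expSeries (x : ℕ+ → PS2) :
    derivative PS2 (expSeries x) = derivative PS2 (xi x) * expSeries x := by
  rw [expSeries_eq, derivative_subst (hasSubst_xi x), derivative_exp, mul_comm]

theorem expXi_of_neg (x : ℕ+ → PS2) {k : ℤ} (hk : k < 0) : expXi x k = 0 := by
  rw [expXi, if_neg (by omega)]

theorem expXi_natCast (x : ℕ+ → PS2) (k : ℕ) : expXi x k = coeff k (expSeries x) := by
  rw [expXi, if_pos (by omega), Int.toNat_natCast, expSeries]

theorem derivative_coeffDer {A : Type*} [CommRing A] [Algebra ℂ A] (δ : Derivation ℂ A A) (F : A⟦X⟧) :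
    derivative A (coeffDer δ F) = coeffDer δ (derivative A F) := by
  ext k
  have h1 : δ ((k : A) + 1) = 0 := by
    have : ((k : A) + 1) = algebraMap ℂ A ((k : ℂ) + 1) := by simp
    rw [this, Derivation.map_algebraMap]
  rw [coeff_derivative, coeff_coeffDer, coeff_coeffDer, coeff_derivative, Derivation.leibniz, h1,
    smul_zero, zero_add, smul_eq_mul, mul_comm]

/-- The chain rule for `e^ξ`: the difference of the two sides solves `G' = ξ' G` in `w` with initial
value zero. -/
theorem coeffDer_expSeries {x : ℕ+ → PS2} {δ : Derivation ℂ PS2 PS2} {F : PowerSeries PS2}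
    (hF : coeff 0 F = 0) (h : ∀ p : ℕ+, δ (x p) = coeff (p : ℕ) F) :
    coeffDer δ (expSeries x) = F * expSeries x := by
  have hxi : coeffDer δ (xi x) = F := by
    ext1 k
    rw [coeff_coeffDer, xi, coeff_mk]
    split_ifs with hk
    · exact h ⟨k, hk⟩
    · obtain rfl : k = 0 := by omega
      rw [map_zero, hF]
  rw [← sub_eq_zero]
  refine eq_zero_of_derivative_eq (a := derivative PS2 (xi x)) ?_ ?_
  · have e : derivative PS2 F = coeffDer δ (derivative PS2 (xi x)) := by
      rw [← hxi, derivative_coeffDer]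
    rw [map_sub, derivative_coeffDer, derivative_expSeries, Derivation.leibniz, Derivation.leibniz,
      derivative_expSeries, e]
    simp only [smul_eq_mul]
    ring
  · rw [map_sub, coeff_coeffDer, coeff_zero_expSeries, Derivation.map_one_eq_zero, coeff_mul]
    simp [hF]

theorem der_expXi {x : ℕ+ → PS2} {δ : Derivation ℂ PS2 PS2} {q : ℕ+} {ε : PS2}
    (h : ∀ p : ℕ+, δ (x p) = if p = q then ε else 0) (k : ℤ) :
    δ (expXi x k) = ε * expXi x (k - q) := by
  have key := coeffDer_expSeries (x := x) (δ := δ) (F := C ε * X ^ (q : ℕ))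
    (by rw [coeff_C_mul, coeff_X_pow, if_neg (by have := q.pos; omega), mul_zero])
    (fun p => by rw [h, coeff_C_mul, coeff_X_pow]; simp [PNat.coe_inj])
  rcases lt_or_ge k 0 with hk | hk
  · have := q.pos
    rw [expXi_of_neg x hk, expXi_of_neg x (by omega), map_zero, mul_zero]
  · lift k to ℕ using hk
    have := congrArg (coeff k) key
    rw [coeff_coeffDer, mul_assoc, coeff_C_mul, coeff_X_pow_mul'] at this
    rw [expXi_natCast, this]
    split_ifs with hkq
    · rw [← Nat.cast_sub hkq, expXi_natCast]
    · rw [expXi_of_neg x (by omega)]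

theorem der_expXi_eq_zero {x : ℕ+ → PS2} {δ : Derivation ℂ PS2 PS2}
    (h : ∀ p : ℕ+, δ (x p) = 0) (k : ℤ) : δ (expXi x k) = 0 := by
  rw [der_expXi (q := 1) (ε := 0) (fun p => by rw [h, ite_self]), zero_mul]

theorem diag_expXi {x : ℕ+ → PS2} (h : ∀ p, diag (x p) = 0) (k : ℤ) :
    diag (expXi x k) = if k = 0 then 1 else 0 := by
  have key : PowerSeries.map (diag : PS2 →+* PS) (expSeries x) = 1 := by
    rw [← sub_eq_zero]
    have hD : ∀ F : PowerSeries PS2, derivative PS (PowerSeries.map (diag : PS2 →+* PS) F) =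
        PowerSeries.map (diag : PS2 →+* PS) (derivative PS2 F) := by
      intro F
      ext1 k
      simp only [coeff_derivative, coeff_map, map_mul, map_add, map_natCast, map_one]
    have hxi : PowerSeries.map (diag : PS2 →+* PS) (xi x) = 0 := by
      ext1 k
      rw [coeff_map, xi, coeff_mk, map_zero]
      split_ifs
      · exact h _
      · exact map_zero _
    refine eq_zero_of_derivative_eq (a := 0) ?_ ?_
    · rw [map_sub, hD, derivative_expSeries, map_mul, ← hD, hxi]
      simp
    · rw [map_sub, coeff_map, coeff_zero_expSeries]
      simp
  rcases lt_or_ge k 0 with hk | hk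
  · rw [expXi_of_neg x hk, if_neg (by omega), map_zero]
  · lift k to ℕ using hk
    have := congrArg (coeff k) key
    rw [coeff_map, coeff_one] at this
    rw [expXi_natCast]
    simpa using this

end ExpXi

/-! ### Weights -/

section Weight

open MvPowerSeries

/-- The weight of a monomial, where `t^{(a)}_p` and `t'^{(a)}_p` have weight `p`. -/
def wt : (Time ⊕ Time →₀ ℕ) →+ ℕ :=
  Finsupp.weight (Sum.elim (fun s => (s.2 : ℕ)) (fun s => (s.2 : ℕ)))

/-- All monomials of the series have weight at least `k`. -/
def WtGE (k : ℕ) (f : PS2) : Prop := ∀ μ, wt μ < k → coeff μ f = 0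

theorem WtGE.mul {k l : ℕ} {f g : PS2} (hf : WtGE k f) (hg : WtGE l g) : WtGE (k + l) (f * g) := by
  classical
  intro μ hμ
  rw [coeff_mul]
  refine Finset.sum_eq_zero fun p hp => ?_
  have : wt μ = wt p.1 + wt p.2 := by rw [← map_add, Finset.HasAntidiagonal.mem_antidiagonal.1 hp]
  by_cases h : wt p.1 < k
  · rw [hf _ h, zero_mul]
  · rw [hg _ (by omega), mul_zero]

theorem wtGE_dT (a : Fin 2) (p : ℕ+) : WtGE p (dT a p) := by
  classical
  intro μ hμ
  rw [dT, map_sub, coeff_X, coeff_X, if_neg, if_neg, sub_zero]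
  · rintro rfl
    simp [wt, Finsupp.weight_single] at hμ
  · rintro rfl
    simp [wt, Finsupp.weight_single] at hμ

theorem wtGE_neg {k : ℕ} {f : PS2} (hf : WtGE k f) : WtGE k (-f) := fun μ hμ => by
  rw [map_neg, hf μ hμ, neg_zero]

/-- This bound makes the formal integrals locally finite. It is read off from the recursion `(k + 1)
e_{k+1} = ∑ (p + 1) x_{p+1} e_{k-p}` for the coefficients of the exponential. -/
theorem wtGE_expXi {x : ℕ+ → PS2} (hx : ∀ p : ℕ+, WtGE p (x p)) (k : ℤ) :
    WtGE k.toNat (expXi x k) := by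
  rcases lt_or_ge k 0 with hk | hk
  · intro μ _; rw [expXi_of_neg x hk, map_zero]
  lift k to ℕ using hk
  rw [expXi_natCast, Int.toNat_natCast]
  induction k using Nat.strong_induction_on with
  | _ k ih =>
    cases k with
    | zero => exact fun μ hμ => absurd hμ (Nat.not_lt_zero _)
    | succ k =>
      intro μ hμ
      have h1 := congrArg (fun F => coeff μ (PowerSeries.coeff k F)) (derivative_expSeries x)
      simp only [PowerSeries.coeff_mul, PowerSeries.coeff_derivative, map_sum] at h1
      rw [Finset.sum_eq_zero] at h1
      · have e2 : ((k : PS2) + 1) = C ((k : ℂ) + 1) := by simp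
        rw [e2, coeff_mul_C, mul_eq_zero] at h1
        exact h1.resolve_right (Nat.cast_add_one_ne_zero _)
      · intro p hp
        have hp' := Finset.HasAntidiagonal.mem_antidiagonal.1 hp
        have h2 : WtGE (p.1 + 1) (PowerSeries.coeff (p.1 + 1) (xi x)) := by
          rw [xi, PowerSeries.coeff_mk, dif_pos (Nat.succ_pos _)]
          exact hx ⟨p.1 + 1, _⟩
        have h3 : WtGE (p.1 + 1) (PowerSeries.coeff (p.1 + 1) (xi x) * ((p.1 : PS2) + 1)) := by
          intro ν hν
          have e2 : ((p.1 : PS2) + 1) = C ((p.1 : ℂ) + 1) := by simp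
          rw [e2, coeff_mul_C, h2 ν hν, zero_mul]
        exact (h3.mul (ih p.2 (by omega))) μ (by omega)

end Weight

end GBMT

namespace GBMT

/-! ### Pairings -/

section Pairing

open MvPowerSeries

/-- The sign `1` for the first set of times, `-1` for the second one. -/
def sg (a : Fin 2) : ℤ := if a = 0 then 1 else -1

theorem sg_cases (a : Fin 2) : sg a = 1 ∨ sg a = -1 := by
  unfold sg; split_ifs <;> simp

@[simp] theorem sg_mul_self (a : Fin 2) : sg a * sg a = 1 := by
  rcases sg_cases a with h | h <;> rw [h] <;> rfl

theorem sg_mul_sg_mul (a : Fin 2) (i : ℤ) : sg a * (sg a * i) = i := by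
  rw [← mul_assoc, sg_mul_self, one_mul]

/-- The formal integral around `∞` for `a = 0` and around `0` for `a = 1`. -/
def pairing (a : Fin 2) (c d : ℤ → PS2) (x : ℕ+ → PS2) : PS2 :=
  lsum fun ij : ℤ × ℤ => c ij.1 * d ij.2 * expXi x (-(sg a * (ij.1 + ij.2)))

theorem intInf_eq (c d : ℤ → PS2) (x : ℕ+ → PS2) : intInf c d x = pairing 0 c d x := by
  have h : sg 0 = 1 := rfl
  unfold pairing
  simp only [h, one_mul]
  rfl

theorem intZero_eq (c d : ℤ → PS2) (x : ℕ+ → PS2) : intZero c d x = pairing 1 c d x := by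
  have h : sg 1 = -1 := rfl
  unfold pairing
  simp only [h, neg_one_mul, neg_neg]
  rfl

/-- The series `∑ c_i z^i` is bounded above for `a = 0` and bounded below for `a = 1`. -/
def Bdd {A : Type*} [Zero A] (a : Fin 2) (c : ℤ → A) : Prop := ∃ α : ℤ, ∀ i, α < sg a * i → c i = 0

/-- The exponents `x_p` have weight at least `p`. -/
def Wtd (x : ℕ+ → PS2) : Prop := ∀ p : ℕ+, WtGE p (x p)

variable {a : Fin 2} {c d : ℤ → PS2} {x : ℕ+ → PS2}

theorem wtd_dT (b : Fin 2) : Wtd (dT b) := wtGE_dT b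

theorem wtd_neg_dT (b : Fin 2) : Wtd (-dT b) := fun p => wtGE_neg (wtGE_dT b p)

/-- The two series bound `sg a * i` and `sg a * j` from above, and the weight of the exponential
bounds their sum from below at each monomial, so only finitely many pairs remain. -/
theorem locFin_pairing (hc : Bdd a c) (hd : Bdd a d) (hx : Wtd x) :
    LocFin fun ij : ℤ × ℤ => c ij.1 * d ij.2 * expXi x (-(sg a * (ij.1 + ij.2))) := by
  obtain ⟨α, hα⟩ := hc
  obtain ⟨β, hβ⟩ := hd
  intro μ
  set M : ℤ := wt μ + |α| + |β|
  refine ((Set.finite_Icc (-M) M).prod (Set.finite_Icc (-M) M)).subset ?_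
  rintro ⟨i, j⟩ hij
  have h1 : ¬ α < sg a * i := fun h => hij (by simp [hα i h])
  have h2 : ¬ β < sg a * j := fun h => hij (by simp [hβ j h])
  have h3 : (-(sg a * (i + j))).toNat ≤ wt μ := by
    by_contra h
    refine hij ?_
    have hw : WtGE (0 + (-(sg a * (i + j))).toNat) (c i * d j * expXi x (-(sg a * (i + j)))) :=
      WtGE.mul (fun μ hμ => absurd hμ (Nat.not_lt_zero _)) (wtGE_expXi hx _)
    exact hw μ (by omega)
  have := le_abs_self α
  have := le_abs_self β
  have := abs_nonneg α
  have := abs_nonneg β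
  simp only [Set.mem_prod, Set.mem_Icc]
  rcases sg_cases a with h | h <;> rw [h] at h1 h2 h3 <;> omega

theorem pairing_comm (a : Fin 2) (c d : ℤ → PS2) (x : ℕ+ → PS2) :
    pairing a c d x = pairing a d c x := by
  rw [pairing, pairing, ← lsum_equiv (Equiv.prodComm ℤ ℤ)]
  congr 1
  ext1 ij
  rw [Equiv.prodComm_apply, Prod.fst_swap, Prod.snd_swap, mul_comm (c _), add_comm]

theorem pairing_zMul (a : Fin 2) (e : ℤ) (c d : ℤ → PS2) (x : ℕ+ → PS2) :
    pairing a (zMul e c) d x = pairing a c (zMul e d) x := by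
  rw [pairing, pairing]
  conv_rhs => rw [← lsum_equiv ((Equiv.subRight e).prodCongr (Equiv.addRight e))]
  congr 1
  ext1 ij
  simp [zMul]

theorem zMul_zMul {R : Type} (e f : ℤ) (c : ℤ → R) : zMul e (zMul f c) = zMul (e + f) c := by
  ext i
  simp only [zMul]
  congr 1
  ring

theorem Bdd.zMul {R : Type} [Zero R] {c : ℤ → R} (hc : Bdd a c) (e : ℤ) : Bdd a (zMul e c) := by
  obtain ⟨α, hα⟩ := hc
  refine ⟨α + sg a * e, fun i hi => hα _ ?_⟩
  rw [mul_sub]; omega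

theorem Bdd.comp {R R' : Type*} [Zero R] [Zero R'] {c : ℤ → R} (hc : Bdd a c) {f : R → R'}
    (hf : f 0 = 0) : Bdd a fun i => f (c i) := by
  obtain ⟨α, hα⟩ := hc
  exact ⟨α, fun i hi => by simp only [hα i hi, hf]⟩

theorem pairing_mul_left (f : PS2) (hc : Bdd a c) (hd : Bdd a d) (hx : Wtd x) :
    pairing a (fun i => f * c i) d x = f * pairing a c d x := by
  rw [pairing, pairing, ← lsum_mul_left f (locFin_pairing hc hd hx)]
  simp only [mul_assoc]

theorem pairing_add_left {c' : ℤ → PS2} (hc : Bdd a c) (hc' : Bdd a c') (hd : Bdd a d)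
    (hx : Wtd x) :
    pairing a (fun i => c i + c' i) d x = pairing a c d x + pairing a c' d x := by
  rw [pairing, pairing, pairing, ← lsum_add (locFin_pairing hc hd hx) (locFin_pairing hc' hd hx)]
  simp only [add_mul]

theorem pairing_sum_left {ι : Type*} {s : Finset ι} {f : ι → PS2} {c : ι → ℤ → PS2}
    (hc : ∀ k ∈ s, Bdd a (c k)) (hd : Bdd a d) (hx : Wtd x) :
    pairing a (fun i => ∑ k ∈ s, f k * c k i) d x = ∑ k ∈ s, f k * pairing a (c k) d x := by
  have h (k : ι) (hk : k ∈ s) : LocFin fun ij : ℤ × ℤ =>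
      f k * (c k ij.1 * d ij.2 * expXi x (-(sg a * (ij.1 + ij.2)))) :=
    (locFin_pairing (hc k hk) hd hx).mul_left _
  rw [pairing, Finset.sum_congr rfl fun k hk => by
    rw [pairing, ← lsum_mul_left (f k) (locFin_pairing (hc k hk) hd hx)], ← lsum_sum h]
  simp only [Finset.sum_mul, mul_assoc]

/-- The derivative of a pairing whose second factor is constant. -/
theorem pderiv_pairing {t : Time ⊕ Time} {q : ℕ+} {ε : PS2} (hc : Bdd a c) (hd : Bdd a d)
    (hx : Wtd x) (hdt : ∀ j, pderiv ℂ t (d j) = 0)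
    (hxt : ∀ p, pderiv ℂ t (x p) = if p = q then ε else 0) :
    pderiv ℂ t (pairing a c d x) =
      pairing a (fun i => pderiv ℂ t (c i) + ε * c (i - sg a * q)) d x := by
  have h0 := locFin_pairing hc hd hx
  have hc1 : Bdd a fun i => pderiv ℂ t (c i) := hc.comp (map_zero _)
  have hc2 : Bdd a (zMul (sg a * q) c) := hc.zMul _
  have hc3 : Bdd a fun i => ε * c (i - sg a * q) := hc2.comp (f := fun y => ε * y) (mul_zero _)
  have h1 := map_lsum h0 (IsLocal.pderiv t)
  change pderiv ℂ t (pairing a c d x) = lsum fun ij : ℤ × ℤ =>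
    pderiv ℂ t (c ij.1 * d ij.2 * expXi x (-(sg a * (ij.1 + ij.2)))) at h1
  rw [h1, pairing_add_left hc1 hc3 hd hx]
  have h2 (ij : ℤ × ℤ) : pderiv ℂ t (c ij.1 * d ij.2 * expXi x (-(sg a * (ij.1 + ij.2)))) =
      pderiv ℂ t (c ij.1) * d ij.2 * expXi x (-(sg a * (ij.1 + ij.2))) +
      ε * (c ij.1 * d ij.2 * expXi x (-(sg a * (ij.1 + ij.2)) - q)) := by
    rw [Derivation.leibniz, Derivation.leibniz, hdt, der_expXi hxt]
    simp only [smul_eq_mul]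
    ring
  -- The power of the spectral variable that comes from differentiating the exponential is absorbed
  -- into the first series by a shift of its index.
  have e2 (ij : ℤ × ℤ) : -(sg a * (ij.1 + ij.2)) - q = -(sg a * (ij.1 + sg a * q + ij.2)) := by
    rw [mul_add, mul_add, mul_add, sg_mul_sg_mul]; ring
  have h3 : LocFin fun ij : ℤ × ℤ =>
      ε * (c ij.1 * d ij.2 * expXi x (-(sg a * (ij.1 + ij.2)) - q)) := by
    have := (locFin_pairing hc3 hd hx).equiv ((Equiv.addRight (sg a * q)).prodCongr (Equiv.refl ℤ))
    convert this using 2 with ij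
    simp only [Equiv.prodCongr_apply, Prod.map_fst, Prod.map_snd, Equiv.coe_addRight,
      Equiv.refl_apply, add_sub_cancel_right, e2, mul_assoc]
  simp only [h2]
  rw [lsum_add (locFin_pairing hc1 hd hx) h3, pairing, pairing]
  congr 1
  conv_rhs => rw [← lsum_equiv ((Equiv.addRight (sg a * q)).prodCongr (Equiv.refl ℤ))]
  congr 1
  ext1 ij
  simp only [Equiv.prodCongr_apply, Prod.map_fst, Prod.map_snd, Equiv.coe_addRight,
      Equiv.refl_apply, add_sub_cancel_right, e2, mul_assoc]

theorem lsum_eq_finsum {σ ι : Type*} {f : ι → MvPowerSeries σ ℂ} (hf : f.support.Finite) :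
    lsum f = ∑ᶠ i, f i := by
  ext μ
  rw [coeff_lsum]
  exact ((coeff μ).toAddMonoidHom.map_finsum hf).symm

theorem lsum_eq_of_injective {σ ι κ : Type*} {f : κ → MvPowerSeries σ ℂ} {e : ι → κ}
    (he : Function.Injective e) (hf : ∀ k, k ∉ Set.range e → f k = 0) :
    lsum f = lsum fun i => f (e i) := by
  ext μ
  rw [coeff_lsum, coeff_lsum, ← finsum_mem_range (f := fun k => coeff μ (f k)) he]
  refine finsum_congr fun k => ?_
  by_cases hk : k ∈ Set.range e
  · simp [hk]
  · simp [hk, hf k hk]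

/-- At equal times the exponential is `1` and only the terms with `i + j = 0` survive. For rows and
columns of matrices the result is an entry of their product. -/
theorem diag_pairing (hc : Bdd a c) (hd : Bdd a d) (hx : Wtd x) (hxd : ∀ p, diag (x p) = 0) :
    diag (pairing a c d x) = ∑ᶠ i, diag (c i) * diag (d (-i)) := by
  have h1 := map_lsum (locFin_pairing hc hd hx) (IsLocal.rename (Sum.elim id id))
  change diag (pairing a c d x) = lsum fun ij : ℤ × ℤ =>
    diag (c ij.1 * d ij.2 * expXi x (-(sg a * (ij.1 + ij.2)))) at h1
  rw [h1, lsum_eq_of_injective (e := fun i : ℤ => (i, -i)), lsum_eq_finsum]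
  · refine finsum_congr fun i => ?_
    rw [map_mul, map_mul, diag_expXi hxd, if_pos (by simp), mul_one]
  · obtain ⟨α, hα⟩ := hc
    obtain ⟨β, hβ⟩ := hd
    refine (Set.finite_Icc (-(|α| + |β|)) (|α| + |β|)).subset fun i hi => ?_
    have h1 : ¬ α < sg a * i := fun h => hi (by simp [hα i h])
    have h2 : ¬ β < sg a * -i := fun h => hi (by simp [hβ _ h])
    have := le_abs_self α
    have := le_abs_self β
    have := abs_nonneg α
    have := abs_nonneg β
    rw [Set.mem_Icc]
    rcases sg_cases a with h | h <;> rw [h] at h1 h2 <;> omega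
  · intro i j hij
    simpa using congrArg Prod.fst hij
  · rintro ⟨i, j⟩ hij
    rw [map_mul, diag_expXi hxd, if_neg, mul_zero]
    intro h
    refine hij ⟨i, ?_⟩
    rcases sg_cases a with hs | hs <;> rw [hs] at h <;> simp at h ⊢ <;> omega

theorem diag_dT (a : Fin 2) (p : ℕ+) : diag (dT a p) = 0 := by
  rw [dT, map_sub, diag, rename_X, rename_X]
  exact sub_self _

theorem diag_neg_dT (a : Fin 2) (p : ℕ+) : diag ((-dT a) p) = 0 := by
  rw [Pi.neg_apply, map_neg, diag_dT, neg_zero]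

theorem pderiv_inl_dT (a b : Fin 2) (p q : ℕ+) :
    pderiv ℂ (Sum.inl (b, q)) (dT a p) = if p = q then (if a = b then 1 else 0) else 0 := by
  classical
  rw [dT, map_sub, pderiv_X_of_ne (j := Sum.inr (a, p)) (by simp), sub_zero]
  by_cases h : a = b ∧ p = q
  · obtain ⟨rfl, rfl⟩ := h; simp
  · rw [pderiv_X_of_ne (by simpa using h)]
    split_ifs <;> simp_all

theorem pderiv_inr_dT (a b : Fin 2) (p q : ℕ+) :
    pderiv ℂ (Sum.inr (b, q)) (dT a p) = if p = q then -(if a = b then 1 else 0) else 0 := by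
  classical
  rw [dT, map_sub, pderiv_X_of_ne (j := Sum.inl (a, p)) (by simp), zero_sub]
  by_cases h : a = b ∧ p = q
  · obtain ⟨rfl, rfl⟩ := h; simp
  · rw [pderiv_X_of_ne (by simpa using h)]
    split_ifs <;> simp_all

theorem pderiv_inr_neg_dT (a b : Fin 2) (p q : ℕ+) :
    pderiv ℂ (Sum.inr (b, q)) ((-dT a) p) = if p = q then (if a = b then 1 else 0) else 0 := by
  rw [Pi.neg_apply, map_neg, pderiv_inr_dT]
  split_ifs <;> simp

end Pairing

/-! ### Evaluation at times that differ by a shift -/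

section Evaluation

open PowerSeries

/-- The derivatives with respect to one set of times in two sets of times. -/
def tder2 (e : Time → Time ⊕ Time) (a : Fin 2) (i : ℕ) : Derivation ℂ PS2 PS2 :=
  MvPowerSeries.pderiv ℂ (e (a, i.succPNat))

/-- The substitution of `t + ε [w]_a` for one set of times and of `t` for the other one. -/
def evalShift (e : Time → Time ⊕ Time) (a : Fin 2) (ε : ℂ) : PS2 →+* PS⟦X⟧ :=
  (PowerSeries.map (diag : PS2 →+* PS)).comp (miwaHom (tder2 e a) ε)

theorem coeff_evalShift (e : Time → Time ⊕ Time) (a : Fin 2) (ε : ℂ) (f : PS2) (k : ℕ) :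
    coeff k (evalShift e a ε f) = diag (coeff k (miwaHom (tder2 e a) ε f)) := by
  rw [evalShift, RingHom.comp_apply, coeff_map]
  rfl

theorem evalShift_const {e : Time → Time ⊕ Time} {a : Fin 2} {ε : ℂ} {f : PS2}
    (hf : ∀ i, tder2 e a i f = 0) : evalShift e a ε f = C (diag f) := by
  rw [evalShift, RingHom.comp_apply, miwaHom_const hf, PowerSeries.map_C]
  rfl

theorem evalShift_of_lift {e : Time → Time ⊕ Time} {a : Fin 2} {ε : ℂ} {φ : PS →ₐ[ℂ] PS2}
    (hφ : ∀ s f, MvPowerSeries.pderiv ℂ (e s) (φ f) = φ (dt s f)) (hd : ∀ f, diag (φ f) = f)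
    (f : PS) : evalShift e a ε (φ f) = miwaHom (tder a) ε f := by
  have : PowerSeries.map (φ : PS →+* PS2) (miwaHom (tder a) ε f) = miwaHom (tder2 e a) ε (φ f) := by
    refine eq_miwaHom ?_ (by simp)
    ext1 k
    have h := congrArg φ (congrArg (coeff k) (miwaDer_miwaHom (tder a) ε f))
    rw [coeff_miwaDer, map_zero, map_sub, map_mul, map_smul, map_sum, map_add, map_natCast,
      map_one] at h
    rw [coeff_miwaDer, map_zero, coeff_map]
    simp only [coeff_map]
    rw [← map_zero φ, ← h]
    congr 2
    exact Finset.sum_congr rfl fun p _ => hφ _ _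
  ext1 k
  rw [coeff_evalShift, ← this, coeff_map]
  exact hd _

/-- The embedding of the series in `t`. -/
def atTHom : PS →ₐ[ℂ] PS2 :=
  MvPowerSeries.rename (Function.Embedding.inl : Time ↪ Time ⊕ Time)

/-- The embedding of the series in `t'`. -/
def atTHom' : PS →ₐ[ℂ] PS2 :=
  MvPowerSeries.rename (Function.Embedding.inr : Time ↪ Time ⊕ Time)

theorem evalShift_atT (a : Fin 2) (ε : ℂ) (f : PS) :
    evalShift Sum.inl a ε (atT f) = miwaHom (tder a) ε f :=
  evalShift_of_lift (φ := atTHom) pderiv_inl_atT diag_atT f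

theorem evalShift_atT' (a : Fin 2) (ε : ℂ) (f : PS) :
    evalShift Sum.inr a ε (atT' f) = miwaHom (tder a) ε f :=
  evalShift_of_lift (φ := atTHom') pderiv_inr_atT' diag_atT' f

theorem evalShift_inl_atT' (a : Fin 2) (ε : ℂ) (f : PS) :
    evalShift Sum.inl a ε (atT' f) = C f := by
  rw [evalShift_const fun i => pderiv_inl_atT' _ _, diag_atT']

theorem evalShift_inr_atT (a : Fin 2) (ε : ℂ) (f : PS) :
    evalShift Sum.inr a ε (atT f) = C f := by
  rw [evalShift_const fun i => pderiv_inr_atT _ _, diag_atT]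

/-- The shift adds `w^p / p` to the exponent `x_p`, because `ε * ε' = 1`, and `exp(∑ (w y)^p / p) =
1 / (1 - w y)`: the exponential is multiplied by a geometric series. -/
theorem miwaHom_expXi {e : Time → Time ⊕ Time} {a : Fin 2} {ε ε' : ℂ} (hε : ε * ε' = 1)
    {x : ℕ+ → PS2} (hx : ∀ p q, MvPowerSeries.pderiv ℂ (e (a, q)) (x p) =
      if p = q then MvPowerSeries.C ε' else 0) (m : ℤ) :
    miwaHom (tder2 e a) ε (expXi x m) = PowerSeries.mk fun k : ℕ => expXi x (m - k) := by
  refine (eq_miwaHom ?_ (by simp)).symm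
  ext1 k
  rw [coeff_miwaDer, coeff_mk, map_zero]
  have : ∀ p ∈ Finset.HasAntidiagonal.antidiagonal k, tder2 e a p.1
      (coeff p.2 (PowerSeries.mk fun k : ℕ => expXi x (m - k))) =
      ε' • expXi x (m - (k + 1 : ℕ)) := by
    intro p hp
    rw [coeff_mk, tder2, der_expXi (hx · p.1.succPNat), MvPowerSeries.smul_eq_C_mul]
    congr 2
    rw [← Finset.HasAntidiagonal.mem_antidiagonal.1 hp]
    simp only [Nat.succPNat_coe]
    push_cast
    ring
  rw [Finset.sum_congr rfl this, Finset.sum_const, Finset.Nat.card_antidiagonal, smul_comm,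
    smul_smul, hε, one_smul, nsmul_eq_mul, mul_comm]
  push_cast
  exact sub_self _

theorem isLocal_evalShift (e : Time → Time ⊕ Time) (a : Fin 2) (ε : ℂ) (k : ℕ) :
    IsLocal ((coeff (R := PS) k).toAddMonoidHom.comp (evalShift e a ε).toAddMonoidHom) := by
  have h (k : ℕ) : IsLocal
      ((coeff (R := PS2) k).toAddMonoidHom.comp (miwaHom (tder2 e a) ε).toAddMonoidHom) := by
    induction k using Nat.strong_induction_on with
    | _ k ih =>
      cases k with
      | zero =>
        convert IsLocal.id (σ := Time ⊕ Time) using 1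
        ext1 f
        exact coeff_zero_miwaHom _ _ _
      | succ k =>
        have hs : IsLocal (∑ p ∈ Finset.HasAntidiagonal.antidiagonal k,
            (tder2 e a p.1).toLinearMap.toAddMonoidHom.comp
              ((coeff (R := PS2) p.2).toAddMonoidHom.comp
                (miwaHom (tder2 e a) ε).toAddMonoidHom)) :=
          IsLocal.sum _ fun p hp => (IsLocal.pderiv _).comp (ih p.2 (Nat.lt_succ_of_le
            ((Nat.le_add_left _ _).trans_eq (Finset.HasAntidiagonal.mem_antidiagonal.1 hp))))
        intro μ
        obtain ⟨D, hD⟩ := hs μ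
        refine ⟨D, fun f hf => ?_⟩
        have h1 := hD f hf
        rw [AddMonoidHom.finsetSum_apply] at h1
        have h2 := congrArg (MvPowerSeries.coeff μ) (miwaHom_succ (tder2 e a) ε f k)
        have e2 : ((k : PS2) + 1) = MvPowerSeries.C ((k : ℂ) + 1) := by simp
        rw [e2, MvPowerSeries.coeff_mul_C, MvPowerSeries.smul_eq_C_mul, MvPowerSeries.coeff_C_mul]
          at h2
        have h3 : MvPowerSeries.coeff μ (∑ p ∈ Finset.HasAntidiagonal.antidiagonal k,
          tder2 e a p.1 (coeff p.2 (miwaHom (tder2 e a) ε f))) = 0 := h1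
        rw [h3, mul_zero, mul_eq_zero] at h2
        exact h2.resolve_right (Nat.cast_add_one_ne_zero _)
  convert (IsLocal.rename (Sum.elim id id)).comp (h k) using 1
  ext1 f
  exact coeff_evalShift e a ε f k

variable {e : Time → Time ⊕ Time} {a b : Fin 2} {ε ε' : ℂ} {c d : ℤ → PS2} {x : ℕ+ → PS2}

theorem coeff_evalShift_pairing (hc : Bdd b c) (hd : Bdd b d) (hx : Wtd x) (k : ℕ) :
    coeff k (evalShift e a ε (pairing b c d x)) = lsum fun ij : ℤ × ℤ => coeff k
      (evalShift e a ε (c ij.1) * evalShift e a ε (d ij.2) *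
        evalShift e a ε (expXi x (-(sg b * (ij.1 + ij.2))))) := by
  have := map_lsum (locFin_pairing hc hd hx) (isLocal_evalShift e a ε k)
  simp only [← map_mul]
  exact this

/-- The pairing at shifted times is a product of series, if the exponent becomes a geometric
series. -/
theorem evalShift_pairing (hε : ε * ε' = 1) (hx : Wtd x) (hxd : ∀ p, diag (x p) = 0)
    (hxe : ∀ p q, MvPowerSeries.pderiv ℂ (e (a, q)) (x p) =
      if p = q then MvPowerSeries.C ε' else 0)
    {c' d' : ℤ → PS} (hc : ∀ i, evalShift e a ε (c i) = C (c' i))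
    (hd : ∀ i, evalShift e a ε (d i) = miwaHom (tder a) ε (d' i)) {α : ℤ}
    (hc0 : ∀ i, α < sg a * i → c i = 0) (hd0 : ∀ i, -α < sg a * i → d i = 0) :
    evalShift e a ε (pairing a c d x) = PowerSeries.mk (fun u : ℕ => c' (sg a * (α - u))) *
      miwaFull (tder a) ε (PowerSeries.mk fun v : ℕ => d' (sg a * (-α - v))) := by
  ext1 k
  rw [coeff_evalShift_pairing ⟨α, hc0⟩ ⟨-α, hd0⟩ hx]
  -- At shifted equal times only the geometric series is left of the exponential, so its coefficient
  -- of index `m` becomes `w^m`.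
  have hh (m : ℤ) (j : ℕ) : coeff j (evalShift e a ε (expXi x m)) = if m = j then 1 else 0 := by
    rw [coeff_evalShift, miwaHom_expXi hε hxe, coeff_mk, diag_expXi hxd]
    simp [sub_eq_zero]
  -- Here `u` and `v` measure the distance to the bounds `α` and `-α`. As the bounds add up to zero,
  -- the exponential contributes exactly `w^(u + v)`.
  rw [lsum_eq_of_injective (e := fun uv : ℕ × ℕ => (sg a * (α - uv.1), sg a * (-α - uv.2)))]
  · have h1 (uv : ℕ × ℕ) : coeff k (evalShift e a ε (c (sg a * (α - uv.1))) *
        evalShift e a ε (d (sg a * (-α - uv.2))) *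
        evalShift e a ε (expXi x (-(sg a * (sg a * (α - uv.1) + sg a * (-α - uv.2)))))) =
        if uv.1 + uv.2 ≤ k then c' (sg a * (α - uv.1)) *
          coeff (k - (uv.1 + uv.2)) (miwaHom (tder a) ε (d' (sg a * (-α - uv.2)))) else 0 := by
      have e1 : -(sg a * (sg a * (α - uv.1) + sg a * (-α - uv.2))) = ((uv.1 + uv.2 : ℕ) : ℤ) := by
        rw [← mul_add, sg_mul_sg_mul]; push_cast; ring
      have e3 : evalShift e a ε (expXi x ((uv.1 + uv.2 : ℕ) : ℤ)) = X ^ (uv.1 + uv.2) := by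
        ext1 j
        rw [hh, coeff_X_pow]
        simp only [Nat.cast_inj, eq_comm]
      rw [e1, e3, hc, hd, mul_comm, coeff_X_pow_mul', coeff_C_mul]
    simp only [h1]
    rw [lsum_eq_finsum, finsum_eq_sum_of_support_subset
      (s := Finset.range (k + 1) ×ˢ Finset.range (k + 1)), Finset.sum_product, coeff_mul,
      Finset.Nat.sum_antidiagonal_eq_sum_range_succ_mk]
    · refine Finset.sum_congr rfl fun u hu => ?_
      rw [coeff_mk, coeff_miwaFull, Finset.Nat.sum_antidiagonal_eq_sum_range_succ_mk,
        Finset.mul_sum, ← Finset.sum_filter]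
      refine Finset.sum_congr ?_ fun v hv => ?_
      · ext v
        simp only [Finset.mem_filter, Finset.mem_range] at hu ⊢
        omega
      · rw [coeff_mk, Nat.sub_sub]
    · intro uv huv
      rw [Function.mem_support] at huv
      simp only [Finset.coe_product, Finset.coe_range, Set.mem_prod, Set.mem_Iio]
      by_contra h
      exact huv (if_neg (by omega))
    · refine ((Finset.range (k + 1) ×ˢ Finset.range (k + 1)).finite_toSet).subset fun uv huv => ?_
      rw [Function.mem_support] at huv
      simp only [Finset.coe_product, Finset.coe_range, Set.mem_prod, Set.mem_Iio]
      by_contra h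
      exact huv (if_neg (by omega))
  · rintro ⟨u, v⟩ ⟨u', v'⟩ h
    simp only [Prod.mk.injEq] at h ⊢
    rcases sg_cases a with hs | hs <;> rw [hs] at h <;> omega
  · rintro ⟨i, j⟩ hij
    by_cases h1 : α < sg a * i
    · rw [hc0 i h1]; simp
    by_cases h2 : -α < sg a * j
    · rw [hd0 j h2]; simp
    exfalso
    refine hij ⟨((α - sg a * i).toNat, (-α - sg a * j).toNat), ?_⟩
    rcases sg_cases a with hs | hs <;> rw [hs] at h1 h2 ⊢ <;> simp only [Prod.mk.injEq] <;> omega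

/-- A pairing with an unaffected exponent vanishes at shifted times if there is no term of degree
`0`. -/
theorem evalShift_pairing_eq_zero (hx : Wtd x) (hxd : ∀ p, diag (x p) = 0)
    (hxe : ∀ p q, MvPowerSeries.pderiv ℂ (e (a, q)) (x p) = 0) {α β : ℤ}
    (hc0 : ∀ i, α < sg b * i → c i = 0) (hd0 : ∀ i, β < sg b * i → d i = 0) (hαβ : α + β < 0) :
    evalShift e a ε (pairing b c d x) = 0 := by
  ext1 k
  rw [coeff_evalShift_pairing ⟨α, hc0⟩ ⟨β, hd0⟩ hx, map_zero, ← lsum_zero (ι := ℤ × ℤ)]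
  congr 1
  ext1 ⟨i, j⟩
  by_cases h1 : α < sg b * i
  · rw [hc0 i h1]; simp
  by_cases h2 : β < sg b * j
  · rw [hd0 j h2]; simp
  rw [evalShift_const (f := expXi x _) fun i => der_expXi_eq_zero (hxe · _) _, diag_expXi hxd, if_neg]
  · simp
  · simp only [mul_add]
    omega

end Evaluation

end GBMT

namespace GBMT

/-! ### Rings of matrices that are bounded on one side -/

section OpRing

variable {R : Type*} [CommRing R] {a : Fin 2}

/-- The product of two matrices with index set `ℤ`. -/
def mmul (A B : ℤ → ℤ → R) : ℤ → ℤ → R := fun n l => ∑ᶠ k, A n k * B k l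

/-- The matrix has entries only up to the `b`-th diagonal, counted upwards for `a = 0` and
downwards for `a = 1`. -/
def OrdLE (a : Fin 2) (b : ℤ) (A : ℤ → ℤ → R) : Prop := ∀ n k, b < sg a * (k - n) → A n k = 0

theorem OrdLE.mono {b c : ℤ} {A : ℤ → ℤ → R} (h : OrdLE a b A) (hbc : b ≤ c) : OrdLE a c A :=
  fun n k hk => h n k (hbc.trans_lt hk)

theorem OrdLE.zero (b : ℤ) : OrdLE a b (0 : ℤ → ℤ → R) := fun _ _ _ => rfl

theorem OrdLE.add {b : ℤ} {A B : ℤ → ℤ → R} (hA : OrdLE a b A) (hB : OrdLE a b B) :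
    OrdLE a b (A + B) := fun n k hk => by simp [hA n k hk, hB n k hk]

theorem OrdLE.neg {b : ℤ} {A : ℤ → ℤ → R} (hA : OrdLE a b A) :
    OrdLE a b (-A) := fun n k hk => by simp [hA n k hk]

theorem OrdLE.sub {b : ℤ} {A B : ℤ → ℤ → R} (hA : OrdLE a b A) (hB : OrdLE a b B) :
    OrdLE a b (A - B) := fun n k hk => by simp [hA n k hk, hB n k hk]

theorem OrdLE.mmul {b c : ℤ} {A B : ℤ → ℤ → R} (hA : OrdLE a b A) (hB : OrdLE a c B) :
    OrdLE a (b + c) (mmul A B) := by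
  intro n l h
  refine finsum_eq_zero_of_forall_eq_zero fun k => ?_
  by_cases h1 : b < sg a * (k - n)
  · rw [hA n k h1, zero_mul]
  · rw [hB k l (by simp only [mul_sub] at h h1 ⊢; omega), mul_zero]

/-- The integers between two bounds, in the order that belongs to `a`. -/
def seg (a : Fin 2) (u v : ℤ) : Finset ℤ := (Finset.Icc u v).image (sg a * ·)

theorem mem_seg {u v k : ℤ} : k ∈ seg a u v ↔ u ≤ sg a * k ∧ sg a * k ≤ v := by
  simp only [seg, Finset.mem_image, Finset.mem_Icc]
  constructor
  · rintro ⟨i, hi, rfl⟩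
    rwa [sg_mul_sg_mul]
  · exact fun h => ⟨sg a * k, h, sg_mul_sg_mul a k⟩

theorem support_mul_subset {b c : ℤ} {A B : ℤ → ℤ → R} (hA : OrdLE a b A) (hB : OrdLE a c B)
    (n l : ℤ) :
    (Function.support fun k => A n k * B k l) ⊆ seg a (sg a * l - c) (sg a * n + b) := by
  intro k hk
  rw [Finset.mem_coe, mem_seg]
  have h1 : ¬ b < sg a * (k - n) := fun h => hk (by simp [hA n k h])
  have h2 : ¬ c < sg a * (l - k) := fun h => hk (by simp [hB k l h])
  simp only [mul_sub] at h1 h2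
  omega

theorem mmul_eq_sum {b c : ℤ} {A B : ℤ → ℤ → R} (hA : OrdLE a b A) (hB : OrdLE a c B) {n l : ℤ}
    {s : Finset ℤ} (hs : seg a (sg a * l - c) (sg a * n + b) ⊆ s) :
    mmul A B n l = ∑ k ∈ s, A n k * B k l :=
  finsum_eq_sum_of_support_subset _ ((support_mul_subset hA hB n l).trans (by exact_mod_cast hs))

theorem seg_subset {u v u' v' : ℤ} (hu : u' ≤ u) (hv : v ≤ v') : seg a u v ⊆ seg a u' v' := by
  intro k
  rw [mem_seg, mem_seg]
  omega

theorem mmul_assoc {b c d : ℤ} {A B C : ℤ → ℤ → R} (hA : OrdLE a b A) (hB : OrdLE a c B)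
    (hC : OrdLE a d C) : mmul (mmul A B) C = mmul A (mmul B C) := by
  ext n l
  rw [mmul_eq_sum (hA.mmul hB) hC subset_rfl, mmul_eq_sum hA (hB.mmul hC) subset_rfl]
  have h1 : ∀ k ∈ seg a (sg a * l - d) (sg a * n + (b + c)),
      mmul A B n k * C k l = ∑ m ∈ seg a (sg a * l - (c + d)) (sg a * n + b),
        A n m * B m k * C k l := by
    intro k hk
    rw [mem_seg] at hk
    rw [mmul_eq_sum hA hB (seg_subset (u' := sg a * l - (c + d)) (by omega) le_rfl),
      Finset.sum_mul]
  have h2 : ∀ m ∈ seg a (sg a * l - (c + d)) (sg a * n + b),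
      A n m * mmul B C m l = ∑ k ∈ seg a (sg a * l - d) (sg a * n + (b + c)),
        A n m * B m k * C k l := by
    intro m hm
    rw [mem_seg] at hm
    rw [mmul_eq_sum hB hC (seg_subset (v' := sg a * n + (b + c)) le_rfl (by omega)),
      Finset.mul_sum]
    simp only [mul_assoc]
  rw [Finset.sum_congr rfl h1, Finset.sum_congr rfl h2, Finset.sum_comm]

/-- The ring of the matrices that are bounded above, for `a = 0`, or bounded below, for `a = 1`. -/
structure Op (a : Fin 2) (R : Type*) [CommRing R] where
  /-- The entries. -/
  val : ℤ → ℤ → R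
  /-- The matrix is bounded on one side. -/
  exists_ordLE : ∃ b, OrdLE a b val

namespace Op

instance : CoeFun (Op a R) fun _ => ℤ → ℤ → R := ⟨Op.val⟩

theorem val_injective : Function.Injective (Op.val : Op a R → ℤ → ℤ → R) := by
  rintro ⟨A, hA⟩ ⟨B, hB⟩ rfl
  rfl

instance : Add (Op a R) := ⟨fun A B => ⟨A.val + B.val, by
  obtain ⟨b, hb⟩ := A.2
  obtain ⟨c, hc⟩ := B.2
  exact ⟨max b c, (hb.mono (le_max_left _ _)).add (hc.mono (le_max_right _ _))⟩⟩⟩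

instance : Zero (Op a R) := ⟨⟨0, 0, OrdLE.zero _⟩⟩

instance : Neg (Op a R) := ⟨fun A => ⟨-A.val, by
  obtain ⟨b, hb⟩ := A.2
  exact ⟨b, hb.neg⟩⟩⟩

instance : Sub (Op a R) := ⟨fun A B => ⟨A.val - B.val, by
  obtain ⟨b, hb⟩ := A.2
  obtain ⟨c, hc⟩ := B.2
  exact ⟨max b c, (hb.mono (le_max_left _ _)).sub (hc.mono (le_max_right _ _))⟩⟩⟩

instance : SMul ℕ (Op a R) := ⟨fun m A => ⟨m • A.val, by
  obtain ⟨b, hb⟩ := A.2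
  exact ⟨b, fun n k h => by simp [hb n k h]⟩⟩⟩

instance : SMul ℤ (Op a R) := ⟨fun m A => ⟨m • A.val, by
  obtain ⟨b, hb⟩ := A.2
  exact ⟨b, fun n k h => by simp [hb n k h]⟩⟩⟩

instance : AddCommGroup (Op a R) :=
  val_injective.addCommGroup _ rfl (fun _ _ => rfl) (fun _ => rfl) (fun _ _ => rfl)
    (fun _ _ => rfl) fun _ _ => rfl

/-- A bounded matrix as an element of the ring. -/
def ofOrdLE {b : ℤ} (A : ℤ → ℤ → R) (hA : OrdLE a b A) : Op a R := ⟨A, b, hA⟩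

@[ext] theorem ext {A B : Op a R} (h : ∀ n k, A n k = B n k) : A = B :=
  val_injective (funext fun n => funext (h n))

@[simp] theorem add_apply (A B : Op a R) (n k : ℤ) : (A + B) n k = A n k + B n k := rfl
@[simp] theorem zero_apply (n k : ℤ) : (0 : Op a R) n k = 0 := rfl
@[simp] theorem neg_apply (A : Op a R) (n k : ℤ) : (-A) n k = -A n k := rfl
@[simp] theorem sub_apply (A B : Op a R) (n k : ℤ) : (A - B) n k = A n k - B n k := rfl

instance : Mul (Op a R) where
  mul A B := ⟨mmul A B, by
    obtain ⟨b, hb⟩ := A.2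
    obtain ⟨c, hc⟩ := B.2
    exact ⟨_, hb.mmul hc⟩⟩

theorem coe_mul (A B : Op a R) : ((A * B : Op a R) : ℤ → ℤ → R) = mmul A B := rfl

/-- The matrix of the shift `Λ^j`. -/
def shift (a : Fin 2) (R : Type*) [CommRing R] (j : ℤ) : Op a R :=
  ofOrdLE (b := sg a * j) (fun n k => if k = n + j then 1 else 0) fun n k h =>
    if_neg (by rintro rfl; simp at h)

/-- A diagonal matrix. -/
def diagonal (a : Fin 2) (f : ℤ → R) : Op a R :=
  ofOrdLE (b := 0) (fun n k => if k = n then f n else 0) fun n k h =>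
    if_neg (by rintro rfl; simp at h)

theorem finite_support (A B : Op a R) (n l : ℤ) :
    (Function.support fun k => A n k * B k l).Finite := by
  obtain ⟨b, hb⟩ := A.2
  obtain ⟨c, hc⟩ := B.2
  exact (Finset.finite_toSet _).subset (support_mul_subset hb hc n l)

theorem mul_apply (A B : Op a R) (n l : ℤ) : (A * B) n l = ∑ᶠ k, A n k * B k l := rfl

theorem shift_apply (j n k : ℤ) : shift a R j n k = if k = n + j then 1 else 0 := rfl

theorem diagonal_apply (f : ℤ → R) (n k : ℤ) :
    diagonal a f n k = if k = n then f n else 0 := rfl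

@[simp] theorem shift_mul_apply (A : Op a R) (j n k : ℤ) :
    (shift a R j * A) n k = A (n + j) k := by
  rw [mul_apply, finsum_eq_single _ (n + j)]
  · simp [shift_apply]
  · intro m hm
    simp [shift_apply, hm]

@[simp] theorem mul_shift_apply (A : Op a R) (j n k : ℤ) :
    (A * shift a R j) n k = A n (k - j) := by
  rw [mul_apply, finsum_eq_single _ (k - j)]
  · simp [shift_apply]
  · intro m hm
    rw [shift_apply, if_neg (by omega), mul_zero]

@[simp] theorem diagonal_mul_apply (A : Op a R) (f : ℤ → R) (n k : ℤ) :
    (diagonal a f * A) n k = f n * A n k := by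
  rw [mul_apply, finsum_eq_single _ n]
  · simp [diagonal_apply]
  · intro m hm
    simp [diagonal_apply, hm]

@[simp] theorem mul_diagonal_apply (A : Op a R) (f : ℤ → R) (n k : ℤ) :
    (A * diagonal a f) n k = A n k * f k := by
  rw [mul_apply, finsum_eq_single _ k]
  · simp [diagonal_apply]
  · intro m hm
    rw [diagonal_apply, if_neg (Ne.symm hm), mul_zero]

instance : One (Op a R) := ⟨shift a R 0⟩

theorem shift_zero : shift a R 0 = 1 := rfl

@[simp] theorem one_apply (n k : ℤ) : (1 : Op a R) n k = if k = n then 1 else 0 := by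
  rw [← shift_zero, shift_apply, add_zero]

instance : Ring (Op a R) :=
  { (inferInstance : AddCommGroup (Op a R)) with
    mul := (· * ·)
    one := 1
    left_distrib := fun A B C => by
      ext n l
      simp only [mul_apply, add_apply, mul_add]
      exact finsum_add_distrib (finite_support A B n l) (finite_support A C n l)
    right_distrib := fun A B C => by
      ext n l
      simp only [mul_apply, add_apply, add_mul]
      exact finsum_add_distrib (finite_support A C n l) (finite_support B C n l)
    zero_mul := fun A => by ext n l; simp [mul_apply]
    mul_zero := fun A => by ext n l; simp [mul_apply]
    mul_assoc := fun A B C => by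
      obtain ⟨b, hb⟩ := A.2
      obtain ⟨c, hc⟩ := B.2
      obtain ⟨d, hd⟩ := C.2
      exact val_injective (mmul_assoc hb hc hd)
    one_mul := fun A => by ext n l; rw [← shift_zero, shift_mul_apply, add_zero]
    mul_one := fun A => by ext n l; rw [← shift_zero, mul_shift_apply, sub_zero] }

theorem shift_mul_shift (i j : ℤ) : shift a R i * shift a R j = shift a R (i + j) := by
  ext n k
  rw [shift_mul_apply, shift_apply, shift_apply, add_assoc]

end Op

/-! ### Orders and inverses -/

theorem OrdLE.mul {b c : ℤ} {A B : Op a R} (hA : OrdLE a b A) (hB : OrdLE a c B) :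
    OrdLE a (b + c) (A * B) := OrdLE.mmul hA hB

theorem ordLE_one : OrdLE a 0 (1 : Op a R) := fun n k h => by
  rw [Op.one_apply, if_neg]
  rintro rfl
  simp at h

theorem ordLE_shift (j : ℤ) : OrdLE a (sg a * j) (Op.shift a R j) := fun n k h => by
  rw [Op.shift_apply, if_neg]
  rintro rfl
  simp at h

theorem ordLE_diagonal (f : ℤ → R) : OrdLE a 0 (Op.diagonal a f) := fun n k h => by
  rw [Op.diagonal_apply, if_neg]
  rintro rfl
  simp at h

theorem OrdLE.pow {b : ℤ} {A : Op a R} (hA : OrdLE a b A) (p : ℕ) :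
    OrdLE a (p * b) (A ^ p) := by
  induction p with
  | zero => simpa using ordLE_one
  | succ p ih =>
    rw [pow_succ]
    convert ih.mul hA using 1
    push_cast
    ring

theorem OrdLE.eq_zero {A : Op a R} (h : ∀ d : ℕ, OrdLE a (-d) A) : A = 0 := by
  ext n k
  refine h ((-(sg a * (k - n))).toNat + 1) n k ?_
  omega

/-- Entries of a product on the top diagonal. -/
theorem OrdLE.mul_apply {b c : ℤ} {A B : Op a R} (hA : OrdLE a b A) (hB : OrdLE a c B) (n : ℤ) :
    (A * B) n (n + sg a * (b + c)) = A n (n + sg a * b) *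
      B (n + sg a * b) (n + sg a * (b + c)) := by
  rw [Op.mul_apply, finsum_eq_single _ (n + sg a * b)]
  intro k hk
  by_cases h1 : b < sg a * (k - n)
  · rw [hA n k h1, zero_mul]
  · rw [hB k _ ?_, mul_zero]
    have h3 : sg a * (n + sg a * (b + c) - k) = b + c - sg a * (k - n) := by
      linear_combination (b + c) * sg_mul_self a
    have h4 : sg a * (k - n) ≠ b := by
      intro h
      refine hk ?_
      rw [← h, sg_mul_sg_mul]
      ring
    omega

/-- The matrix has order `b`, with units on the top diagonal. -/
structure Lead (b : ℤ) (A : Op a R) : Prop where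
  ord : OrdLE a b A
  unit : ∀ n, IsUnit (A n (n + sg a * b))

theorem Lead.mul {b c : ℤ} {A B : Op a R} (hA : Lead b A) (hB : Lead c B) : Lead (b + c) (A * B) := by
  refine ⟨hA.ord.mul hB.ord, fun n => ?_⟩
  rw [hA.ord.mul_apply hB.ord]
  refine (hA.unit n).mul ?_
  convert hB.unit (n + sg a * b) using 2
  ring

theorem lead_one : Lead 0 (1 : Op a R) := ⟨ordLE_one, fun n => by simp⟩

theorem lead_shift (j : ℤ) : Lead (sg a * j) (Op.shift a R j) :=
  ⟨ordLE_shift j, fun n => by simp [sg_mul_sg_mul, Op.shift_apply]⟩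

/-- The geometric series of a matrix of negative order. -/
def geom (N : Op a R) (hN : OrdLE a (-1) N) : Op a R :=
  Op.ofOrdLE (b := 0) (fun n k => ∑ j ∈ Finset.range (1 - sg a * (k - n)).toNat, (N ^ j) n k)
    fun n k h => Finset.sum_eq_zero fun j _ => hN.pow j n k (by omega)

theorem geom_apply {N : Op a R} (hN : OrdLE a (-1) N) (D : ℕ) :
    OrdLE a (-D) (geom N hN - ∑ j ∈ Finset.range D, N ^ j : Op a R) := by
  intro n k h
  have h1 : ((∑ j ∈ Finset.range D, N ^ j : Op a R)) n k = ∑ j ∈ Finset.range D, (N ^ j) n k := by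
    clear h
    induction D with
    | zero => simp
    | succ D ih => rw [Finset.sum_range_succ, Finset.sum_range_succ, Op.add_apply, ih]
  rw [Op.sub_apply, h1, sub_eq_zero]
  change ∑ j ∈ Finset.range _, _ = _
  refine Finset.sum_subset (Finset.range_subset_range.2 (by omega)) fun j _ hj => ?_
  rw [Finset.mem_range] at hj
  exact hN.pow j n k (by omega)

/-- Up to an error of order at most `-D` the geometric series is its partial sum with `D` terms; a
matrix of order at most `-D` for every `D` is zero. -/
theorem one_sub_mul_geom {N : Op a R} (hN : OrdLE a (-1) N) : (1 - N) * geom N hN = 1 := by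
  rw [← sub_eq_zero]
  refine OrdLE.eq_zero fun D => ?_
  have h1 : (1 - N) * geom N hN - 1 =
      (1 - N) * (geom N hN - ∑ j ∈ Finset.range D, N ^ j) - N ^ D := by
    rw [mul_sub, mul_neg_geom_sum]
    abel
  rw [h1]
  have h2 : OrdLE a 0 (1 - N : Op a R) := ordLE_one.sub (hN.mono (by omega))
  refine OrdLE.sub ?_ ?_
  · simpa using h2.mul (geom_apply hN D)
  · simpa using hN.pow D

theorem geom_mul_one_sub {N : Op a R} (hN : OrdLE a (-1) N) : geom N hN * (1 - N) = 1 := by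
  rw [← sub_eq_zero]
  refine OrdLE.eq_zero fun D => ?_
  have h1 : geom N hN * (1 - N) - 1 =
      (geom N hN - ∑ j ∈ Finset.range D, N ^ j) * (1 - N) - N ^ D := by
    rw [sub_mul, geom_sum_mul_neg]
    abel
  rw [h1]
  have h2 : OrdLE a 0 (1 - N : Op a R) := ordLE_one.sub (hN.mono (by omega))
  refine OrdLE.sub ?_ ?_
  · simpa using (geom_apply hN D).mul h2
  · simpa using hN.pow D

theorem ordLE_geom {N : Op a R} (hN : OrdLE a (-1) N) : OrdLE a 0 (geom N hN) := by
  simpa using geom_apply hN 0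

theorem diagonal_mul_diagonal (f g : ℤ → R) :
    Op.diagonal a f * Op.diagonal a g = Op.diagonal a fun n => f n * g n := by
  ext n k
  rw [Op.diagonal_mul_apply, Op.diagonal_apply, Op.diagonal_apply]
  split_ifs <;> simp

theorem diagonal_one : Op.diagonal a (fun _ => (1 : R)) = 1 := by
  ext n k
  rw [Op.diagonal_apply, Op.one_apply]

/-- A matrix with units on the top diagonal is invertible. -/
theorem Lead.exists_inv {b : ℤ} {A : Op a R} (hA : Lead b A) :
    ∃ B : Op a R, OrdLE a (-b) B ∧ A * B = 1 ∧ B * A = 1 := by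
  choose u hu using fun n => hA.unit n
  set U : Op a R := Op.diagonal a fun n => ↑(u n)⁻¹
  -- Dividing by the top diagonal and moving it to the main one gives `K` with `1 - K` of negative
  -- order, which the geometric series inverts.
  set K : Op a R := U * A * Op.shift a R (-(sg a * b))
  have hK : OrdLE a 0 K := by
    have := ((ordLE_diagonal (a := a) fun n => ((u n)⁻¹ : Rˣ).1).mul hA.ord).mul
      (ordLE_shift (a := a) (R := R) (-(sg a * b)))
    convert this using 1
    rw [mul_neg, sg_mul_sg_mul]
    ring
  have hN : OrdLE a (-1) (1 - K : Op a R) := by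
    intro n k h
    rcases eq_or_ne k n with rfl | hkn
    · have : K k k = 1 := by
        simp only [K, U, Op.mul_shift_apply, Op.diagonal_mul_apply, sub_neg_eq_add, ← hu]
        simp
      rw [Op.sub_apply, this]
      simp
    · have h0 : sg a * (k - n) ≠ 0 := by
        rcases sg_cases a with h | h <;> rw [h] <;> omega
      exact (ordLE_one.sub hK) n k (by omega)
  have hV : (Op.diagonal a fun n => (u n : R)) * U = 1 := by
    simp [U, diagonal_mul_diagonal, diagonal_one]
  have hV' : U * (Op.diagonal a fun n => (u n : R)) = 1 := by
    simp [U, diagonal_mul_diagonal, diagonal_one]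
  have hs : Op.shift a R (-(sg a * b)) * Op.shift a R (sg a * b) = 1 := by
    rw [Op.shift_mul_shift, neg_add_cancel, Op.shift_zero]
  have hs' : Op.shift a R (sg a * b) * Op.shift a R (-(sg a * b)) = 1 := by
    rw [Op.shift_mul_shift, add_neg_cancel, Op.shift_zero]
  have hAK : A = (Op.diagonal a fun n => (u n : R)) * K * Op.shift a R (sg a * b) := by
    calc A = ((Op.diagonal a fun n => (u n : R)) * U) * A *
          (Op.shift a R (-(sg a * b)) * Op.shift a R (sg a * b)) := by rw [hV, hs]; simp
      _ = _ := by simp only [K, mul_assoc]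
  have hKG : K * geom _ hN = 1 := by simpa using one_sub_mul_geom hN
  have hGK : geom _ hN * K = 1 := by simpa using geom_mul_one_sub hN
  refine ⟨Op.shift a R (-(sg a * b)) * geom _ hN * U, ?_, ?_, ?_⟩
  · have := ((ordLE_shift (a := a) (R := R) (-(sg a * b))).mul (ordLE_geom hN)).mul
      (ordLE_diagonal (a := a) fun n => ((u n)⁻¹ : Rˣ).1)
    convert this using 1
    rw [mul_neg, sg_mul_sg_mul]
    ring
  · rw [hAK]
    calc _ = (Op.diagonal a fun n => (u n : R)) * K * (Op.shift a R (sg a * b) *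
          Op.shift a R (-(sg a * b))) * geom _ hN * U := by simp only [mul_assoc]
      _ = (Op.diagonal a fun n => (u n : R)) * (K * geom _ hN) * U := by
        rw [hs', mul_one]; simp only [mul_assoc]
      _ = 1 := by rw [hKG, mul_one, hV]
  · rw [hAK]
    calc _ = Op.shift a R (-(sg a * b)) * geom _ hN * (U * (Op.diagonal a fun n => (u n : R))) *
          K * Op.shift a R (sg a * b) := by simp only [mul_assoc]
      _ = Op.shift a R (-(sg a * b)) * (geom _ hN * K) * Op.shift a R (sg a * b) := by
        rw [hV', mul_one]; simp only [mul_assoc]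
      _ = 1 := by rw [hGK, mul_one, hs]

theorem isUnit_of_mul_isUnit_one {x y : R} (h : x * y = 1) : IsUnit x ∧ IsUnit y :=
  ⟨IsUnit.of_mul_eq_one _ h, IsUnit.of_mul_eq_one _ (mul_comm x y ▸ h)⟩

/-- The inverse of a matrix with a known order has units on the top diagonal. -/
theorem lead_of_mul_eq_one {b : ℤ} {A B : Op a R} (hA : OrdLE a b A) (hB : OrdLE a (-b) B)
    (h : A * B = 1) (h' : B * A = 1) : Lead b A ∧ Lead (-b) B := by
  have h1 (n : ℤ) := hA.mul_apply hB n
  have h2 (n : ℤ) := hB.mul_apply hA n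
  simp only [h, h', add_neg_cancel, neg_add_cancel, mul_zero, add_zero, Op.one_apply,
    if_pos] at h1 h2
  exact ⟨⟨hA, fun n => (isUnit_of_mul_isUnit_one (h1 n).symm).1⟩,
    ⟨hB, fun n => (isUnit_of_mul_isUnit_one (h2 n).symm).1⟩⟩

end OpRing

/-! ### Derivations acting on the entries -/

section OpDer

variable {R : Type*} [CommRing R] [Algebra ℂ R] {a : Fin 2}

/-- A derivation acting on all entries. -/
def Op.der (δ : Derivation ℂ R R) : Op a R →+ Op a R where
  toFun A := ⟨fun n k => δ (A n k), by
    obtain ⟨b, hb⟩ := A.2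
    exact ⟨b, fun n k h => by simp only [hb n k h, map_zero]⟩⟩
  map_zero' := by ext n k; exact map_zero δ
  map_add' A B := by ext n k; exact map_add δ _ _

variable (δ : Derivation ℂ R R)

@[simp] theorem Op.der_apply (A : Op a R) (n k : ℤ) : Op.der δ A n k = δ (A n k) := rfl

theorem Op.der_mul (A B : Op a R) : Op.der δ (A * B) = Op.der δ A * B + A * Op.der δ B := by
  ext n l
  simp only [Op.der_apply, Op.add_apply, Op.mul_apply]
  have h := (δ : R →+ R).map_finsum (Op.finite_support A B n l)
  simp only [AddMonoidHom.coe_coe] at h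
  have h' := finsum_add_distrib (Op.finite_support (Op.der δ A) B n l)
    (Op.finite_support A (Op.der δ B) n l)
  simp only [Op.der_apply] at h'
  rw [h, ← h']
  refine finsum_congr fun k => ?_
  rw [Derivation.leibniz, smul_eq_mul, smul_eq_mul]
  ring

@[simp] theorem Op.der_shift (j : ℤ) : Op.der δ (Op.shift a R j) = 0 := by
  ext n k
  rw [Op.der_apply, Op.shift_apply]
  split_ifs <;> simp

@[simp] theorem Op.der_one : Op.der δ (1 : Op a R) = 0 := Op.der_shift δ 0

theorem OrdLE.der {b : ℤ} {A : Op a R} (hA : OrdLE a b A) : OrdLE a b (Op.der δ A) :=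
  fun n k h => by rw [Op.der_apply, hA n k h, map_zero]

/-- The derivative of an inverse. -/
theorem Op.der_inv {A B : Op a R} (h : A * B = 1) (h' : B * A = 1) :
    Op.der δ B = -(B * Op.der δ A * B) := by
  have h1 := congrArg (Op.der δ) h
  rw [Op.der_mul, Op.der_one] at h1
  have h2 := congrArg (B * ·) h1
  simp only [mul_add, mul_zero, ← mul_assoc, h', one_mul] at h2
  exact eq_neg_of_add_eq_zero_right h2

theorem Op.der_pow_of_comm {A B : Op a R} (h : Op.der δ A = B * A - A * B) (p : ℕ) :
    Op.der δ (A ^ p) = B * A ^ p - A ^ p * B := by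
  induction p with
  | zero => simp
  | succ p ih => rw [pow_succ, Op.der_mul, ih, h]; noncomm_ring

end OpDer

end GBMT

namespace GBMT

open MvPowerSeries

/-! ### Linear systems of differential equations -/

theorem eq_zero_of_dt_eq_mul {f : PS} {c : Time → PS} (hf : ∀ s, dt s f = c s * f)
    (h0 : constantCoeff f = 0) : f = 0 := by
  suffices ∀ (d : ℕ) μ, μ.degree = d → coeff μ f = 0 by
    ext μ; exact this _ μ rfl
  intro d
  induction d using Nat.strong_induction_on with
  | _ d ih =>
    intro μ hμ
    by_cases hs : ∃ s, μ s ≠ 0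
    · obtain ⟨s, hs⟩ := hs
      have hle : Finsupp.single s 1 ≤ μ := by
        rw [Finsupp.single_le_iff]; omega
      obtain ⟨ν, rfl⟩ := exists_add_of_le hle
      have hdeg : ν.degree + 1 = d := by
        rw [← hμ, map_add, Finsupp.degree_single, add_comm]
      have h2 := congrArg (coeff ν) (hf s)
      rw [dt, coeff_pderiv, coeff_mul, Finset.sum_eq_zero, mul_eq_zero] at h2
      · rw [add_comm]
        exact h2.resolve_right (Nat.cast_add_one_ne_zero _)
      · intro p hp
        have hp2 : p.2.degree ≤ ν.degree := by
          rw [← Finset.HasAntidiagonal.mem_antidiagonal.1 hp, map_add]; omega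
        rw [ih p.2.degree (by omega) p.2 rfl, mul_zero]
    · push Not at hs
      rw [show μ = 0 from Finsupp.ext hs, coeff_zero_eq_constantCoeff_apply]
      exact h0

theorem isUnit_of_constantCoeff {f : PS} (h : constantCoeff f ≠ 0) : IsUnit f :=
  isUnit_iff_constantCoeff.2 (isUnit_iff_ne_zero.2 h)

/-- A solution of such a linear system that vanishes at the origin vanishes identically. In this way
leading coefficients that are merely non-zero turn out to be invertible. -/
theorem isUnit_of_dt_eq_mul {f : PS} {c : Time → PS} (hf : ∀ s, dt s f = c s * f)
    (h0 : f ≠ 0) : IsUnit f :=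
  isUnit_of_constantCoeff fun h => h0 (eq_zero_of_dt_eq_mul hf h)

section Frobenius

/-- The monomial `(-t)^μ / μ!`. -/
def expMonomial (μ : Time →₀ ℕ) : PS :=
  monomial μ (μ.prod fun _ k => (-1 : ℂ) ^ k / (k.factorial : ℂ))

theorem dt_expMonomial_of_eq_zero {s : Time} {μ : Time →₀ ℕ} (h : μ s = 0) :
    dt s (expMonomial μ) = 0 := by
  classical
  ext ν
  rw [dt, coeff_pderiv, expMonomial, coeff_monomial, if_neg, zero_mul, map_zero]
  intro hν
  rw [← hν] at h
  simp at h

theorem dt_expMonomial_add (s : Time) (μ : Time →₀ ℕ) :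
    dt s (expMonomial (μ + Finsupp.single s 1)) = -expMonomial μ := by
  classical
  have key : (μ + Finsupp.single s 1).prod (fun _ k => (-1 : ℂ) ^ k / (k.factorial : ℂ)) *
      ((μ s : ℂ) + 1) = -μ.prod fun _ k => (-1 : ℂ) ^ k / (k.factorial : ℂ) := by
    have hs : s ∈ insert s μ.support := Finset.mem_insert_self _ _
    rw [Finsupp.prod_of_support_subset _ (s := insert s μ.support) _ _ (by simp),
      Finsupp.prod_of_support_subset _ (s := insert s μ.support) _ _ (by simp),
      ← Finset.mul_prod_erase _ _ hs, ← Finset.mul_prod_erase _ _ hs]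
    · have : ∀ t ∈ (insert s μ.support).erase s,
          (-1 : ℂ) ^ (μ + Finsupp.single s 1 : Time →₀ ℕ) t / (((μ + Finsupp.single s 1 : Time →₀ ℕ) t).factorial : ℂ) =
          (-1 : ℂ) ^ μ t / ((μ t).factorial : ℂ) := by
        intro t ht
        rw [Finsupp.add_apply, Finsupp.single_eq_of_ne (Finset.ne_of_mem_erase ht), add_zero]
      rw [Finset.prod_congr rfl this, Finsupp.add_apply, Finsupp.single_eq_same,
        Nat.factorial_succ, pow_succ]
      have h1 : ((μ s : ℂ) + 1) ≠ 0 := Nat.cast_add_one_ne_zero _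
      have h2 : ((μ s).factorial : ℂ) ≠ 0 := Nat.cast_ne_zero.2 (Nat.factorial_ne_zero _)
      push_cast
      field_simp
    · exact Finset.subset_insert _ _
    · intro t ht
      rw [Finset.mem_insert]
      by_contra h
      rw [not_or, Finsupp.notMem_support_iff] at h
      rw [Finsupp.mem_support_iff, Finsupp.add_apply, Finsupp.single_eq_of_ne h.1, h.2] at ht
      exact ht rfl
  ext ν
  rw [dt, coeff_pderiv, map_neg, expMonomial, expMonomial, coeff_monomial, coeff_monomial]
  by_cases h : ν = μ
  · subst h
    rw [if_pos rfl, if_pos rfl, key]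
  · rw [if_neg h, if_neg (fun h' => h (add_right_cancel h')), zero_mul, neg_zero]

variable {ι : Type*} (D : Time → ι → Finset ι) (A : Time → ι → ι → PS)

/-- The covariant derivative `∂_s - A_s`. -/
def cov (s : Time) (x : ι → PS) : ι → PS := fun i => dt s (x i) - ∑ k ∈ D s i, A s i k * x k

/-- A compatible system `∂_s x_i = ∑_k A_{s,i,k} x_k` with finite sums has solutions with arbitrary
constant terms. -/
theorem exists_solution (hA : ∀ s r x, cov D A s (cov D A r x) = cov D A r (cov D A s x))
    (x₀ : ι → PS) : ∃ x : ι → PS, (∀ s i, dt s (x i) = ∑ k ∈ D s i, A s i k * x k) ∧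
      ∀ i, constantCoeff (x i) = constantCoeff (x₀ i) := by
  classical
  have : LeftCommutative (cov D A) := ⟨hA⟩
  -- The solution is `∑ (-t)^μ / μ! ∇^μ x₀` with the covariant derivatives `∇_s`; compatibility
  -- makes `∇^μ` independent of the order of its factors.
  set y : (Time →₀ ℕ) → ι → PS := fun μ => (Finsupp.toMultiset μ).foldr (cov D A) x₀ with hy
  have hy0 : y 0 = x₀ := by simp [hy]
  have hys (s : Time) (μ) : y (μ + Finsupp.single s 1) = cov D A s (y μ) := by
    simp only [hy]
    rw [add_comm, map_add, Finsupp.toMultiset_single, one_smul, Multiset.singleton_add,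
      Multiset.foldr_cons]
  have hfin (f : (Time →₀ ℕ) → PS) : LocFin fun μ => expMonomial μ * f μ := by
    intro ν
    refine (Set.finite_Iic ν).subset fun μ hμ => ?_
    by_contra h
    exact hμ (by simp only; rw [expMonomial, coeff_monomial_mul]; exact if_neg h)
  refine ⟨fun i => lsum fun μ => expMonomial μ * y μ i, fun s i => ?_, fun i => ?_⟩
  · have h1 := map_lsum (hfin fun μ => y μ i) (IsLocal.pderiv s)
    change dt s (lsum fun μ => expMonomial μ * y μ i) =
      lsum fun μ => dt s (expMonomial μ * y μ i) at h1
    rw [h1]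
    have h2 (μ) : dt s (expMonomial μ * y μ i) = dt s (expMonomial μ) * y μ i +
        (expMonomial μ * y (μ + Finsupp.single s 1) i +
          ∑ k ∈ D s i, A s i k * (expMonomial μ * y μ k)) := by
      rw [hys, cov, dt, dt, dt, Derivation.leibniz, smul_eq_mul, smul_eq_mul, mul_sub,
        Finset.mul_sum, Finset.sum_congr rfl fun k _ => mul_left_comm (expMonomial μ) _ _]
      ring
    have hs1 : LocFin fun μ => dt s (expMonomial μ) * y μ i := by
      intro ν
      refine (Set.finite_Iic (ν + Finsupp.single s 1)).subset fun μ hμ => ?_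
      by_cases h0 : μ s = 0
      · exact absurd (by simp only; rw [dt_expMonomial_of_eq_zero h0, zero_mul, map_zero]) hμ
      · have hle : Finsupp.single s 1 ≤ μ := by
          rw [Finsupp.single_le_iff]; omega
        obtain ⟨κ, rfl⟩ := exists_add_of_le hle
        rw [add_comm] at hμ ⊢
        rw [Set.mem_Iic]
        by_contra h
        refine hμ ?_
        simp only
        rw [dt_expMonomial_add, expMonomial, neg_mul, map_neg, coeff_monomial_mul, if_neg, neg_zero]
        intro h'
        exact h (by gcongr)
    have hs2 := hfin fun μ => y (μ + Finsupp.single s 1) i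
    have hs3 : ∀ k ∈ D s i, LocFin fun μ => A s i k * (expMonomial μ * y μ k) :=
      fun k _ => (hfin fun μ => y μ k).mul_left _
    simp only [h2]
    rw [lsum_add hs1 (hs2.add (LocFin.sum hs3)), lsum_add hs2 (LocFin.sum hs3), lsum_sum hs3]
    -- Terms without `t_s` drop out; after the substitution `μ ↦ μ + e_s` the others are the
    -- negatives of the terms in which `∇_s` acts on `∇^μ x₀`.
    have h3 : lsum (fun μ => dt s (expMonomial μ) * y μ i) =
        lsum fun μ => -1 * (expMonomial μ * y (μ + Finsupp.single s 1) i) := by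
      rw [lsum_eq_of_injective (add_left_injective (Finsupp.single s 1))]
      · congr 1
        ext1 μ
        rw [dt_expMonomial_add]
        ring
      · intro μ hμ
        by_cases h0 : μ s = 0
        · rw [dt_expMonomial_of_eq_zero h0, zero_mul]
        · have hle : Finsupp.single s 1 ≤ μ := by
            rw [Finsupp.single_le_iff]; omega
          obtain ⟨κ, rfl⟩ := exists_add_of_le hle
          exact absurd ⟨κ, add_comm _ _⟩ hμ
    rw [h3, lsum_mul_left _ hs2, neg_one_mul, neg_add_cancel_left]
    exact Finset.sum_congr rfl fun k _ => lsum_mul_left _ (hfin _)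
  · rw [← coeff_zero_eq_constantCoeff_apply, coeff_lsum, finsum_eq_single _ 0]
    · rw [hy0, expMonomial, Finsupp.prod_zero_index]
      change coeff 0 (1 * x₀ i) = _
      rw [one_mul, coeff_zero_eq_constantCoeff_apply]
    · intro μ hμ
      rw [expMonomial, coeff_monomial_mul, if_neg]
      simpa using hμ

end Frobenius

end GBMT

namespace GBMT

/-! ### Bands and half matrices -/

section Band

variable {R : Type*} [CommRing R] {a : Fin 2}

/-- Matrices that are bounded on both sides, with vanishing row sums. -/
structure Band (R : Type*) [CommRing R] where
  /-- The entries. -/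
  val : ℤ → ℤ → R
  /-- The matrix is bounded on both sides. -/
  exists_ordLE : ∃ b, ∀ a, OrdLE a b val
  /-- The row sums vanish. -/
  rowSum : ∀ n, ∑ᶠ k, val n k = 0

/-- A band as an element of the rings of matrices that are bounded on one side. -/
def Band.op (B : Band R) (a : Fin 2) : Op a R := ⟨B.val, B.exists_ordLE.imp fun _ h => h a⟩

@[simp] theorem Band.op_apply (B : Band R) (a : Fin 2) (n k : ℤ) : B.op a n k = B.val n k := rfl

theorem finite_row_of_ordLE {A : ℤ → ℤ → R} {b : ℤ} (h : ∀ a, OrdLE a b A) (n : ℤ) :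
    (Function.support (A n)).Finite := by
  refine (Set.finite_Icc (n - |b|) (n + |b|)).subset fun k hk => ?_
  have h0 : ¬ b < sg 0 * (k - n) := fun h' => hk (h 0 n k h')
  have h1 : ¬ b < sg 1 * (k - n) := fun h' => hk (h 1 n k h')
  have e0 : sg 0 = 1 := rfl
  have e1 : sg 1 = -1 := rfl
  rw [e0] at h0
  rw [e1] at h1
  have := le_abs_self b
  rw [Set.mem_Icc]
  omega

theorem finite_col_of_ordLE {A : ℤ → ℤ → R} {b : ℤ} (h : ∀ a, OrdLE a b A) (k : ℤ) :
    (Function.support fun n => A n k).Finite := by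
  refine (Set.finite_Icc (k - |b|) (k + |b|)).subset fun n hk => ?_
  have h0 : ¬ b < sg 0 * (k - n) := fun h' => hk (h 0 n k h')
  have h1 : ¬ b < sg 1 * (k - n) := fun h' => hk (h 1 n k h')
  have e0 : sg 0 = 1 := rfl
  have e1 : sg 1 = -1 := rfl
  rw [e0] at h0
  rw [e1] at h1
  have := le_abs_self b
  rw [Set.mem_Icc]
  omega

theorem Band.finite_row (B : Band R) (n : ℤ) : (Function.support (B.val n)).Finite :=
  finite_row_of_ordLE B.exists_ordLE.choose_spec n

/-- The matrix `∑_{j ≥ 0} Λ^{-j}` for `a = 0` and `∑_{j ≥ 1} Λ^j` for `a = 1`. -/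
def half (a : Fin 2) (R : Type*) [CommRing R] : Op a R :=
  Op.ofOrdLE (b := 0) (fun n k => if a = 0 then (if k ≤ n then 1 else 0) else if n < k then 1 else 0)
    fun n k h => by
      unfold sg at h
      dsimp only
      split_ifs at h ⊢ <;> first | rfl | omega

/-- The inverse of the half matrix. -/
def halfInv (a : Fin 2) (R : Type*) [CommRing R] : Op a R := sg a • (1 - Op.shift a R (-1))

theorem half_zero_apply (n k : ℤ) : half 0 R n k = if k ≤ n then 1 else 0 := rfl

theorem half_one_apply (n k : ℤ) : half 1 R n k = if n < k then 1 else 0 := rfl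

/-- The two expansions of `Δ^{-1}` differ by the matrix of ones. At equal times this is the source
of the right-hand sides of the bilinear identities other than the constraint. -/
theorem half_add_half (n k : ℤ) : half 0 R n k + half 1 R n k = 1 := by
  rw [half_zero_apply, half_one_apply]
  split_ifs <;> first | omega | simp

theorem half_mul_halfInv : half a R * halfInv a R = 1 := by
  ext n k
  rw [halfInv, mul_smul_comm, mul_sub, mul_one]
  fin_cases a
  · change sg 0 • (half 0 R n k - (half 0 R * Op.shift 0 R (-1)) n k) = _
    rw [Op.mul_shift_apply, half_zero_apply, half_zero_apply, Op.one_apply]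
    rw [show sg 0 = 1 from rfl]
    split_ifs <;> first | omega | simp
  · change sg 1 • (half 1 R n k - (half 1 R * Op.shift 1 R (-1)) n k) = _
    rw [Op.mul_shift_apply, half_one_apply, half_one_apply, Op.one_apply]
    rw [show sg 1 = -1 from rfl]
    split_ifs <;> first | omega | simp

theorem halfInv_mul_half : halfInv a R * half a R = 1 := by
  ext n k
  rw [halfInv, smul_mul_assoc, sub_mul, one_mul]
  fin_cases a
  · change sg 0 • (half 0 R n k - (Op.shift 0 R (-1) * half 0 R) n k) = _
    rw [Op.shift_mul_apply, half_zero_apply, half_zero_apply, Op.one_apply]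
    rw [show sg 0 = 1 from rfl]
    split_ifs <;> first | omega | simp
  · change sg 1 • (half 1 R n k - (Op.shift 1 R (-1) * half 1 R) n k) = _
    rw [Op.shift_mul_apply, half_one_apply, half_one_apply, Op.one_apply]
    rw [show sg 1 = -1 from rfl]
    split_ifs <;> first | omega | simp

theorem halfInv_mul_apply (A : Op a R) (n k : ℤ) :
    (halfInv a R * A) n k = sg a • (A n k - A (n - 1) k) := by
  rw [halfInv, smul_mul_assoc, sub_mul, one_mul]
  change sg a • (A n k - (Op.shift a R (-1) * A) n k) = _
  rw [Op.shift_mul_apply]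
  rfl

theorem mul_halfInv_apply (A : Op a R) (n k : ℤ) :
    (A * halfInv a R) n k = sg a • (A n k - A n (k + 1)) := by
  rw [halfInv, mul_smul_comm, mul_sub, mul_one]
  change sg a • (A n k - (A * Op.shift a R (-1)) n k) = _
  rw [Op.mul_shift_apply, sub_neg_eq_add]

theorem Band.op_mul_apply (B : Band R) (A : Op a R) (n j : ℤ) :
    (B.op a * A) n j = ∑ k ∈ (B.finite_row n).toFinset, B.val n k * A k j := by
  rw [Op.mul_apply]
  refine finsum_eq_sum_of_support_subset _ fun k hk => ?_
  rw [Set.Finite.coe_toFinset]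
  exact fun h => hk (by simp [h])

theorem Band.sum_row (B : Band R) (n : ℤ) : ∑ k ∈ (B.finite_row n).toFinset, B.val n k = 0 := by
  rw [← B.rowSum n]
  exact (finsum_eq_sum_of_support_subset _ (by rw [Set.Finite.coe_toFinset])).symm

/-- The sums over the two halves of a row are opposite. -/
theorem Band.op_mul_half_add (B : Band R) (n j : ℤ) :
    (B.op 0 * half 0 R) n j + (B.op 1 * half 1 R) n j = 0 := by
  rw [B.op_mul_apply, B.op_mul_apply, ← Finset.sum_add_distrib]
  simp only [← mul_add, half_add_half, mul_one]
  exact B.sum_row n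

/-- The conjugate of a band by the difference operator. -/
def Band.conj (B : Band R) : ℤ → ℤ → R := (halfInv 0 R * B.op 0 * half 0 R).val

/-- As `B` annihilates constants, its products with the two halves are opposite, and the sign in
`halfInv` compensates this. So both expansions of `Δ^{-1}` give the same conjugate, which is
therefore bounded on both sides. -/
theorem Band.conj_eq (B : Band R) (a : Fin 2) (n k : ℤ) :
    (halfInv a R * B.op a * half a R) n k = B.conj n k := by
  fin_cases a
  · rfl
  · change (halfInv 1 R * B.op 1 * half 1 R) n k = (halfInv 0 R * B.op 0 * half 0 R) n k
    rw [mul_assoc, mul_assoc, halfInv_mul_apply, halfInv_mul_apply]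
    have h1 := B.op_mul_half_add n k
    have h2 := B.op_mul_half_add (n - 1) k
    rw [eq_neg_of_add_eq_zero_left h1, eq_neg_of_add_eq_zero_left h2, show sg 0 = 1 from rfl,
      show sg 1 = -1 from rfl]
    simp only [neg_smul, one_smul]
    ring

theorem Band.exists_ordLE_conj (B : Band R) : ∃ b, ∀ a, OrdLE a b B.conj := by
  obtain ⟨b, hb⟩ := (halfInv 0 R * B.op 0 * half 0 R).exists_ordLE
  obtain ⟨c, hc⟩ := (halfInv 1 R * B.op 1 * half 1 R).exists_ordLE
  refine ⟨max b c, fun a n k h => ?_⟩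
  rw [← B.conj_eq a]
  fin_cases a
  · exact hb n k ((le_max_left _ _).trans_lt h)
  · exact hc n k ((le_max_right _ _).trans_lt h)

theorem Band.finite_col_conj (B : Band R) (k : ℤ) :
    (Function.support fun n => B.conj n k).Finite :=
  finite_col_of_ordLE B.exists_ordLE_conj.choose_spec k

theorem Band.mul_conj_apply (B : Band R) (A : Op a R) (n j : ℤ) :
    (A * (halfInv a R * B.op a * half a R)) n j =
      ∑ k ∈ (B.finite_col_conj j).toFinset, B.conj k j * A n k := by
  rw [Op.mul_apply]
  simp only [B.conj_eq, mul_comm (A n _)]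
  refine finsum_eq_sum_of_support_subset _ fun k hk => ?_
  rw [Set.Finite.coe_toFinset]
  exact fun h => hk (by
    have h' : B.conj k j = 0 := h
    simp [h'])

end Band

/-! ### Dressing operators and their bilinear identities -/

section Dressed

open MvPowerSeries

/-- The derivatives of all entries of a matrix with respect to a time. -/
abbrev opDt {a : Fin 2} (s : Time) : Op a PS →+ Op a PS := Op.der (pderiv ℂ s)

/-- Wave operators with their inverses, in terms of matrices. -/
structure IsDressed (B : Time → Band PS) (S T : ∀ a, Op a PS) : Prop where
  ordS : ∀ a, OrdLE a 0 (S a)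
  ordT : ∀ a, OrdLE a 0 (T a)
  mul_inv : ∀ a, S a * T a = 1
  inv_mul : ∀ a, T a * S a = 1
  evol : ∀ a s, opDt s (S a) =
    (B s).op a * S a - if s.1 = a then S a * Op.shift a PS (sg a * s.2) else 0

variable {B : Time → Band PS} {S T : ∀ a, Op a PS}

/-- The evolution of the dual wave functions, from `∂T = -T (∂S) T`. Inserting `half a * halfInv a =
1` lets the band act from the right through its conjugate. -/
theorem IsDressed.evol_star (h : IsDressed B S T) (a : Fin 2) (s : Time) :
    opDt s (T a * half a PS) =
      -(T a * half a PS * (halfInv a PS * (B s).op a * half a PS)) +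
        if s.1 = a then Op.shift a PS (sg a * s.2) * (T a * half a PS) else 0 := by
  have h0 : opDt s (half a PS) = 0 := by
    refine Op.ext fun n k => ?_
    change dt s (if a = 0 then (if k ≤ n then 1 else 0) else if n < k then 1 else 0) = 0
    unfold dt
    split_ifs <;> simp
  have h1 : T a * half a PS * (halfInv a PS * (B s).op a * half a PS) =
      T a * (B s).op a * half a PS := by
    calc _ = T a * (half a PS * halfInv a PS) * (B s).op a * half a PS := by
          simp only [mul_assoc]
      _ = _ := by rw [half_mul_halfInv, mul_one]
  rw [Op.der_mul, h0, mul_zero, add_zero, Op.der_inv _ (h.mul_inv a) (h.inv_mul a), h.evol, h1]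
  have h2 : T a * (B s).op a * S a * T a = T a * (B s).op a := by
    rw [mul_assoc, h.mul_inv, mul_one]
  split_ifs
  · have h3 : T a * (S a * Op.shift a PS (sg a * s.2)) * T a = Op.shift a PS (sg a * s.2) * T a := by
      rw [← mul_assoc, h.inv_mul, one_mul]
    rw [mul_sub, sub_mul, ← mul_assoc, h2, h3, neg_sub, sub_mul]
    simp only [mul_assoc]
    abel
  · rw [sub_zero, ← mul_assoc, h2, add_zero, neg_mul]

/-- Uniqueness for pairings whose first factor satisfies linear differential equations. -/
theorem pairing_eq_of_flow {e : Time → Time ⊕ Time} (he : e = Sum.inl ∨ e = Sum.inr)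
    {φ : PS →ₐ[ℂ] PS2} (hφ : ∀ s f, pderiv ℂ (e s) (φ f) = φ (dt s f)) {c : Fin 2 → ℤ → ℤ → PS}
    {ε : PS} {d : Fin 2 → ℤ → PS2} {x : Fin 2 → ℕ+ → PS2} {G : ℤ → PS2}
    (hcb : ∀ a n, Bdd a (c a n)) (hdb : ∀ a, Bdd a (d a)) (hxw : ∀ a, Wtd (x a))
    (hd : ∀ s a j, pderiv ℂ (e s) (d a j) = 0)
    (hx : ∀ s a p, pderiv ℂ (e s) (x a p) = if p = s.2 then (if a = s.1 then φ ε else 0) else 0)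
    (hflow : ∀ s n, ∃ (D : Finset ℤ) (b : ℤ → PS),
      (∀ a j, dt s (c a n j) = ∑ k ∈ D, b k * c a k j -
        if s.1 = a then ε * c a n (j - sg a * s.2) else 0) ∧
      pderiv ℂ (e s) (G n) = ∑ k ∈ D, φ (b k) * G k)
    (hdiag : ∀ n, diag (pairing 0 (fun j => φ (c 0 n j)) (d 0) (x 0)) +
      diag (pairing 1 (fun j => φ (c 1 n j)) (d 1) (x 1)) = diag (G n)) (n : ℤ) :
    pairing 0 (fun j => φ (c 0 n j)) (d 0) (x 0) +
      pairing 1 (fun j => φ (c 1 n j)) (d 1) (x 1) = G n := by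
  rw [← sub_eq_zero]
  refine eq_zero_of_flow he (F := fun n => pairing 0 (fun j => φ (c 0 n j)) (d 0) (x 0) +
      pairing 1 (fun j => φ (c 1 n j)) (d 1) (x 1) - G n) (fun s n => ?_) (fun n => ?_) n
  · obtain ⟨D, b, hb, hG⟩ := hflow s n
    refine ⟨D, fun k => φ (b k), ?_⟩
    -- The derivative of the exponential cancels the shifted term in the flow of `c`, and the linear
    -- combination with coefficients `b` is left.
    have h1 (a : Fin 2) : pderiv ℂ (e s) (pairing a (fun j => φ (c a n j)) (d a) (x a)) =
        ∑ k ∈ D, φ (b k) * pairing a (fun j => φ (c a k j)) (d a) (x a) := by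
      rw [pderiv_pairing ((hcb a n).comp (map_zero φ)) (hdb a) (hxw a) (hd s a) (hx s a),
        ← pairing_sum_left (fun k _ => (hcb a k).comp (map_zero φ)) (hdb a) (hxw a)]
      congr 1
      ext1 j
      rw [hφ, hb, map_sub, map_sum]
      simp only [map_mul]
      by_cases hs : s.1 = a
      · rw [if_pos hs, if_pos hs.symm, map_mul, sub_add_cancel]
      · rw [if_neg hs, if_neg (Ne.symm hs), map_zero, zero_mul, sub_zero, add_zero]
    rw [map_sub, map_add, h1, h1, hG, ← Finset.sum_add_distrib, ← Finset.sum_sub_distrib]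
    exact Finset.sum_congr rfl fun k _ => by ring
  · rw [map_sub, map_add, hdiag, sub_self]

theorem bdd_row {a : Fin 2} (A : Op a PS) (n : ℤ) : Bdd a (A n) := by
  obtain ⟨b, hb⟩ := A.exists_ordLE
  refine ⟨b + sg a * n, fun i hi => hb n i ?_⟩
  rw [mul_sub]; omega

theorem bdd_col {a : Fin 2} (A : Op a PS) (n : ℤ) : Bdd a fun j => A (-j) n := by
  obtain ⟨b, hb⟩ := A.exists_ordLE
  refine ⟨b - sg a * n, fun i hi => hb _ _ ?_⟩
  rw [sub_neg_eq_add, mul_add]; omega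

/-- Pairings with the rows of the wave operators are determined by their values on the diagonal. -/
theorem IsDressed.pairing_eq (h : IsDressed B S T) {e : Time → Time ⊕ Time}
    (he : e = Sum.inl ∨ e = Sum.inr) {φ : PS →ₐ[ℂ] PS2}
    (hφ : ∀ s f, pderiv ℂ (e s) (φ f) = φ (dt s f)) (hφd : ∀ f, diag (φ f) = f)
    {d : Fin 2 → ℤ → PS2} {x : Fin 2 → ℕ+ → PS2} {G : ℤ → PS2} {j : Fin 2 → ℤ}
    (hdb : ∀ a, Bdd a (d a)) (hxw : ∀ a, Wtd (x a)) (hxd : ∀ a p, diag (x a p) = 0)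
    (hd : ∀ s a j, pderiv ℂ (e s) (d a j) = 0)
    (hx : ∀ s a p, pderiv ℂ (e s) (x a p) = if p = s.2 then (if a = s.1 then 1 else 0) else 0)
    (hG : ∀ s n, pderiv ℂ (e s) (G n) =
      ∑ k ∈ ((B s).finite_row n).toFinset, φ ((B s).val n k) * G k)
    (hdiag : ∀ n, (∑ᶠ i, (S 0 * Op.shift 0 PS (j 0)) n i * diag (d 0 (-i))) +
      ∑ᶠ i, (S 1 * Op.shift 1 PS (j 1)) n i * diag (d 1 (-i)) = diag (G n)) (n : ℤ) :
    pairing 0 (fun i => φ ((S 0 * Op.shift 0 PS (j 0)) n i)) (d 0) (x 0) +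
      pairing 1 (fun i => φ ((S 1 * Op.shift 1 PS (j 1)) n i)) (d 1) (x 1) = G n := by
  refine pairing_eq_of_flow he hφ (c := fun a n i => (S a * Op.shift a PS (j a)) n i) (ε := 1)
    (fun a n => bdd_row _ n) hdb hxw hd (by simpa using hx) (fun s n => ?_) (fun n => ?_) n
  · refine ⟨_, (B s).val n, fun a i => ?_, hG s n⟩
    have h1 : opDt s (S a * Op.shift a PS (j a)) = (B s).op a * (S a * Op.shift a PS (j a)) -
        if s.1 = a then S a * Op.shift a PS (j a) * Op.shift a PS (sg a * s.2) else 0 := by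
      rw [Op.der_mul, Op.der_shift, mul_zero, add_zero, h.evol, sub_mul, mul_assoc]
      split_ifs
      · rw [mul_assoc, mul_assoc, Op.shift_mul_shift, Op.shift_mul_shift, add_comm]
      · rw [zero_mul]
    have h2 := congrArg (fun A : Op a PS => A n i) h1
    simp only [Op.sub_apply] at h2
    rw [(B s).op_mul_apply] at h2
    refine h2.trans ?_
    congr 1
    split_ifs
    · rw [Op.mul_shift_apply _ (sg a * s.2), one_mul]
    · rfl
  · rw [diag_pairing ((bdd_row _ n).comp (map_zero φ)) (hdb 0) (hxw 0) (hxd 0),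
      diag_pairing ((bdd_row _ n).comp (map_zero φ)) (hdb 1) (hxw 1) (hxd 1)]
    simp only [hφd]
    exact hdiag n

/-- Pairings with the columns of the inverse wave operators are determined by their values on the
diagonal. -/
theorem IsDressed.pairing_star_eq (h : IsDressed B S T)
    {d : Fin 2 → ℤ → PS} {G : ℤ → PS2} (hdb : ∀ a, Bdd a (d a))
    (hG : ∀ s n, pderiv ℂ (Sum.inr s) (G n) =
      -∑ k ∈ ((B s).finite_col_conj n).toFinset, atT' ((B s).conj k n) * G k)
    (hdiag : ∀ n, (∑ᶠ i, d 0 i * (T 0 * half 0 PS) i n) +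
      ∑ᶠ i, d 1 i * (T 1 * half 1 PS) i n = diag (G n)) (n : ℤ) :
    pairing 0 (fun i => atT (d 0 i)) (fun i => atT' ((T 0 * half 0 PS) (-i) n)) (dT 0) +
      pairing 1 (fun i => atT (d 1 i)) (fun i => atT' ((T 1 * half 1 PS) (-i) n)) (dT 1) = G n := by
  have hb (a) : Bdd a fun i => atT (d a i) := (hdb a).comp (map_zero atTHom)
  have hc (a) (n : ℤ) : Bdd a fun i => atTHom' ((T a * half a PS) (-i) n) :=
    (bdd_col _ n).comp (map_zero atTHom')
  -- The flow is now in `t'`, so the dual functions become the first factor. The exponents `t - t'`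
  -- have derivative `-1` in `t'`, whence `ε = -1`.
  rw [pairing_comm 0, pairing_comm 1]
  refine pairing_eq_of_flow (Or.inr rfl) (φ := atTHom') pderiv_inr_atT'
    (c := fun a n i => (T a * half a PS) (-i) n) (ε := -1) (fun a n => bdd_col _ n) hb wtd_dT
    (fun s a i => pderiv_inr_atT _ _) (fun s a p => ?_) (fun s n => ?_) (fun n => ?_) n
  · rw [pderiv_inr_dT]
    split_ifs <;> simp
  · refine ⟨((B s).finite_col_conj n).toFinset, fun k => -(B s).conj k n, fun a i => ?_, ?_⟩
    · have h2 := congrArg (fun A : Op a PS => A (-i) n) (h.evol_star a s)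
      simp only [Op.add_apply, Op.neg_apply] at h2
      rw [(B s).mul_conj_apply] at h2
      refine h2.trans ?_
      simp only [neg_mul, one_mul, Finset.sum_neg_distrib]
      rw [sub_eq_add_neg]
      congr 1
      split_ifs
      · rw [Op.shift_mul_apply, neg_neg, neg_sub, sub_eq_neg_add, add_comm]
      · simp
    · rw [hG]
      simp only [map_neg, neg_mul, Finset.sum_neg_distrib]
      rfl
  · rw [← hdiag, diag_pairing (hc 0 n) (hb 0) (wtd_dT 0) (diag_dT 0),
      diag_pairing (hc 1 n) (hb 1) (wtd_dT 1) (diag_dT 1)]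
    have h1 (a : Fin 2) : (∑ᶠ i, diag (atT' ((T a * half a PS) (-i) n)) * diag (atT (d a (-i)))) =
        ∑ᶠ i, d a i * (T a * half a PS) i n := by
      rw [← finsum_comp_equiv (Equiv.neg ℤ)]
      refine finsum_congr fun i => ?_
      rw [diag_atT, diag_atT', Equiv.neg_apply, neg_neg, mul_comm]
    exact congrArg₂ (· + ·) (h1 0) (h1 1)

end Dressed

end GBMT

namespace GBMT

/-! ### The bilinear identities of dressing operators -/

open MvPowerSeries

variable {B : Time → Band PS} {S T : ∀ a, Op a PS}

theorem bdd_atT {a : Fin 2} {c : ℤ → PS} (hc : Bdd a c) : Bdd a fun i => atT (c i) :=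
  hc.comp (map_zero atTHom)

theorem bdd_atT' {a : Fin 2} {c : ℤ → PS} (hc : Bdd a c) : Bdd a fun i => atT' (c i) :=
  hc.comp (map_zero atTHom')

/-- Functions with `∂_s q_n = B_s(q_n)`. -/
def IsEigen (B : Time → Band PS) (q : ℤ → PS) : Prop := ∀ s n,
  dt s (q n) = ∑ k ∈ ((B s).finite_row n).toFinset, (B s).val n k * q k

/-- Functions with `∂_s r_n = -(Δ^{-1} B_s^* Δ)(r_n)`. -/
def IsAdjEigen (B : Time → Band PS) (r : ℤ → PS) : Prop := ∀ s n,
  dt s (r n) = -∑ k ∈ ((B s).finite_col_conj n).toFinset, (B s).conj k n * r k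

theorem isEigen_one (B : Time → Band PS) : IsEigen B fun _ => 1 := fun s n => by
  simp only [mul_one]
  rw [(B s).sum_row, dt, Derivation.map_one_eq_zero]

/-- For fixed `t'` both sides satisfy the linear flow of eigenfunctions in `t`, so it is enough to
compare them at `t = t'`, which is the matrix identity `hK`. -/
theorem IsDressed.pairing_row_eq (h : IsDressed B S T) {K : ∀ a, Op a PS} {q : ℤ → PS}
    (hq : IsEigen B q) {n' : ℤ} (hK : ∀ n, (S 0 * K 0) n n' + (S 1 * K 1) n n' = q n) (n : ℤ) :
    pairing 0 (fun i => atT (S 0 n i)) (fun i => atT' (K 0 (-i) n')) (dT 0) +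
      pairing 1 (fun i => atT (S 1 n i)) (fun i => atT' (K 1 (-i) n')) (dT 1) = atT (q n) := by
  have := h.pairing_eq (Or.inl rfl) (φ := atTHom) pderiv_inl_atT diag_atT (j := 0)
    (d := fun a i => atT' (K a (-i) n')) (x := dT) (G := fun n => atT (q n))
    (fun a => bdd_atT' (bdd_col _ _)) wtd_dT diag_dT (fun s a i => pderiv_inl_atT' _ _)
    (fun s a p => by rw [pderiv_inl_dT]) (fun s n => ?_) (fun n => ?_) n
  · simp only [Pi.zero_apply, Op.shift_zero, mul_one] at this
    exact this
  · rw [pderiv_inl_atT, hq s n]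
    change atTHom _ = ∑ k ∈ _, atTHom _ * atTHom _
    simp only [map_sum, map_mul]
  · simp only [Pi.zero_apply, Op.shift_zero, mul_one, diag_atT', diag_atT, neg_neg]
    exact hK n

theorem diagonal_mul_half_add (q : ℤ → PS) (n n' : ℤ) :
    (Op.diagonal 0 q * half 0 PS) n n' + (Op.diagonal 1 q * half 1 PS) n n' = q n := by
  rw [Op.diagonal_mul_apply, Op.diagonal_mul_apply, ← mul_add, half_add_half, mul_one]

/-- The pairing that reproduces an eigenfunction. -/
theorem IsDressed.pairing_eigen (h : IsDressed B S T) {q : ℤ → PS} (hq : IsEigen B q) (n n' : ℤ) :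
    pairing 0 (fun i => atT (S 0 n i))
        (fun i => atT' ((T 0 * (Op.diagonal 0 q * half 0 PS)) (-i) n')) (dT 0) +
      pairing 1 (fun i => atT (S 1 n i))
        (fun i => atT' ((T 1 * (Op.diagonal 1 q * half 1 PS)) (-i) n')) (dT 1) = atT (q n) := by
  refine h.pairing_row_eq (K := fun a => T a * (Op.diagonal a q * half a PS)) hq (fun n => ?_) n
  rw [← mul_assoc (S 0), ← mul_assoc (S 1), h.mul_inv, h.mul_inv, one_mul, one_mul,
    diagonal_mul_half_add]

/-- The bilinear identity of the wave functions without a spectral factor. -/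
theorem IsDressed.pairing_one (h : IsDressed B S T) (n n' : ℤ) :
    pairing 0 (fun i => atT (S 0 n i)) (fun i => atT' ((T 0 * half 0 PS) (-i) n')) (dT 0) +
      pairing 1 (fun i => atT (S 1 n i)) (fun i => atT' ((T 1 * half 1 PS) (-i) n')) (dT 1) =
      1 := by
  have := h.pairing_eigen (isEigen_one B) n n'
  simp only [diagonal_one, one_mul] at this
  rw [this]
  exact map_one atTHom

/-- The pairing that reproduces an adjoint eigenfunction. -/
theorem IsDressed.pairing_adjEigen (h : IsDressed B S T) {r : ℤ → PS} (hr : IsAdjEigen B r)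
    (n n' : ℤ) :
    pairing 0 (fun i => atT ((half 0 PS * Op.diagonal 0 r * halfInv 0 PS * S 0) n i))
        (fun i => atT' ((T 0 * half 0 PS) (-i) n')) (dT 0) +
      pairing 1 (fun i => atT ((half 1 PS * Op.diagonal 1 r * halfInv 1 PS * S 1) n i))
        (fun i => atT' ((T 1 * half 1 PS) (-i) n')) (dT 1) = atT' (r n') := by
  refine h.pairing_star_eq
    (d := fun a i => (half a PS * Op.diagonal a r * halfInv a PS * S a) n i)
    (G := fun n' => atT' (r n')) (fun a => bdd_row _ _) (fun s n' => ?_) (fun n' => ?_) n'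
  · rw [pderiv_inr_atT', hr s n']
    change atTHom' _ = -∑ k ∈ _, atTHom' _ * atTHom' _
    simp only [map_neg, map_sum, map_mul]
  -- At equal times `S a * T a` and `halfInv a * half a` cancel, and the remaining two types add up
  -- to `r` by `half_add_half`.
  · have h1 (a : Fin 2) : half a PS * Op.diagonal a r * halfInv a PS * S a * (T a * half a PS) =
        half a PS * Op.diagonal a r := by
      calc _ = half a PS * Op.diagonal a r * halfInv a PS * (S a * T a) * half a PS := by
            simp only [mul_assoc]
        _ = half a PS * Op.diagonal a r * (halfInv a PS * half a PS) := by
            rw [h.mul_inv, mul_one]; simp only [mul_assoc]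
        _ = _ := by rw [halfInv_mul_half, mul_one]
    rw [diag_atT', ← Op.mul_apply, ← Op.mul_apply, h1, h1, Op.mul_diagonal_apply,
      Op.mul_diagonal_apply, ← add_mul, half_add_half, one_mul]

/-- The bilinear identity with spectral factors. -/
theorem IsDressed.pairing_shift (h : IsDressed B S T) {j : Fin 2 → ℤ} {m : ℕ}
    {q r : Fin m → ℤ → PS} (hq : ∀ i, IsEigen B (q i))
    (hqr : ∀ n n', (S 0 * Op.shift 0 PS (j 0) * (T 0 * half 0 PS)) n n' +
      (S 1 * Op.shift 1 PS (j 1) * (T 1 * half 1 PS)) n n' = ∑ i, q i n * r i n') (n n' : ℤ) :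
    pairing 0 (fun i => atT ((S 0 * Op.shift 0 PS (j 0)) n i))
        (fun i => atT' ((T 0 * half 0 PS) (-i) n')) (dT 0) +
      pairing 1 (fun i => atT ((S 1 * Op.shift 1 PS (j 1)) n i))
        (fun i => atT' ((T 1 * half 1 PS) (-i) n')) (dT 1) =
      ∑ i, atT (q i n) * atT' (r i n') := by
  refine h.pairing_eq (Or.inl rfl) (φ := atTHom) pderiv_inl_atT diag_atT (j := j)
    (d := fun a i => atT' ((T a * half a PS) (-i) n')) (x := dT)
    (G := fun n => ∑ i, atT (q i n) * atT' (r i n'))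
    (fun a => bdd_atT' (bdd_col _ _)) wtd_dT diag_dT (fun s a i => pderiv_inl_atT' _ _)
    (fun s a p => by rw [pderiv_inl_dT]) (fun s n => ?_) (fun n => ?_) n
  · have h1 (i : Fin m) : pderiv ℂ (Sum.inl s) (atT (q i n) * atT' (r i n')) =
        ∑ k ∈ ((B s).finite_row n).toFinset,
          atTHom ((B s).val n k) * (atT (q i k) * atT' (r i n')) := by
      rw [Derivation.leibniz, pderiv_inl_atT', pderiv_inl_atT, hq i s n, smul_zero, zero_add,
        smul_eq_mul]
      change _ * atTHom _ = ∑ k ∈ _, atTHom _ * (atTHom _ * _)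
      rw [map_sum, Finset.mul_sum]
      refine Finset.sum_congr rfl fun k _ => ?_
      rw [map_mul]
      ring
    simp only [map_sum, h1, Finset.mul_sum]
    exact Finset.sum_comm
  · simp only [diag_atT', neg_neg, map_sum, map_mul, diag_atT]
    exact hqr n n'

/-- The spectral representation of an eigenfunction. -/
theorem IsDressed.pairing_q (h : IsDressed B S T) {q : ℤ → PS} (hq : IsEigen B q) (n n' : ℤ) :
    pairing 0 (fun i => atT ((T 0 * (half 0 PS * Op.diagonal 0 q - Op.diagonal 0 q * half 0 PS))
        (-i) n)) (fun i => atT' (S 0 n' i)) (-dT 0) +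
      pairing 1 (fun i => atT ((T 1 * (half 1 PS * Op.diagonal 1 q - Op.diagonal 1 q * half 1 PS))
        (-i) n)) (fun i => atT' (S 1 n' i)) (-dT 1) = atT (q n) - atT' (q n') := by
  have := h.pairing_eq (Or.inr rfl) (φ := atTHom') pderiv_inr_atT' diag_atT' (j := 0)
    (d := fun a i => atT ((T a * (half a PS * Op.diagonal a q - Op.diagonal a q * half a PS))
        (-i) n)) (x := fun a => -dT a) (G := fun n' => atT (q n) - atT' (q n'))
    (fun a => bdd_atT (bdd_col _ _)) wtd_neg_dT diag_neg_dT (fun s a i => pderiv_inr_atT _ _)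
    (fun s a p => by rw [pderiv_inr_neg_dT]) (fun s n' => ?_) (fun n' => ?_) n'
  · simp only [Pi.zero_apply, Op.shift_zero, mul_one] at this
    rw [pairing_comm 0, pairing_comm 1]
    exact this
  -- The summand `q n` at time `t` is constant in `t'`; it is compatible with the flow because the
  -- bands annihilate constants.
  · have h1 := congrArg atTHom' ((B s).sum_row n')
    rw [map_sum, map_zero] at h1
    rw [map_sub, pderiv_inr_atT, pderiv_inr_atT', hq s n', zero_sub]
    simp only [mul_sub]
    rw [Finset.sum_sub_distrib, ← Finset.sum_mul, h1, zero_mul, zero_sub]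
    change -atTHom' _ = -∑ k ∈ _, atTHom' _ * atTHom' _
    simp only [map_sum, map_mul]
  · simp only [Pi.zero_apply, Op.shift_zero, mul_one, diag_atT', diag_atT, neg_neg, map_sub]
    have h1 (a : Fin 2) : (∑ᶠ i, S a n' i *
        (T a * (half a PS * Op.diagonal a q - Op.diagonal a q * half a PS)) i n) =
        half a PS n' n * (q n - q n') := by
      rw [← Op.mul_apply, ← mul_assoc, h.mul_inv, one_mul, Op.sub_apply, Op.mul_diagonal_apply,
        Op.diagonal_mul_apply]
      ring
    rw [h1, h1, ← add_mul, half_add_half, one_mul]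

/-- The spectral representation of an adjoint eigenfunction. -/
theorem IsDressed.pairing_r (h : IsDressed B S T) {r : ℤ → PS} (hr : IsAdjEigen B r) (n n' : ℤ) :
    pairing 0 (fun i => atT
        (((Op.diagonal 0 r - half 0 PS * Op.diagonal 0 r * halfInv 0 PS) * S 0) n i))
        (fun i => atT' ((T 0 * half 0 PS) (-i) n')) (dT 0) +
      pairing 1 (fun i => atT
        (((Op.diagonal 1 r - half 1 PS * Op.diagonal 1 r * halfInv 1 PS) * S 1) n i))
        (fun i => atT' ((T 1 * half 1 PS) (-i) n')) (dT 1) = atT (r n) - atT' (r n') := by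
  have h1 (a : Fin 2) : pairing a (fun i => atT
        (((Op.diagonal a r - half a PS * Op.diagonal a r * halfInv a PS) * S a) n i))
        (fun i => atT' ((T a * half a PS) (-i) n')) (dT a) =
      atT (r n) * pairing a (fun i => atT (S a n i))
        (fun i => atT' ((T a * half a PS) (-i) n')) (dT a) -
      pairing a (fun i => atT ((half a PS * Op.diagonal a r * halfInv a PS * S a) n i))
        (fun i => atT' ((T a * half a PS) (-i) n')) (dT a) := by
    have hd : Bdd a fun i => atT' ((T a * half a PS) (-i) n') := bdd_atT' (bdd_col _ _)
    rw [eq_sub_iff_add_eq, ← pairing_add_left (bdd_atT (bdd_row _ _)) (bdd_atT (bdd_row _ _)) hd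
      (wtd_dT a), ← pairing_mul_left _ (bdd_atT (bdd_row _ _)) hd (wtd_dT a)]
    congr 1
    ext1 i
    change atTHom _ + atTHom _ = atTHom _ * atTHom _
    rw [← map_add, ← map_mul, ← Op.add_apply, ← add_mul, sub_add_cancel, Op.diagonal_mul_apply]
  rw [h1, h1, sub_add_sub_comm, ← mul_add, h.pairing_one, h.pairing_adjEigen hr, mul_one]

end GBMT

namespace GBMT

/-! ### Truncations -/

section Trunc

variable {R : Type*} [CommRing R] {a : Fin 2}

/-- The part of a matrix with positive powers of `Δ` for `a = 0` and of `Δ^*` for `a = 1`. -/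
def Op.trunc (A : Op a R) : Band R where
  val n k := if 1 ≤ sg a * (k - n) then A n k else
    if k = n then -∑ᶠ j, (if 1 ≤ sg a * (j - n) then A n j else 0) else 0
  exists_ordLE := by
    obtain ⟨b, hb⟩ := A.exists_ordLE
    refine ⟨|b|, fun a' n k h => ?_⟩
    have h0 := le_abs_self b
    have h1 := abs_nonneg b
    have h2 : k ≠ n := by
      rintro rfl
      rw [sub_self, mul_zero] at h
      omega
    dsimp only
    rw [if_neg h2]
    split_ifs with h3
    · refine hb n k ?_
      rcases sg_cases a with h | h <;> rcases sg_cases a' with h' | h' <;> simp only [h, h'] at * <;>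
        omega
    · rfl
  rowSum n := by
    obtain ⟨b, hb⟩ := A.exists_ordLE
    have hfin : (Function.support fun j => if 1 ≤ sg a * (j - n) then A n j else 0).Finite := by
      refine (Finset.finite_toSet (seg a (sg a * n + 1) (sg a * n + b))).subset fun j hj => ?_
      rw [Finset.mem_coe, mem_seg]
      have h1 : 1 ≤ sg a * (j - n) := by
        by_contra h
        exact hj (if_neg h)
      have h2 : ¬ b < sg a * (j - n) := by
        intro h
        exact hj (by simp only [hb n j h, ite_self])
      rw [mul_sub] at h1 h2
      omega
    have hfin' : (Function.support fun k => if k = n then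
        -∑ᶠ j, (if 1 ≤ sg a * (j - n) then A n j else 0) else 0).Finite :=
      (Set.finite_singleton n).subset fun k hk => by
        by_contra h
        exact hk (if_neg h)
    have h1 (k : ℤ) : (if 1 ≤ sg a * (k - n) then A n k else
        if k = n then -∑ᶠ j, (if 1 ≤ sg a * (j - n) then A n j else 0) else 0) =
        (if 1 ≤ sg a * (k - n) then A n k else 0) +
        if k = n then -∑ᶠ j, (if 1 ≤ sg a * (j - n) then A n j else 0) else 0 := by
      by_cases hk : k = n
      · subst hk; simp
      · simp [hk]
    simp only [h1]
    rw [finsum_add_distrib hfin hfin', finsum_eq_single (fun k => if k = n then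
      -∑ᶠ j, (if 1 ≤ sg a * (j - n) then A n j else 0) else 0) n fun k hk => if_neg hk, if_pos rfl,
      add_neg_cancel]

theorem Op.trunc_val (A : Op a R) (n k : ℤ) : A.trunc.val n k =
    if 1 ≤ sg a * (k - n) then A n k else
      if k = n then -∑ᶠ j, (if 1 ≤ sg a * (j - n) then A n j else 0) else 0 := rfl

theorem ordLE_trunc_sub (A : Op a R) : OrdLE a 0 (A.trunc.op a - A : Op a R) := by
  intro n k h
  rw [Op.sub_apply, Band.op_apply, Op.trunc_val, if_pos (by omega), sub_self]

theorem ordLE_trunc_of_ne (A : Op a R) {a' : Fin 2} (h : a ≠ a') : OrdLE a' 0 A.trunc.val := by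
  intro n k hk
  have h2 : k ≠ n := by
    rintro rfl
    simp at hk
  have h3 : sg a = -sg a' := by
    revert h
    fin_cases a <;> fin_cases a' <;> decide
  rw [Op.trunc_val, h3, neg_mul, if_neg (by omega), if_neg h2]

end Trunc

/-! ### Existence of wave operators -/

section Existence

open MvPowerSeries

/-- The operators `B_s` of a pair of Lax operators. -/
def laxBand (L : ∀ a, Op a PS) (s : Time) : Band PS := (L s.1 ^ (s.2 : ℕ)).trunc

/-- The Lax equations, in terms of matrices. -/
structure IsLaxPair (L : ∀ a, Op a PS) : Prop where
  ord : ∀ a, OrdLE a 1 (L a)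
  ne_zero : ∀ a n, L a n (n + sg a) ≠ 0
  lax : ∀ a s, opDt s (L a) = (laxBand L s).op a * L a - L a * (laxBand L s).op a

variable {L : ∀ a, Op a PS}

/-- The power of the Lax operator that belongs to a time, if it is of the given type. -/
def laxPow (L : ∀ a, Op a PS) (a : Fin 2) (s : Time) : Op a PS :=
  if s.1 = a then L a ^ (s.2 : ℕ) else 0

/-- The connection `B_s - L^p`. -/
def laxConn (L : ∀ a, Op a PS) (a : Fin 2) (s : Time) : Op a PS :=
  (laxBand L s).op a - laxPow L a s

/-- For a time of type `a` the subtraction of `L^p` removes everything beyond the diagonal; for the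
other type `B_s` has nothing there. -/
theorem ordLE_laxConn (L : ∀ a, Op a PS) (a : Fin 2) (s : Time) : OrdLE a 0 (laxConn L a s) := by
  unfold laxConn laxPow laxBand
  by_cases h : s.1 = a
  · subst h
    rw [if_pos rfl]
    exact ordLE_trunc_sub _
  · rw [if_neg h, sub_zero]
    exact ordLE_trunc_of_ne _ h

theorem commute_laxPow (L : ∀ a, Op a PS) (a : Fin 2) (s : Time) : Commute (laxPow L a s) (L a) := by
  unfold laxPow
  split_ifs
  · exact (Commute.refl _).pow_left _
  · exact Commute.zero_left _

theorem commute_laxPow_laxPow (L : ∀ a, Op a PS) (a : Fin 2) (s r : Time) :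
    Commute (laxPow L a s) (laxPow L a r) := by
  conv => arg 2; unfold laxPow
  split_ifs
  · exact (commute_laxPow L a s).pow_right _
  · exact Commute.zero_right _

theorem IsLaxPair.der_laxPow (h : IsLaxPair L) (a : Fin 2) (s r : Time) : opDt r (laxPow L a s) =
    (laxBand L r).op a * laxPow L a s - laxPow L a s * (laxBand L r).op a := by
  unfold laxPow
  split_ifs
  · exact Op.der_pow_of_comm _ (h.lax a r) _
  · simp

/-- Since `L^p` commutes with `L`, the Lax equation holds with `B_s - L^p`, of order at most `0`.
Its top diagonal is a scalar linear equation for the leading coefficient, so `isUnit_of_dt_eq_mul`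
applies. -/
theorem IsLaxPair.lead (h : IsLaxPair L) (a : Fin 2) : Lead 1 (L a) := by
  refine ⟨h.ord a, fun n => ?_⟩
  rw [mul_one]
  refine isUnit_of_dt_eq_mul
    (c := fun s => laxConn L a s n n - laxConn L a s (n + sg a) (n + sg a)) (fun s => ?_)
    (h.ne_zero a n)
  have h1 : opDt s (L a) = laxConn L a s * L a - L a * laxConn L a s := by
    rw [h.lax, laxConn, sub_mul, mul_sub, (commute_laxPow L a s).eq]
    abel
  have h2 := congrArg (fun A : Op a PS => A n (n + sg a)) h1
  have h3 := (ordLE_laxConn L a s).mul_apply (h.ord a) n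
  have h4 := (h.ord a).mul_apply (ordLE_laxConn L a s) n
  simp only [zero_add, mul_one, mul_zero, add_zero] at h3 h4
  simp only [Op.sub_apply, h3, h4] at h2
  refine h2.trans ?_
  ring

/-- The curvature of the operators `B_s`. -/
def curv (B : Time → Band PS) (s r : Time) (a : Fin 2) : Op a PS :=
  opDt r ((B s).op a) - opDt s ((B r).op a) + ((B s).op a * (B r).op a - (B r).op a * (B s).op a)

/-- The curvature annihilates constants, because the bands, their derivatives and their products do.
-/
theorem curv_mul_half_add (B : Time → Band PS) (s r : Time) (n k : ℤ) :
    (curv B s r 0 * half 0 PS) n k + (curv B s r 1 * half 1 PS) n k = 0 := by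
  have hd (r : Time) (a : Fin 2) : opDt r (half a PS) = 0 := by
    refine Op.ext fun n k => ?_
    change dt r (if a = 0 then (if k ≤ n then 1 else 0) else if n < k then 1 else 0) = 0
    unfold dt
    split_ifs <;> simp
  have h1 (s r : Time) : (opDt r ((B s).op 0) * half 0 PS) n k +
      (opDt r ((B s).op 1) * half 1 PS) n k = 0 := by
    have e (a : Fin 2) : opDt r ((B s).op a) * half a PS = opDt r ((B s).op a * half a PS) := by
      rw [Op.der_mul, hd, mul_zero, add_zero]
    rw [e, e, Op.der_apply, Op.der_apply, ← map_add, (B s).op_mul_half_add, map_zero]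
  have h2 (s r : Time) : ((B s).op 0 * (B r).op 0 * half 0 PS) n k +
      ((B s).op 1 * (B r).op 1 * half 1 PS) n k = 0 := by
    rw [mul_assoc, mul_assoc, Band.op_mul_apply, Band.op_mul_apply, ← Finset.sum_add_distrib]
    exact Finset.sum_eq_zero fun j _ => by rw [← mul_add, (B r).op_mul_half_add, mul_zero]
  simp only [curv, add_mul, sub_mul, Op.add_apply, Op.sub_apply]
  linear_combination h1 s r - h1 r s + h2 s r - h2 r s

/-- Subtracting the powers of `L` does not change the curvature: they commute with each other and
obey the Lax equations. The new form has order at most `0`. -/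
theorem IsLaxPair.curv_eq (h : IsLaxPair L) (s r : Time) (a : Fin 2) : curv (laxBand L) s r a =
    opDt r (laxConn L a s) - opDt s (laxConn L a r) +
      (laxConn L a s * laxConn L a r - laxConn L a r * laxConn L a s) := by
  simp only [laxConn, map_sub, h.der_laxPow, mul_sub, sub_mul,
    (commute_laxPow_laxPow L a s r).eq, curv]
  abel

/-- Both types have the same entries and both have order at most `0`, so the curvature is diagonal;
a diagonal matrix that annihilates constants is zero. -/
theorem IsLaxPair.curv_eq_zero (h : IsLaxPair L) (s r : Time) (a : Fin 2) :
    curv (laxBand L) s r a = 0 := by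
  have hord (a : Fin 2) : OrdLE a 0 (curv (laxBand L) s r a) := by
    rw [h.curv_eq]
    have h1 := ordLE_laxConn L a
    refine (OrdLE.sub ((h1 s).der _) ((h1 r).der _)).add (OrdLE.sub ?_ ?_)
    · simpa using (h1 s).mul (h1 r)
    · simpa using (h1 r).mul (h1 s)
  have hval : (curv (laxBand L) s r 0).val = (curv (laxBand L) s r 1).val := rfl
  have hoff (n k : ℤ) (hk : k ≠ n) : (curv (laxBand L) s r 0) n k = 0 := by
    rcases lt_or_gt_of_ne hk with h' | h'
    · rw [hval]
      refine hord 1 n k ?_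
      rw [show sg 1 = -1 from rfl]
      omega
    · refine hord 0 n k ?_
      rw [show sg 0 = 1 from rfl]
      omega
  have hdiag (n : ℤ) : (curv (laxBand L) s r 0) n n = 0 := by
    have h1 := curv_mul_half_add (laxBand L) s r n n
    rw [Op.mul_apply, Op.mul_apply, finsum_eq_single _ n, finsum_eq_single _ n, ← hval, ← mul_add,
      half_add_half, mul_one] at h1
    · exact h1
    · intro k hk
      rw [← hval, hoff n k hk, zero_mul]
    · intro k hk
      rw [hoff n k hk, zero_mul]
  have h0 : curv (laxBand L) s r 0 = 0 := Op.ext fun n k => by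
    by_cases hk : k = n
    · rw [hk, hdiag]; rfl
    · exact hoff n k hk
  fin_cases a
  · exact h0
  · refine Op.val_injective ?_
    exact hval.symm.trans (congrArg Op.val h0)

variable {a : Fin 2}

/-- A matrix with a single column, which is bounded on one side. -/
def colOp (a : Fin 2) (x : ℕ → PS) : Op a PS :=
  Op.ofOrdLE (b := 0) (fun n k => if k = 0 ∧ 0 ≤ sg a * n then x (sg a * n).toNat else 0) fun n k h =>
    if_neg (by
      rintro ⟨rfl, h'⟩
      simp only [zero_sub, mul_neg] at h
      omega)

theorem colOp_apply (x : ℕ → PS) (n k : ℤ) :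
    colOp a x n k = if k = 0 ∧ 0 ≤ sg a * n then x (sg a * n).toNat else 0 := rfl

theorem ordLE_colOp (x : ℕ → PS) : OrdLE a 0 (colOp a x) := fun n k h =>
  if_neg (by
      rintro ⟨rfl, h'⟩
      simp only [zero_sub, mul_neg] at h
      omega)

theorem colOp_apply_natCast (x : ℕ → PS) (m : ℕ) : colOp a x (sg a * m) 0 = x m := by
  rw [colOp_apply, sg_mul_sg_mul, if_pos ⟨rfl, Int.natCast_nonneg m⟩, Int.toNat_natCast]

theorem colOp_injective : Function.Injective (colOp a) := fun x y h => by
  ext1 m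
  rw [← colOp_apply_natCast (a := a) x, h, colOp_apply_natCast]

theorem mul_colOp {A : Op a PS} (hA : OrdLE a 0 A) (x : ℕ → PS) :
    A * colOp a x = colOp a fun m =>
      ∑ j ∈ Finset.range (m + 1), A (sg a * m) (sg a * j) * x j := by
  refine Op.ext fun n k => ?_
  rw [colOp_apply]
  by_cases hk : k = 0
  · subst hk
    by_cases hn : 0 ≤ sg a * n
    · rw [if_pos ⟨rfl, hn⟩, Op.coe_mul, mmul_eq_sum hA (ordLE_colOp x) subset_rfl]
      symm
      have hn' : sg a * ((sg a * n).toNat : ℤ) = n := by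
        rw [Int.toNat_of_nonneg hn, sg_mul_sg_mul]
      refine Finset.sum_bij (fun j _ => sg a * (j : ℤ)) (fun j hj => ?_) (fun i _ j _ hij => ?_)
        (fun i hi => ?_) (fun j _ => ?_)
      · rw [Finset.mem_range] at hj
        rw [mem_seg, sg_mul_sg_mul]
        omega
      · have := congrArg (sg a * ·) hij
        simpa only [sg_mul_sg_mul, Nat.cast_inj] using this
      · rw [mem_seg] at hi
        refine ⟨(sg a * i).toNat, ?_, ?_⟩
        · rw [Finset.mem_range]
          omega
        · rw [Int.toNat_of_nonneg (by omega), sg_mul_sg_mul]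
      · rw [hn', colOp_apply_natCast]
    · rw [if_neg fun h => hn h.2]
      refine (hA.mul (ordLE_colOp x)) n 0 ?_
      rw [zero_sub, mul_neg]
      omega
  · rw [if_neg fun h => hk h.1, Op.mul_apply]
    exact finsum_eq_zero_of_forall_eq_zero fun j => by
      rw [colOp_apply, if_neg fun h => hk h.1, mul_zero]

/-- Compatible linear differential equations for a column of a matrix can be solved. -/
theorem exists_column {A : Time → Op a PS} (hA : ∀ s, OrdLE a 0 (A s))
    (hflat : ∀ s r, opDt r (A s) - opDt s (A r) + (A s * A r - A r * A s) = 0) :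
    ∃ x : Op a PS, OrdLE a 0 x ∧ (∀ s, opDt s x = A s * x) ∧ IsUnit (x 0 0) := by
  set D : Time → ℕ → Finset ℕ := fun _ m => Finset.range (m + 1)
  set A' : Time → ℕ → ℕ → PS := fun s m j => A s (sg a * m) (sg a * j)
  have hder (s : Time) (x : ℕ → PS) : opDt s (colOp a x) = colOp a fun m => dt s (x m) := by
    refine Op.ext fun n k => ?_
    rw [Op.der_apply, colOp_apply, colOp_apply]
    split_ifs
    · rfl
    · exact map_zero _
  have hcov (s : Time) (x : ℕ → PS) :
      colOp a (cov D A' s x) = opDt s (colOp a x) - A s * colOp a x := by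
    rw [hder, mul_colOp (hA s)]
    refine Op.ext fun n k => ?_
    rw [Op.sub_apply, colOp_apply, colOp_apply, colOp_apply]
    split_ifs
    · rfl
    · rw [sub_zero]
  have hcomm (s r : Time) (C : Op a PS) : opDt s (opDt r C) = opDt r (opDt s C) :=
    Op.ext fun n k => pderiv_comm s r (C n k)
  -- Flatness of the connection is the commutation of the covariant derivatives, transported to
  -- columns through `colOp`.
  have hA' (s r : Time) (x : ℕ → PS) :
      cov D A' s (cov D A' r x) = cov D A' r (cov D A' s x) := by
    refine colOp_injective (a := a) ?_
    have h1 := congrArg (· * colOp a x) (hflat s r)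
    simp only [add_mul, sub_mul, zero_mul] at h1
    simp only [hcov, map_sub, Op.der_mul, mul_sub, hcomm s r, ← mul_assoc]
    rw [← sub_eq_zero, ← h1]
    abel
  -- Only the entry at `(0, 0)` has to be a unit; the other initial values are arbitrary.
  obtain ⟨x, hx, hx0⟩ := exists_solution D A' hA' fun _ => 1
  refine ⟨colOp a x, ordLE_colOp x, fun s => ?_, ?_⟩
  · rw [hder, mul_colOp (hA s)]
    congr 1
    ext1 m
    exact hx s m
  · have h0 : colOp a x 0 0 = x 0 := by simp [colOp_apply]
    rw [h0]
    refine isUnit_of_constantCoeff ?_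
    rw [hx0]
    simp

/-- Powers of an invertible matrix with a known order. -/
theorem lead_zpow {R : Type*} [CommRing R] {u : (Op a R)ˣ} (hu : Lead 1 u.val) (z : ℤ) :
    Lead z (u ^ z : (Op a R)ˣ).val := by
  have hinv : Lead (-1) (u⁻¹ : (Op a R)ˣ).val := by
    obtain ⟨B, hB, h1, h2⟩ := hu.exists_inv
    have : (u⁻¹ : (Op a R)ˣ).val = B := by
      rw [← mul_one (u⁻¹ : (Op a R)ˣ).val, ← h1, Units.inv_mul_cancel_left]
    rw [this]
    exact (lead_of_mul_eq_one hu.ord hB h1 h2).2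
  induction z using Int.induction_on with
  | zero => simpa using lead_one
  | succ i ih =>
    rw [zpow_add_one, Units.val_mul]
    exact ih.mul hu
  | pred i ih =>
    rw [zpow_sub_one, Units.val_mul]
    exact ih.mul hinv

theorem der_zpow {R : Type*} [CommRing R] [Algebra ℂ R] (δ : Derivation ℂ R R) {u : (Op a R)ˣ}
    {B : Op a R} (h : Op.der δ u.val = B * u.val - u.val * B) (z : ℤ) :
    Op.der δ (u ^ z : (Op a R)ˣ).val =
      B * (u ^ z : (Op a R)ˣ).val - (u ^ z : (Op a R)ˣ).val * B := by
  have hinv : Op.der δ (u⁻¹ : (Op a R)ˣ).val =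
      B * (u⁻¹ : (Op a R)ˣ).val - (u⁻¹ : (Op a R)ˣ).val * B := by
    rw [Op.der_inv δ u.mul_inv u.inv_mul, h, mul_sub, sub_mul, ← mul_assoc, ← mul_assoc, u.inv_mul,
      one_mul, mul_assoc _ u.val, u.mul_inv, mul_one, neg_sub]
  induction z using Int.induction_on with
  | zero => simp
  | succ i ih =>
    rw [zpow_add_one, Units.val_mul, Op.der_mul, ih, h]
    noncomm_ring
  | pred i ih =>
    rw [zpow_sub_one, Units.val_mul, Op.der_mul, ih, hinv]
    noncomm_ring

/-- One horizontal column `x` suffices. By the Lax equation all `L^z x` with `z : ℤ` are horizontal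
too; with `L^(-(sg a * k)) x` as its column `k`, the matrix `S` satisfies `L * S = S * Λ^{±1}` by
construction. Its top diagonal consists of products of leading coefficients of powers of `L` with `x
0 0`. -/
theorem IsLaxPair.exists_dressing (h : IsLaxPair L) (a : Fin 2) :
    ∃ S T : Op a PS, OrdLE a 0 S ∧ OrdLE a 0 T ∧ S * T = 1 ∧ T * S = 1 ∧
      (∀ s, opDt s S = (laxBand L s).op a * S -
        if s.1 = a then S * Op.shift a PS (sg a * s.2) else 0) ∧
      L a = S * Op.shift a PS (sg a) * T := by
  obtain ⟨x, hx, hdx, hx0⟩ := exists_column (ordLE_laxConn L a)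
    fun s r => (h.curv_eq s r a).symm.trans (h.curv_eq_zero s r a)
  obtain ⟨K, -, hK1, hK2⟩ := (h.lead a).exists_inv
  set u : (Op a PS)ˣ := ⟨L a, K, hK1, hK2⟩
  have hu : Lead 1 u.val := h.lead a
  have hord (z : ℤ) : OrdLE a z ((u ^ z : (Op a PS)ˣ).val * x) := by
    simpa using (lead_zpow hu z).ord.mul hx
  have hSord : OrdLE a 0 fun n k => ((u ^ (-(sg a * k)) : (Op a PS)ˣ).val * x) n 0 := by
    intro n k hnk
    refine hord _ n 0 ?_
    rw [mul_sub] at hnk ⊢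
    rw [mul_zero]
    omega
  obtain ⟨S, hSdef⟩ : ∃ S : Op a PS,
      S.val = fun n k => ((u ^ (-(sg a * k)) : (Op a PS)ˣ).val * x) n 0 := ⟨⟨_, 0, hSord⟩, rfl⟩
  have hS (n k : ℤ) : S n k = ((u ^ (-(sg a * k)) : (Op a PS)ˣ).val * x) n 0 := by
    rw [hSdef]
  have hCS (C : Op a PS) (n k : ℤ) :
      (C * S) n k = (C * ((u ^ (-(sg a * k)) : (Op a PS)ˣ).val * x)) n 0 := by
    rw [Op.mul_apply, Op.mul_apply]
    simp only [hS]
  have hlead : Lead 0 S := by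
    refine ⟨hSdef ▸ hSord, fun n => ?_⟩
    have h1 := (lead_zpow hu (-(sg a * n))).ord.mul_apply hx n
    have e : n + sg a * -(sg a * n) = 0 := by rw [mul_neg, sg_mul_sg_mul, add_neg_cancel]
    rw [mul_zero, add_zero, hS]
    rw [add_zero, e] at h1
    rw [h1]
    have h2 := (lead_zpow hu (-(sg a * n))).unit n
    rw [e] at h2
    exact h2.mul hx0
  have hpow (p : ℕ) : L a ^ p * S = S * Op.shift a PS (sg a * p) := by
    refine Op.ext fun n k => ?_
    have e : L a ^ p = (u ^ (p : ℤ) : (Op a PS)ˣ).val := by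
      rw [zpow_natCast, Units.val_pow_eq_pow_val]
    rw [hCS, Op.mul_shift_apply, hS, ← mul_assoc, e, ← Units.val_mul, ← zpow_add, mul_sub,
      sg_mul_sg_mul, neg_sub, sub_eq_add_neg]
  obtain ⟨T, hT, hST, hTS⟩ := hlead.exists_inv
  refine ⟨S, T, hlead.ord, by simpa using hT, hST, hTS, fun s => ?_, ?_⟩
  · have h1 : opDt s S = laxConn L a s * S := by
      refine Op.ext fun n k => ?_
      rw [hCS]
      have h2 : opDt s ((u ^ (-(sg a * k)) : (Op a PS)ˣ).val * x) =
          laxConn L a s * ((u ^ (-(sg a * k)) : (Op a PS)ˣ).val * x) := by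
        have h3 : Commute (laxPow L a s) (u ^ (-(sg a * k)) : (Op a PS)ˣ).val :=
          Commute.units_zpow_right (commute_laxPow L a s) _
        rw [Op.der_mul, der_zpow _ (h.lax a s), hdx, laxConn, sub_mul, sub_mul, sub_mul, mul_sub,
          ← mul_assoc (laxPow L a s), h3.eq]
        simp only [mul_assoc]
        abel
      rw [Op.der_apply, hS, ← Op.der_apply, h2]
    rw [h1, laxConn, sub_mul, laxPow]
    split_ifs
    · rw [hpow]
    · rw [zero_mul]
  · have h1 := hpow 1
    rw [pow_one, Nat.cast_one, mul_one] at h1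
    rw [← h1, mul_assoc, hST, mul_one]

end Existence

end GBMT

namespace GBMT

/-! ### Matrices of shift operators -/

section Mat

open MvPowerSeries

/-- The matrix of an operator. -/
def mat (A : ShiftOp) : ℤ → ℤ → PS := fun n k => A (k - n) n

theorem mat_apply_add (A : ShiftOp) (n j : ℤ) : mat A n (n + j) = A j n := by
  simp only [mat, add_sub_cancel_left]

theorem mat_injective : Function.Injective mat := fun A B h => by
  ext1 j
  ext1 n
  rw [← mat_apply_add A n j, h, mat_apply_add]

/-- The operator with a given matrix. -/
def unmat (A : ℤ → ℤ → PS) : ShiftOp := fun j n => A n (n + j)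

theorem mat_unmat (A : ℤ → ℤ → PS) : mat (unmat A) = A := by
  ext1 n
  ext1 k
  simp only [mat, unmat, add_sub_cancel]

theorem mat_comp (A B : ShiftOp) : mat (comp A B) = mmul (mat A) (mat B) := by
  ext1 n
  ext1 l
  rw [mmul, ← finsum_comp_equiv (Equiv.addLeft n)]
  refine finsum_congr fun i => ?_
  rw [Equiv.coe_addLeft, mat_apply_add, mat]
  congr 2
  ring

theorem mat_add (A B : ShiftOp) : mat (A + B) = mat A + mat B := rfl

theorem mat_sub (A B : ShiftOp) : mat (A - B) = mat A - mat B := rfl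

theorem mat_shift (a : Fin 2) (j : ℤ) : mat (shift j) = (Op.shift a PS j).val := by
  ext1 n
  ext1 k
  rw [Op.shift_apply, mat, shift]
  simp only [sub_eq_iff_eq_add, add_comm]

theorem mat_adj (A : ShiftOp) (n k : ℤ) : mat (adj A) n k = mat A k n := by
  simp only [mat, adj, neg_sub, add_sub_cancel]

theorem mat_dtOp (s : Time) (A : ShiftOp) (n k : ℤ) : mat (dtOp s A) n k = dt s (mat A n k) := rfl

theorem mat_iotaDown (n k : ℤ) : mat iotaDown n k = if k < n then 1 else 0 := by
  simp only [mat, iotaDown]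
  refine if_congr ?_ rfl rfl
  omega

theorem mat_iotaUp (n k : ℤ) : mat iotaUp n k = if n ≤ k then -1 else 0 := by
  simp only [mat, iotaUp]
  refine if_congr ?_ rfl rfl
  omega

theorem act_eq (A : ShiftOp) (f : ℤ → PS) (n : ℤ) : act A f n = ∑ᶠ k, mat A n k * f k := by
  rw [← finsum_comp_equiv (Equiv.addLeft n)]
  refine finsum_congr fun j => ?_
  rw [Equiv.coe_addLeft, mat_apply_add]

theorem mat_opPow {a : Fin 2} {A : ShiftOp} {X : Op a PS} (h : X.val = mat A) (p : ℕ) :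
    mat (opPow A p) = (X ^ p).val := by
  induction p with
  | zero =>
    rw [pow_zero, ← Op.shift_zero, ← mat_shift]
    rfl
  | succ p ih =>
    rw [pow_succ, Op.coe_mul, ← ih, h, ← mat_comp]
    rfl

theorem mat_truncDelta {A : ShiftOp} {X : Op 0 PS} (h : X.val = mat A) :
    mat (truncDelta A) = X.trunc.val := by
  ext1 n
  ext1 k
  rw [Op.trunc_val, show sg 0 = 1 from rfl, h]
  simp only [one_mul, mat, truncDelta, sub_eq_zero]
  conv_rhs => rw [← finsum_comp_equiv (Equiv.addLeft n)]
  simp only [Equiv.coe_addLeft, add_sub_cancel_left, finsum_eq_if]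

theorem mat_truncDeltaStar {A : ShiftOp} {X : Op 1 PS} (h : X.val = mat A) :
    mat (truncDeltaStar A) = X.trunc.val := by
  ext1 n
  ext1 k
  have e (j : ℤ) : 1 ≤ -1 * j ↔ j ≤ -1 := by omega
  rw [Op.trunc_val, show sg 1 = -1 from rfl, h]
  simp only [e, mat, truncDeltaStar, sub_eq_zero]
  conv_rhs => rw [← finsum_comp_equiv (Equiv.addLeft n)]
  simp only [Equiv.coe_addLeft, add_sub_cancel_left, finsum_eq_if]

variable {L1 L2 : ShiftOp} {L : ∀ a, Op a PS}

theorem mat_Bop (h0 : (L 0).val = mat L1) (h1 : (L 1).val = mat L2) (s : Time) :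
    mat (Bop L1 L2 s) = (laxBand L s).val := by
  obtain ⟨a, p⟩ := s
  fin_cases a
  · exact mat_truncDelta (mat_opPow h0 p).symm
  · exact mat_truncDeltaStar (mat_opPow h1 p).symm

theorem act_eq_sum {A : ShiftOp} {B : Band PS} (h : mat A = B.val) (f : ℤ → PS) (n : ℤ) :
    act A f n = ∑ k ∈ (B.finite_row n).toFinset, B.val n k * f k := by
  rw [act_eq, h]
  refine finsum_eq_sum_of_support_subset _ fun k hk => ?_
  rw [Set.Finite.coe_toFinset]
  exact fun h => hk (by simp [h])

theorem mmul_mat_Delta (A : ℤ → ℤ → PS) (n k : ℤ) :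
    mmul A (mat Delta) n k = A n (k - 1) - A n k := by
  have h1 (j : ℤ) : mat Delta j k = if j = k - 1 then 1 else if j = k then -1 else 0 := by
    rw [Delta, mat_sub, Pi.sub_apply, Pi.sub_apply]
    simp only [mat, shift]
    split_ifs <;> first | omega | simp
  rw [mmul, finsum_eq_sum_of_support_subset (s := {k - 1, k}) _ fun j hj => ?_,
    Finset.sum_pair (by omega), h1, h1, if_pos rfl, if_neg (by omega), if_pos rfl]
  · ring
  · simp only [Finset.coe_insert, Finset.coe_singleton, Set.mem_insert_iff, Set.mem_singleton_iff]
    by_contra h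
    rw [not_or] at h
    exact hj (by simp only [h1]; rw [if_neg h.1, if_neg h.2, mul_zero])

/-- Transposition turns `Δ^{-1} B^* Δ` into the conjugate of the band by the half matrix of type
`1`, which by `Band.conj_eq` does not depend on the type. -/
theorem mat_adjoint_conj {A : ShiftOp} {B : Band PS} (h : mat A = B.val) (n k : ℤ) :
    mat (comp (comp iotaDown (adj A)) Delta) n k = B.conj k n := by
  have h1 (l : ℤ) : mat (comp iotaDown (adj A)) n l = (B.op 1 * half 1 PS) l n := by
    rw [mat_comp, Op.mul_apply]
    refine finsum_congr fun j => ?_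
    rw [mat_iotaDown, mat_adj, h, half_one_apply, Band.op_apply, mul_comm]
  rw [mat_comp, mmul_mat_Delta, h1, h1, ← B.conj_eq 1, mul_assoc, halfInv_mul_apply,
    show sg 1 = -1 from rfl]
  simp

theorem act_adjoint_eq_sum {A : ShiftOp} {B : Band PS} (h : mat A = B.val) (f : ℤ → PS) (n : ℤ) :
    act (comp (comp iotaDown (adj A)) Delta) f n =
      ∑ k ∈ (B.finite_col_conj n).toFinset, B.conj k n * f k := by
  rw [act_eq]
  simp only [mat_adjoint_conj h]
  refine finsum_eq_sum_of_support_subset _ fun k hk => ?_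
  rw [Set.Finite.coe_toFinset]
  intro h
  refine hk ?_
  have h' : B.conj k n = 0 := h
  simp [h']

theorem lax_iff {a : Fin 2} {A X : ShiftOp} {B : Band PS} {Y : Op a PS} (hA : mat A = B.val)
    (hX : Y.val = mat X) (s : Time) :
    dtOp s X = comm A X ↔ opDt s Y = B.op a * Y - Y * B.op a := by
  rw [← mat_injective.eq_iff, ← Op.val_injective.eq_iff, comm, mat_sub, mat_comp, mat_comp, hA,
    ← hX]
  have : mat (dtOp s X) = (opDt s Y).val := by
    ext1 n
    ext1 k
    rw [mat_dtOp, ← hX]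
    rfl
  rw [this]
  rfl

variable {M N m : ℕ} {q r : Fin m → ℤ → PS}

/-- In column `n' - 1` the expansions of `Δ^{-1}` are column `n'` of `half 0` and of `-half 1`. This
shift by one absorbs the `n + 1` in `r_{i,n+1}`, and the sign moves the second term to the left. -/
theorem constraint_iff (h0 : (L 0).val = mat L1) (h1 : (L 1).val = mat L2) :
    comp (opPow L1 M) iotaDown = comp (opPow L2 N) iotaUp + sourceOp q r ↔
      ∀ n n', (L 0 ^ M * half 0 PS) n n' + (L 1 ^ N * half 1 PS) n n' = ∑ i, q i n * r i n' := by
  have e0 (n n' : ℤ) : mat (comp (opPow L1 M) iotaDown) n (n' - 1) = (L 0 ^ M * half 0 PS) n n' := by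
    rw [mat_comp, mat_opPow h0, Op.mul_apply]
    refine finsum_congr fun j => ?_
    rw [mat_iotaDown, half_zero_apply]
    congr 1
    exact if_congr (by omega) rfl rfl
  have e1 (n n' : ℤ) : mat (comp (opPow L2 N) iotaUp) n (n' - 1) = -(L 1 ^ N * half 1 PS) n n' := by
    rw [mat_comp, mat_opPow h1, Op.mul_apply, ← finsum_neg_distrib]
    refine finsum_congr fun j => ?_
    rw [mat_iotaUp, half_one_apply]
    split_ifs <;> first | omega | simp
  have e2 (n n' : ℤ) : mat (sourceOp q r) n (n' - 1) = ∑ i, q i n * r i n' := by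
    simp only [mat, sourceOp]
    refine Finset.sum_congr rfl fun i _ => ?_
    congr 2
    ring
  rw [← mat_injective.eq_iff, mat_add]
  constructor
  · intro h n n'
    have h2 := congrFun (congrFun h n) (n' - 1)
    rw [Pi.add_apply, Pi.add_apply, e0, e1, e2] at h2
    rw [h2]
    ring
  · intro h
    ext1 n
    ext1 k
    obtain ⟨n', rfl⟩ : ∃ n', k = n' - 1 := ⟨k + 1, by ring⟩
    rw [Pi.add_apply, Pi.add_apply, e0, e1, e2, ← h]
    ring

theorem isLaxSolution_iff (h0 : (L 0).val = mat L1) (h1 : (L 1).val = mat L2) :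
    IsLaxSolution M N L1 L2 q r ↔ IsLaxPair L ∧ (∀ i, IsEigen (laxBand L) (q i)) ∧
      (∀ i, IsAdjEigen (laxBand L) (r i)) ∧
      ∀ n n', (L 0 ^ M * half 0 PS) n n' + (L 1 ^ N * half 1 PS) n n' = ∑ i, q i n * r i n' := by
  have hB := mat_Bop h0 h1
  have e0 : sg 0 = 1 := rfl
  have e1 : sg 1 = -1 := rfl
  constructor
  · intro h
    refine ⟨⟨?_, ?_, ?_⟩, fun i s n => ?_, fun i s n => ?_, (constraint_iff h0 h1).1 h.constraint⟩
    · intro a n k hk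
      fin_cases a
      · change (L 0).val n k = 0
        rw [h0]
        exact h.form_one _ _ (by simpa [e0] using hk)
      · change (L 1).val n k = 0
        rw [h1]
        exact h.form_two _ _ (by simp [e1] at hk; omega)
    · intro a n
      fin_cases a
      · change (L 0).val n (n + 1) ≠ 0
        rw [h0, mat_apply_add]
        exact h.lead_one n
      · change (L 1).val n (n + -1) ≠ 0
        rw [h1, mat_apply_add]
        exact h.lead_two n
    · intro a s
      fin_cases a
      · exact (lax_iff (hB s) h0 s).1 (h.lax_one s)
      · exact (lax_iff (hB s) h1 s).1 (h.lax_two s)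
    · rw [h.eigen s i n, act_eq_sum (hB s)]
    · rw [h.adjoint_eigen s i n, act_adjoint_eq_sum (hB s)]
  · rintro ⟨h, hq, hr, hc⟩
    refine ⟨fun j n hj => ?_, fun n => ?_, fun j n hj => ?_, fun n => ?_,
      (constraint_iff h0 h1).2 hc, fun s => (lax_iff (hB s) h0 s).2 (h.lax 0 s),
      fun s => (lax_iff (hB s) h1 s).2 (h.lax 1 s), fun s i n => ?_, fun s i n => ?_⟩
    · rw [← mat_apply_add L1, ← h0]
      exact h.ord 0 _ _ (by rw [e0]; omega)
    · rw [← mat_apply_add L1, ← h0]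
      exact h.ne_zero 0 n
    · rw [← mat_apply_add L2, ← h1]
      exact h.ord 1 _ _ (by rw [e1]; omega)
    · rw [← mat_apply_add L2, ← h1]
      exact h.ne_zero 1 n
    · rw [hq i s n, act_eq_sum (hB s)]
    · rw [hr i s n, act_adjoint_eq_sum (hB s)]

theorem IsLaxSolution.exists_ops (h : IsLaxSolution M N L1 L2 q r) :
    ∃ L : ∀ a, Op a PS, (L 0).val = mat L1 ∧ (L 1).val = mat L2 := by
  refine ⟨fun a => ⟨mat (if a = 0 then L1 else L2), 1, ?_⟩, rfl, rfl⟩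
  intro n k hk
  unfold sg at hk
  split_ifs at hk ⊢
  · exact h.form_one _ _ (by omega)
  · exact h.form_two _ _ (by omega)

variable {W : WaveOps} {S T : ∀ a, Op a PS}

theorem IsWaveOps.exists_ops (h : IsWaveOps L1 L2 W) : ∃ S T : ∀ a, Op a PS,
    ((S 0).val = mat W.S1 ∧ (S 1).val = mat W.S2) ∧ (T 0).val = mat W.T1 ∧ (T 1).val = mat W.T2 := by
  refine ⟨fun a => ⟨mat (if a = 0 then W.S1 else W.S2), 0, ?_⟩,
    fun a => ⟨mat (if a = 0 then W.T1 else W.T2), 0, ?_⟩, ⟨rfl, rfl⟩, rfl, rfl⟩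
  · intro n k hk
    unfold sg at hk
    split_ifs at hk ⊢
    · exact h.form_S1 _ _ (by omega)
    · exact h.form_S2 _ _ (by omega)
  · intro n k hk
    unfold sg at hk
    split_ifs at hk ⊢
    · exact h.form_T1 _ _ (by omega)
    · exact h.form_T2 _ _ (by omega)

theorem comp_eq_shift_iff {a : Fin 2} {A B : ShiftOp} {X Y : Op a PS} (hA : X.val = mat A)
    (hB : Y.val = mat B) : comp A B = shift 0 ↔ X * Y = 1 := by
  rw [← mat_injective.eq_iff, mat_comp, mat_shift a, ← hA, ← hB, ← Op.shift_zero,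
    ← Op.val_injective.eq_iff]
  rfl

theorem dress_iff {a : Fin 2} {A S' T' : ShiftOp} {X Y Z : Op a PS} {j : ℤ} (hA : X.val = mat A)
    (hS : Y.val = mat S') (hT : Z.val = mat T') :
    A = comp (comp S' (shift j)) T' ↔ X = Y * Op.shift a PS j * Z := by
  rw [← mat_injective.eq_iff, mat_comp, mat_comp, mat_shift a, ← hA, ← hS, ← hT,
    ← Op.val_injective.eq_iff]
  rfl

theorem mat_dtOp_eq {a : Fin 2} {A : ShiftOp} {X : Op a PS} (h : X.val = mat A) (s : Time) :
    mat (dtOp s A) = (opDt s X).val := by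
  ext1 n
  ext1 k
  rw [mat_dtOp, ← h]
  rfl

theorem evol_iff {a : Fin 2} {A S' : ShiftOp} {B : Band PS} {Y : Op a PS} (hA : mat A = B.val)
    (hS : Y.val = mat S') (s : Time) :
    dtOp s S' = comp A S' ↔ opDt s Y = B.op a * Y := by
  rw [← mat_injective.eq_iff, mat_comp, mat_dtOp_eq hS, hA, ← hS, ← Op.val_injective.eq_iff]
  rfl

theorem evol_sub_iff {a : Fin 2} {A S' : ShiftOp} {B : Band PS} {Y : Op a PS} {j : ℤ}
    (hA : mat A = B.val) (hS : Y.val = mat S') (s : Time) :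
    dtOp s S' = comp A S' - comp S' (shift j) ↔ opDt s Y = B.op a * Y - Y * Op.shift a PS j := by
  rw [← mat_injective.eq_iff, mat_sub, mat_comp, mat_comp, mat_dtOp_eq hS, hA, mat_shift a, ← hS,
    ← Op.val_injective.eq_iff]
  rfl

theorem isWaveOps_iff (h0 : (L 0).val = mat L1) (h1 : (L 1).val = mat L2)
    (hS0 : (S 0).val = mat W.S1) (hS1 : (S 1).val = mat W.S2) (hT0 : (T 0).val = mat W.T1)
    (hT1 : (T 1).val = mat W.T2) : IsWaveOps L1 L2 W ↔ IsDressed (laxBand L) S T ∧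
      ∀ a, L a = S a * Op.shift a PS (sg a) * T a := by
  have hB := mat_Bop h0 h1
  have e0 : sg 0 = 1 := rfl
  have e1 : sg 1 = -1 := rfl
  constructor
  · intro h
    refine ⟨⟨?_, ?_, ?_, ?_, ?_⟩, ?_⟩
    · intro a n k hk
      fin_cases a
      · change (S 0).val n k = 0
        rw [hS0]
        exact h.form_S1 _ _ (by simpa [e0] using hk)
      · change (S 1).val n k = 0
        rw [hS1]
        exact h.form_S2 _ _ (by simp [e1] at hk; omega)
    · intro a n k hk
      fin_cases a
      · change (T 0).val n k = 0
        rw [hT0]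
        exact h.form_T1 _ _ (by simpa [e0] using hk)
      · change (T 1).val n k = 0
        rw [hT1]
        exact h.form_T2 _ _ (by simp [e1] at hk; omega)
    · intro a
      fin_cases a
      exacts [(comp_eq_shift_iff hS0 hT0).1 h.S1_T1, (comp_eq_shift_iff hS1 hT1).1 h.S2_T2]
    · intro a
      fin_cases a
      exacts [(comp_eq_shift_iff hT0 hS0).1 h.T1_S1, (comp_eq_shift_iff hT1 hS1).1 h.T2_S2]
    · rintro a ⟨b, p⟩
      fin_cases a <;> fin_cases b
      · refine ((evol_sub_iff (hB _) hS0 _).1 (h.evol_one_S1 p)).trans ?_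
        simp [e0]
      · refine ((evol_iff (hB _) hS0 _).1 (h.evol_two_S1 p)).trans ?_
        simp
      · refine ((evol_iff (hB _) hS1 _).1 (h.evol_one_S2 p)).trans ?_
        simp
      · refine ((evol_sub_iff (hB _) hS1 _).1 (h.evol_two_S2 p)).trans ?_
        simp [e1]
    · intro a
      fin_cases a
      exacts [(dress_iff h0 hS0 hT0).1 h.dress_one, (dress_iff h1 hS1 hT1).1 h.dress_two]
  · rintro ⟨h, hL⟩
    refine ⟨fun j n hj => ?_, fun j n hj => ?_, fun j n hj => ?_, fun j n hj => ?_,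
      (comp_eq_shift_iff hS0 hT0).2 (h.mul_inv 0), (comp_eq_shift_iff hT0 hS0).2 (h.inv_mul 0),
      (comp_eq_shift_iff hS1 hT1).2 (h.mul_inv 1), (comp_eq_shift_iff hT1 hS1).2 (h.inv_mul 1),
      (dress_iff h0 hS0 hT0).2 (hL 0), (dress_iff h1 hS1 hT1).2 (hL 1),
      fun p => (evol_sub_iff (hB _) hS0 _).2 ?_, fun p => (evol_iff (hB _) hS1 _).2 ?_,
      fun p => (evol_iff (hB _) hS0 _).2 ?_, fun p => (evol_sub_iff (hB _) hS1 _).2 ?_⟩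
    · rw [← mat_apply_add W.S1, ← hS0]
      exact h.ordS 0 _ _ (by rw [e0]; omega)
    · rw [← mat_apply_add W.T1, ← hT0]
      exact h.ordT 0 _ _ (by rw [e0]; omega)
    · rw [← mat_apply_add W.S2, ← hS1]
      exact h.ordS 1 _ _ (by rw [e1]; omega)
    · rw [← mat_apply_add W.T2, ← hT1]
      exact h.ordT 1 _ _ (by rw [e1]; omega)
    · refine (h.evol 0 (0, p)).trans ?_
      simp [e0]
    · refine (h.evol 1 (0, p)).trans ?_
      simp
    · refine (h.evol 0 (1, p)).trans ?_
      simp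
    · refine (h.evol 1 (1, p)).trans ?_
      simp [e1]

/-! ### Wave functions -/

theorem Psi1_eq (hS0 : (S 0).val = mat W.S1) (n j : ℤ) : Psi1 W n j = S 0 n j := by
  rw [hS0]; rfl

theorem Psi2_eq (hS1 : (S 1).val = mat W.S2) (n j : ℤ) : Psi2 W n j = S 1 n j := by
  rw [hS1]; rfl

theorem Psi1Star_eq (hT0 : (T 0).val = mat W.T1) (n j : ℤ) :
    Psi1Star W n j = (T 0 * half 0 PS) (-j) n := by
  change -mat (comp iotaUp (adj W.T1)) n (-j) = _
  rw [mat_comp, Op.mul_apply, mmul, ← finsum_neg_distrib]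
  refine finsum_congr fun k => ?_
  rw [mat_iotaUp, mat_adj, hT0, half_zero_apply]
  split_ifs <;> simp

theorem Psi2Star_eq (hT1 : (T 1).val = mat W.T2) (n j : ℤ) :
    Psi2Star W n j = (T 1 * half 1 PS) (-j) n := by
  change mat (comp iotaDown (adj W.T2)) n (-j) = _
  rw [mat_comp, Op.mul_apply, mmul]
  refine finsum_congr fun k => ?_
  rw [mat_iotaDown, mat_adj, hT1, half_one_apply]
  split_ifs <;> simp

/-- Summation by parts: with `half a * halfInv a = 1` inserted, the commutator of `half a` with `q`
becomes the difference of `q` times a column of `A * half a`, summed with an expansion of `Δ^{-1}`.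
This is the form in the spectral representation of `q`. -/
theorem mul_comm_half_apply {a : Fin 2} (A : Op a PS) (q : ℤ → PS) (i n : ℤ) :
    (A * (half a PS * Op.diagonal a q - Op.diagonal a q * half a PS)) i n =
      ∑ᶠ k, ((q (k + 1) - q k) * (A * half a PS) i (k + 1)) *
        (if a = 0 then (if n ≤ k then -1 else 0) else if k < n then 1 else 0) := by
  have h1 : A * (half a PS * Op.diagonal a q - Op.diagonal a q * half a PS) = A * half a PS *
      (Op.diagonal a q - halfInv a PS * (Op.diagonal a q * half a PS)) := by
    rw [mul_sub (A * _), ← mul_assoc (A * _) (halfInv a PS), mul_assoc A (half a PS) (halfInv a PS),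
      half_mul_halfInv, mul_one, mul_sub, mul_assoc]
  rw [h1, Op.mul_apply, ← finsum_comp_equiv (Equiv.addRight 1)]
  refine finsum_congr fun k => ?_
  rw [Equiv.coe_addRight]
  beta_reduce
  rw [Op.sub_apply, halfInv_mul_apply, Op.diagonal_mul_apply,
    Op.diagonal_mul_apply, Op.diagonal_apply, add_sub_cancel_right, mul_comm (q (k + 1) - q k),
    mul_assoc]
  congr 1
  fin_cases a
  · change _ - sg 0 • (_ * half 0 PS _ _ - _ * half 0 PS _ _) = _ * if n ≤ k then -1 else 0
    rw [half_zero_apply, half_zero_apply, show sg 0 = 1 from rfl]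
    split_ifs <;> first | omega | simp
  · change _ - sg 1 • (_ * half 1 PS _ _ - _ * half 1 PS _ _) = _ * if k < n then 1 else 0
    rw [half_one_apply, half_one_apply, show sg 1 = -1 from rfl]
    split_ifs <;> first | omega | simp

/-- The counterpart for `r`: the entries of the first factor are differences of `r` times the kernel
of the expansion of `Δ^{-1}` opposite to the one in `mul_comm_half_apply`. -/
theorem comm_half_mul_apply {a : Fin 2} (A : Op a PS) (r : ℤ → PS) (n j : ℤ) :
    ((Op.diagonal a r - half a PS * Op.diagonal a r * halfInv a PS) * A) n j =
      ∑ᶠ k, (if a = 0 then (if k < n then 1 else 0) else if n ≤ k then -1 else 0) *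
        ((r (k + 1) - r k) * A k j) := by
  rw [Op.mul_apply]
  refine finsum_congr fun k => ?_
  rw [Op.sub_apply, mul_halfInv_apply, Op.mul_diagonal_apply, Op.mul_diagonal_apply,
    Op.diagonal_apply, ← mul_assoc]
  congr 1
  fin_cases a
  · change _ - sg 0 • (half 0 PS _ _ * _ - half 0 PS _ _ * _) = (if k < n then 1 else 0) * _
    rw [half_zero_apply, half_zero_apply, show sg 0 = 1 from rfl]
    split_ifs <;> first | omega | simp
    all_goals simp_all
  · change _ - sg 1 • (half 1 PS _ _ * _ - half 1 PS _ _ * _) = (if n ≤ k then -1 else 0) * _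
    rw [half_one_apply, half_one_apply, show sg 1 = -1 from rfl]
    split_ifs <;> first | omega | simp
    all_goals simp_all

variable {B : Time → Band PS}

theorem IsDressed.waveIdentityQ (h : IsDressed B S T) (hS0 : (S 0).val = mat W.S1)
    (hS1 : (S 1).val = mat W.S2) (hT0 : (T 0).val = mat W.T1) (hT1 : (T 1).val = mat W.T2)
    {q : ℤ → PS} (hq : IsEigen B q) : WaveIdentityQ W q := by
  intro n n'
  have h1 := h.pairing_q hq n n'
  rw [intInf_eq, intZero_eq, ← h1]
  simp only [mul_comm_half_apply, act_eq, mat_iotaUp, mat_iotaDown, Psi1_eq hS0, Psi2_eq hS1,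
    Psi1Star_eq hT0, Psi2Star_eq hT1, if_pos, one_ne_zero, if_false]
  simp only [mul_comm]

theorem IsDressed.waveIdentityR (h : IsDressed B S T) (hS0 : (S 0).val = mat W.S1)
    (hS1 : (S 1).val = mat W.S2) (hT0 : (T 0).val = mat W.T1) (hT1 : (T 1).val = mat W.T2)
    {r : ℤ → PS} (hr : IsAdjEigen B r) : WaveIdentityR W r := by
  intro n n'
  have h1 := h.pairing_r hr n n'
  rw [intInf_eq, intZero_eq, ← h1]
  simp only [comm_half_mul_apply, act_eq, mat_iotaUp, mat_iotaDown, Psi1_eq hS0, Psi2_eq hS1,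
    Psi1Star_eq hT0, Psi2Star_eq hT1, if_pos, one_ne_zero, if_false]

theorem IsDressed.waveIdentityConstraint (h : IsDressed B S T) (hS0 : (S 0).val = mat W.S1)
    (hS1 : (S 1).val = mat W.S2) (hT0 : (T 0).val = mat W.T1) (hT1 : (T 1).val = mat W.T2)
    (hq : ∀ i, IsEigen B (q i))
    (hc : ∀ n n', (S 0 * Op.shift 0 PS M * (T 0 * half 0 PS)) n n' +
      (S 1 * Op.shift 1 PS (-N) * (T 1 * half 1 PS)) n n' = ∑ i, q i n * r i n') :
    WaveIdentityConstraint M N W q r := by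
  intro n n'
  have h1 := h.pairing_shift (j := ![(M : ℤ), -N]) hq hc n n'
  rw [intInf_eq, intZero_eq, ← h1]
  simp only [Op.mul_shift_apply, Psi1_eq hS0, Psi2_eq hS1, Psi1Star_eq hT0, Psi2Star_eq hT1]
  rfl

theorem dressed_pow {a : Fin 2} {X Y Z : Op a PS} {j : ℤ} (hX : X = Y * Op.shift a PS j * Z)
    (h : Y * Z = 1) (h' : Z * Y = 1) (p : ℕ) : X ^ p = Y * Op.shift a PS (p * j) * Z := by
  induction p with
  | zero => simp [Op.shift_zero, h]
  | succ p ih =>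
    rw [pow_succ, ih, hX]
    calc _ = Y * Op.shift a PS (p * j) * (Z * Y) * Op.shift a PS j * Z := by simp only [mul_assoc]
      _ = _ := by
        rw [h', mul_one, mul_assoc Y, Op.shift_mul_shift]
        congr 3
        push_cast
        ring

end Mat

end GBMT

namespace GBMT

/-! ### Series of wave functions and tau functions -/

section WaveSeries

open PowerSeries

variable {a : Fin 2}

/-- The difference between the positions of a wave function and its dual. -/
def kap (a : Fin 2) : ℤ := if a = 0 then 0 else 1

theorem kap_eq (a : Fin 2) : sg a * kap a = -kap a := by
  unfold sg kap
  split_ifs <;> rfl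

theorem ordLE_half' : OrdLE a (-kap a) (half a PS) := fun n k h => by
  unfold sg kap at h
  change (if a = 0 then (if k ≤ n then (1 : PS) else 0) else if n < k then 1 else 0) = 0
  split_ifs at h ⊢ <;> first | rfl | omega

/-- A row of a matrix as a power series. -/
def rowSeries (A : Op a PS) (n : ℤ) : PS⟦X⟧ := PowerSeries.mk fun u : ℕ => A n (n - sg a * u)

/-- A column of a matrix as a power series. -/
def colSeries (A : Op a PS) (n : ℤ) : PS⟦X⟧ :=
  PowerSeries.mk fun v : ℕ => A (n + sg a * v) (n + kap a)

theorem sum_type (a : Fin 2) (f : Fin 2 → PS2) : f 0 + f 1 = f a + f (1 - a) := by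
  fin_cases a
  · rfl
  · exact add_comm _ _

theorem one_sub_ne (a : Fin 2) : 1 - a ≠ a := by
  revert a
  decide

/-- This is why bilinear identities are evaluated at `n' = n + kap a`: the degree bounds of the two
series in the other integral then add up to `-1`, and that integral drops out at shifted times. -/
theorem eval_ord_lt (a : Fin 2) (n : ℤ) :
    sg (1 - a) * n + (-(sg (1 - a) * (n + kap a)) - kap (1 - a)) < 0 := by
  fin_cases a
  · change sg 1 * n + (-(sg 1 * (n + kap 0)) - kap 1) < 0
    simp [sg, kap]
  · change sg 0 * n + (-(sg 0 * (n + kap 1)) - kap 0) < 0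
    simp [sg, kap]

theorem row_eq_zero {A : Op a PS} (hA : OrdLE a 0 A) (n i : ℤ) (h : sg a * n < sg a * i) :
    A n i = 0 := hA n i (by rw [mul_sub]; omega)

theorem col_eq_zero {K : Op a PS} (hK : OrdLE a (-kap a) K) (n i : ℤ)
    (h : -(sg a * n) - kap a < sg a * i) : K (-i) n = 0 :=
  hK _ _ (by rw [sub_neg_eq_add, mul_add]; omega)

/-- Evaluation of a bilinear identity with shifted times in the second factor. -/
theorem eval_inr {A K : ∀ a, Op a PS} (hA : ∀ a, OrdLE a 0 (A a))
    (hK : ∀ a, OrdLE a (-kap a) (K a)) {n : ℤ} {G : PS2} (a : Fin 2)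
    (h : pairing 0 (fun i => atT (A 0 n i)) (fun i => atT' (K 0 (-i) (n + kap a))) (dT 0) +
      pairing 1 (fun i => atT (A 1 n i)) (fun i => atT' (K 1 (-i) (n + kap a))) (dT 1) = G) :
    rowSeries (A a) n * miwaFull (tder a) (-1) (colSeries (K a) n) =
      evalShift Sum.inr a (-1) G := by
  have h1 (b : Fin 2) (i : ℤ) (hi : sg b * n < sg b * i) : atT (A b n i) = 0 := by
    rw [row_eq_zero (hA b) n i hi]
    exact map_zero atTHom
  have h2 (b : Fin 2) (i : ℤ) (hi : -(sg b * (n + kap a)) - kap b < sg b * i) :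
      atT' (K b (-i) (n + kap a)) = 0 := by
    rw [col_eq_zero (hK b) _ i hi]
    exact map_zero atTHom'
  rw [sum_type a fun b => pairing b (fun i => atT (A b n i))
    (fun i => atT' (K b (-i) (n + kap a))) (dT b)] at h
  rw [← h, map_add, evalShift_pairing_eq_zero (b := 1 - a) (wtd_dT _) (diag_dT _) (fun p q => ?_)
    (h1 _) (h2 _) (eval_ord_lt a n), add_zero,
    evalShift_pairing (ε' := -1) (α := sg a * n) (by ring) (wtd_dT _) (diag_dT _) (fun p q => ?_)
    (fun i => evalShift_inr_atT a _ _) (fun i => evalShift_atT' a _ _) (h1 a) fun i hi => ?_]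
  · congr 2
    · ext1 u
      rw [rowSeries, coeff_mk, coeff_mk, mul_sub, sg_mul_sg_mul]
    · ext1 v
      rw [colSeries, coeff_mk, coeff_mk, mul_sub, mul_neg, sg_mul_sg_mul]
      congr 1
      ring
  · rw [pderiv_inr_dT, if_pos rfl]
    simp
  · refine h2 a i ?_
    have := kap_eq a
    rw [mul_add]
    omega
  · rw [pderiv_inr_dT, if_neg (one_sub_ne a)]
    simp

/-- Evaluation of a bilinear identity with shifted times in the first factor. -/
theorem eval_inl {A K : ∀ a, Op a PS} (hA : ∀ a, OrdLE a 0 (A a))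
    (hK : ∀ a, OrdLE a (-kap a) (K a)) {n : ℤ} {G : PS2} (a : Fin 2)
    (h : pairing 0 (fun i => atT (A 0 n i)) (fun i => atT' (K 0 (-i) (n + kap a))) (dT 0) +
      pairing 1 (fun i => atT (A 1 n i)) (fun i => atT' (K 1 (-i) (n + kap a))) (dT 1) = G) :
    colSeries (K a) n * miwaFull (tder a) 1 (rowSeries (A a) n) =
      evalShift Sum.inl a 1 G := by
  have h1 (b : Fin 2) (i : ℤ) (hi : sg b * n < sg b * i) : atT (A b n i) = 0 := by
    rw [row_eq_zero (hA b) n i hi]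
    exact map_zero atTHom
  have h2 (b : Fin 2) (i : ℤ) (hi : -(sg b * (n + kap a)) - kap b < sg b * i) :
      atT' (K b (-i) (n + kap a)) = 0 := by
    rw [col_eq_zero (hK b) _ i hi]
    exact map_zero atTHom'
  rw [sum_type a fun b => pairing b (fun i => atT (A b n i))
    (fun i => atT' (K b (-i) (n + kap a))) (dT b)] at h
  rw [← h, map_add, evalShift_pairing_eq_zero (b := 1 - a) (wtd_dT _) (diag_dT _) (fun p q => ?_)
    (h1 _) (h2 _) (eval_ord_lt a n), add_zero, pairing_comm,
    evalShift_pairing (ε' := 1) (α := -(sg a * n)) (by ring) (wtd_dT _) (diag_dT _) (fun p q => ?_)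
    (fun i => evalShift_inl_atT' a _ _) (fun i => evalShift_atT a _ _) (fun i hi => ?_)
    fun i hi => ?_]
  · congr 2
    · ext1 v
      rw [colSeries, coeff_mk, coeff_mk, mul_sub, mul_neg, sg_mul_sg_mul]
      congr 1
      ring
    · ext1 u
      rw [rowSeries, coeff_mk, coeff_mk, neg_neg, mul_sub, sg_mul_sg_mul]
  · rw [pderiv_inl_dT, if_pos rfl]
    simp
  · refine h2 a i ?_
    have := kap_eq a
    rw [mul_add]
    omega
  · exact h1 a i (by omega)
  · rw [pderiv_inl_dT, if_neg (one_sub_ne a)]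
    simp

variable {B : Time → Band PS} {S T : ∀ a, Op a PS}

theorem ordLE_mul_half {A K : Op a PS} (hA : OrdLE a 0 A) (hK : OrdLE a (-kap a) K) :
    OrdLE a (-kap a) (A * K) := by
  simpa using hA.mul hK

theorem IsDressed.ord_star (h : IsDressed B S T) (a : Fin 2) :
    OrdLE a (-kap a) (T a * half a PS) := ordLE_mul_half (h.ordT a) ordLE_half'

/-- The bilinear identity with right-hand side `1`, at `t'` equal to `t` shifted by the Miwa shift
of type `a`: the shifted dual wave function is the inverse of the wave function. -/
theorem IsDressed.row_mul_star (h : IsDressed B S T) (a : Fin 2) (n : ℤ) :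
    rowSeries (S a) n * miwaFull (tder a) (-1) (colSeries (T a * half a PS) n) = 1 := by
  rw [eval_inr (K := fun a => T a * half a PS) h.ordS h.ord_star a (h.pairing_one n _), map_one]

theorem IsDressed.star_mul_row (h : IsDressed B S T) (a : Fin 2) (n : ℤ) :
    colSeries (T a * half a PS) n * miwaFull (tder a) 1 (rowSeries (S a) n) = 1 := by
  rw [eval_inl (K := fun a => T a * half a PS) h.ordS h.ord_star a (h.pairing_one n _), map_one]

/-- Both sides have the same product with the invertible shifted row of `S a`, by the reproducing
identity for `q` and by `star_mul_row`. With a tau pair this makes `ρ = q τ_1` play the role of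
`τ_1`. -/
theorem IsDressed.colSeries_eigen (h : IsDressed B S T) {q : ℤ → PS} (hq : IsEigen B q)
    (a : Fin 2) (n : ℤ) : colSeries (T a * (Op.diagonal a q * half a PS)) n =
      colSeries (T a * half a PS) n * miwaHom (tder a) 1 (q n) := by
  have h1 := eval_inl (K := fun a => T a * (Op.diagonal a q * half a PS)) h.ordS
    (fun a => ordLE_mul_half (h.ordT a) (ordLE_mul_half (ordLE_diagonal q) ordLE_half')) a
    (h.pairing_eigen hq n _)
  rw [evalShift_atT] at h1
  linear_combination colSeries (T a * half a PS) n * h1 -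
    colSeries (T a * (Op.diagonal a q * half a PS)) n * h.star_mul_row a n

theorem ordLE_halfInv (a : Fin 2) : OrdLE a (kap a) (halfInv a PS) := by
  intro n k hk
  have h1 := halfInv_mul_apply (1 : Op a PS) n k
  rw [mul_one, Op.one_apply, Op.one_apply] at h1
  rw [h1]
  fin_cases a
  · simp [sg, kap] at hk ⊢
    rw [if_neg (by omega), if_neg (by omega), sub_self]
  · simp [sg, kap] at hk ⊢
    rw [if_neg (by omega), if_neg (by omega), sub_self]

theorem ordLE_conj_diagonal (r : ℤ → PS) {A : Op a PS} (hA : OrdLE a 0 A) :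
    OrdLE a 0 (half a PS * Op.diagonal a r * halfInv a PS * A) := by
  simpa using ((ordLE_half'.mul (ordLE_diagonal r)).mul (ordLE_halfInv a)).mul hA

theorem IsDressed.rowSeries_adjEigen (h : IsDressed B S T) {r : ℤ → PS} (hr : IsAdjEigen B r)
    (a : Fin 2) (n : ℤ) : rowSeries (half a PS * Op.diagonal a r * halfInv a PS * S a) n =
      rowSeries (S a) n * miwaHom (tder a) (-1) (r (n + kap a)) := by
  have h1 := eval_inr (A := fun a => half a PS * Op.diagonal a r * halfInv a PS * S a)
    (K := fun a => T a * half a PS) (fun a => ordLE_conj_diagonal r (h.ordS a)) h.ord_star a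
    (h.pairing_adjEigen hr n _)
  rw [evalShift_atT'] at h1
  linear_combination rowSeries (S a) n * h1 -
    rowSeries (half a PS * Op.diagonal a r * halfInv a PS * S a) n * h.row_mul_star a n

/-! ### Tau pairs -/

/-- The coefficients of `f(t + ε [z^{∓1}]_a)`. -/
def shiftCoeff (a : Fin 2) (ε : ℂ) (f : PS) (j : ℤ) : PS :=
  if 0 ≤ -(sg a * j) then miwaCoeff a ε f (-(sg a * j)).toNat else 0

theorem shiftOne_eq (ε : ℂ) (f : PS) : shiftOne ε f = shiftCoeff 0 ε f := by
  ext1 j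
  rw [shiftOne, shiftCoeff, show sg 0 = 1 from rfl, one_mul]
  exact if_congr (by omega) rfl rfl

theorem shiftTwo_eq (ε : ℂ) (f : PS) : shiftTwo ε f = shiftCoeff 1 ε f := by
  ext1 j
  rw [shiftTwo, shiftCoeff, show sg 1 = -1 from rfl, neg_one_mul, neg_neg]

/-- The relations between wave functions and tau functions, as identities of power series. -/
structure IsTauSeries (S P : ∀ a, Op a PS) (τ0 τ1 : ℤ → PS) : Prop where
  row : ∀ a n, rowSeries (S a) n * C (τ1 n) = miwaHom (tder a) (-1) (τ0 (n + kap a))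
  col : ∀ a n, colSeries (P a) n * C (τ0 (n + kap a)) = miwaHom (tder a) 1 (τ1 n)

theorem row_mul_iff {A : Op a PS} (hA : OrdLE a 0 A) {x f : PS} {n : ℤ} :
    rowSeries A n * C x = miwaHom (tder a) (-1) f ↔
      ∀ j, A n j * x = shiftCoeff a (-1) f (j - n) := by
  constructor
  · intro h j
    rw [shiftCoeff]
    split_ifs with hj
    · have h1 := congrArg (coeff (-(sg a * (j - n))).toNat) h
      rw [coeff_mul_C, rowSeries, coeff_mk, Int.toNat_of_nonneg hj, mul_neg, sg_mul_sg_mul] at h1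
      rw [miwaCoeff_eq, ← h1]
      congr 2
      ring
    · rw [hA n j (by omega), zero_mul]
  · intro h
    ext1 u
    rw [coeff_mul_C, rowSeries, coeff_mk, h, shiftCoeff]
    have e : -(sg a * (n - sg a * u - n)) = u := by
      rw [sub_sub_cancel_left, mul_neg, sg_mul_sg_mul, neg_neg]
    rw [e, if_pos (Int.natCast_nonneg u), Int.toNat_natCast, miwaCoeff_eq]

theorem col_mul_iff {K : Op a PS} (hK : OrdLE a (-kap a) K) {y g : PS} {n : ℤ} :
    colSeries K n * C y = miwaHom (tder a) 1 g ↔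
      ∀ j, K (-j) (n + kap a) * y = shiftCoeff a 1 g (j + n) := by
  constructor
  · intro h j
    rw [shiftCoeff]
    split_ifs with hj
    · have h1 := congrArg (coeff (-(sg a * (j + n))).toNat) h
      rw [coeff_mul_C, colSeries, coeff_mk, Int.toNat_of_nonneg hj, mul_neg, sg_mul_sg_mul] at h1
      rw [miwaCoeff_eq, ← h1]
      congr 2
      ring
    · rw [hK _ _ ?_, zero_mul]
      have := kap_eq a
      have e : sg a * (n + kap a - -j) = sg a * (j + n) + sg a * kap a := by ring
      omega
  · intro h
    ext1 v
    have h1 := h (-(n + sg a * v))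
    rw [neg_neg] at h1
    rw [coeff_mul_C, colSeries, coeff_mk, h1, shiftCoeff]
    have e : -(sg a * (-(n + sg a * v) + n)) = v := by
      rw [neg_add_rev, neg_add_cancel_right, mul_neg, sg_mul_sg_mul, neg_neg]
    rw [e, if_pos (Int.natCast_nonneg v), Int.toNat_natCast, miwaCoeff_eq]

theorem isTauPair_iff {W : WaveOps} (h : IsDressed B S T) (hS0 : (S 0).val = mat W.S1)
    (hS1 : (S 1).val = mat W.S2) (hT0 : (T 0).val = mat W.T1) (hT1 : (T 1).val = mat W.T2)
    {τ0 τ1 : ℤ → PS} : IsTauPair W τ0 τ1 ↔ (∀ n, IsUnit (τ0 n)) ∧ (∀ n, IsUnit (τ1 n)) ∧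
      IsTauSeries S (fun a => T a * half a PS) τ0 τ1 := by
  have e0 : kap 0 = 0 := rfl
  have e1 : kap 1 = 1 := rfl
  constructor
  · rintro ⟨hu0, hu1, h1, h2, h3, h4⟩
    refine ⟨hu0, hu1, fun a n => (row_mul_iff (h.ordS a)).2 fun j => ?_,
      fun a n => (col_mul_iff (h.ord_star a)).2 fun j => ?_⟩
    · fin_cases a
      · have := h1 n j
        rw [Psi1_eq hS0, shiftOne_eq, zMul] at this
        simpa [e0] using this
      · have := h3 n j
        rw [Psi2_eq hS1, shiftTwo_eq, zMul] at this
        simpa [e1] using this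
    · fin_cases a
      · have := h2 n j
        rw [Psi1Star_eq hT0, shiftOne_eq, zMul] at this
        simpa [e0] using this
      · have := h4 (n + 1) j
        rw [Psi2Star_eq hT1, shiftTwo_eq, zMul] at this
        simpa [e1] using this
  · rintro ⟨hu0, hu1, h1, h2⟩
    refine ⟨hu0, hu1, fun n j => ?_, fun n j => ?_, fun n j => ?_, fun n j => ?_⟩
    · have := (row_mul_iff (h.ordS 0)).1 (h1 0 n) j
      rw [Psi1_eq hS0, shiftOne_eq, zMul, this, e0, add_zero]
    · have := (col_mul_iff (h.ord_star 0)).1 (h2 0 n) j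
      rw [e0, add_zero] at this
      rw [Psi1Star_eq hT0, shiftOne_eq, zMul, this, sub_neg_eq_add]
    · have := (row_mul_iff (h.ordS 1)).1 (h1 1 n) j
      rw [Psi2_eq hS1, shiftTwo_eq, zMul, this, e1]
    · have := (col_mul_iff (h.ord_star 1)).1 (h2 1 (n - 1)) j
      rw [e1, sub_add_cancel] at this
      rw [Psi2Star_eq hT1, shiftTwo_eq, zMul, this]
      congr 1
      ring

/-- Pairings of tau functions in terms of wave functions. -/
theorem tauPairing_eq {A K : ∀ a, Op a PS} (hA : ∀ a, OrdLE a 0 (A a))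
    (hK : ∀ a, OrdLE a (-kap a) (K a)) {x y f g : ℤ → PS}
    (hrow : ∀ a n, rowSeries (A a) n * C (x n) = miwaHom (tder a) (-1) (f (n + kap a)))
    (hcol : ∀ a n, colSeries (K a) n * C (y (n + kap a)) = miwaHom (tder a) 1 (g n))
    (e₁ e₂ n n' : ℤ) : tauPairing e₁ e₂ f g n n' = atT (x n) * atT' (y n') *
      (pairing 0 (fun i => atT ((A 0 * Op.shift 0 PS e₁) n i)) (fun i => atT' (K 0 (-i) n')) (dT 0) +
       pairing 1 (fun i => atT ((A 1 * Op.shift 1 PS e₂) n i)) (fun i => atT' (K 1 (-i) n')) (dT 1))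
      := by
  have key (a : Fin 2) (e : ℤ) : pairing a
      (zMul (e + n - n' + kap a) fun j => atT (shiftCoeff a (-1) (f (n + kap a)) j))
      (fun j => atT' (shiftCoeff a 1 (g (n' - kap a)) j)) (dT a) = atT (x n) * atT' (y n') *
      pairing a (fun i => atT ((A a * Op.shift a PS e) n i)) (fun i => atT' (K a (-i) n'))
        (dT a) := by
    have hc : Bdd a fun i => atT ((A a * Op.shift a PS e) n i) := bdd_atT (bdd_row _ _)
    have hd : Bdd a fun i => atT' (K a (-i) n') := bdd_atT' (bdd_col _ _)
    rw [mul_comm (atT _), mul_assoc, ← pairing_mul_left _ hc hd (wtd_dT a), pairing_comm a (fun i => _ * _),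
      ← pairing_mul_left _ hd (hc.comp (f := fun z => atT (x n) * z) (mul_zero _)) (wtd_dT a),
      pairing_comm a (fun i => _ * _)]
    -- The power of `z` is split so that `e + n` goes to the series at `t` and `kap a - n'` to the
    -- series at `t'`.
    rw [show e + n - n' + kap a = (kap a - n') + (e + n) by ring, ← zMul_zMul, pairing_comm,
      ← pairing_zMul, pairing_comm]
    congr 1
    · ext1 j
      have h1 := (row_mul_iff (hA a)).1 (hrow a n) (j - e)
      rw [Op.mul_shift_apply, zMul]
      change atTHom _ = atTHom _ * atTHom _
      rw [← map_mul, mul_comm, h1]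
      congr 2
      ring
    · ext1 j
      have h1 := (col_mul_iff (hK a)).1 (hcol a (n' - kap a)) j
      rw [sub_add_cancel] at h1
      rw [zMul]
      change atTHom' _ = atTHom' _ * atTHom' _
      rw [← map_mul, mul_comm, h1]
      congr 2
      ring
  have h0 := key 0 e₁
  have h1 := key 1 e₂
  rw [mul_add, ← h0, ← h1, tauPairing, intInf_eq, intZero_eq]
  simp only [shiftOne_eq, shiftTwo_eq]
  simp [kap]

/-- The tau functions of a solution satisfy the bilinear equations. -/
theorem IsDressed.isTauSolution (h : IsDressed B S T) {M N m : ℕ} {q r : Fin m → ℤ → PS}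
    (hq : ∀ i, IsEigen B (q i)) (hr : ∀ i, IsAdjEigen B (r i))
    (hc : ∀ n n', (S 0 * Op.shift 0 PS M * (T 0 * half 0 PS)) n n' +
      (S 1 * Op.shift 1 PS (-N) * (T 1 * half 1 PS)) n n' = ∑ i, q i n * r i n')
    {τ0 τ1 : ℤ → PS} (hτ : IsTauSeries S (fun a => T a * half a PS) τ0 τ1) :
    IsTauSolution M N τ0 τ1 (fun i n => q i n * τ1 n) fun i n => r i n * τ0 n := by
  have hT : ∀ x y, atT (x * y) = atT x * atT y := map_mul atTHom
  have hT' : ∀ x y, atT' (x * y) = atT' x * atT' y := map_mul atTHom'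
  have hord (q : ℤ → PS) (a : Fin 2) :
      OrdLE a (-kap a) (T a * (Op.diagonal a q * half a PS)) :=
    ordLE_mul_half (h.ordT a) (ordLE_mul_half (ordLE_diagonal q) ordLE_half')
  refine ⟨fun n n' => ?_, fun i n n' => ?_, fun i n n' => ?_, fun n n' => ?_⟩
  · have e := h.pairing_shift (j := ![(M : ℤ), -N]) hq hc n n'
    change pairing 0 (fun i => atT ((S 0 * Op.shift 0 PS M) n i)) _ _ +
      pairing 1 (fun i => atT ((S 1 * Op.shift 1 PS (-N)) n i)) _ _ = _ at e
    rw [tauPairing_eq h.ordS h.ord_star hτ.row hτ.col, e, Finset.mul_sum]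
    refine Finset.sum_congr rfl fun i _ => ?_
    rw [hT, hT']
    ring
  -- The role of the dual wave operator is played by `T a * diagonal a q * half a`, whose columns
  -- are the shifted `ρ` divided by `τ0`.
  · rw [tauPairing_eq h.ordS (hord (q i)) hτ.row (y := τ0) fun a n => ?_]
    · simp only [Op.shift_zero, mul_one]
      rw [h.pairing_eigen (hq i), hT]
      ring
    · rw [h.colSeries_eigen (hq i), map_mul, ← hτ.col]
      ring
  · rw [tauPairing_eq (fun a => ordLE_conj_diagonal (r i) (h.ordS a)) h.ord_star (x := τ1) (fun a n => ?_) hτ.col]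
    · simp only [Op.shift_zero, mul_one]
      rw [h.pairing_adjEigen (hr i), hT']
      ring
    · rw [h.rowSeries_adjEigen (hr i), map_mul, ← hτ.row]
      ring
  · rw [tauPairing_eq h.ordS h.ord_star hτ.row hτ.col]
    simp only [Op.shift_zero, mul_one]
    rw [h.pairing_one, mul_one]

end WaveSeries

end GBMT

namespace GBMT

/-! ### Wave operators with shifted times -/

section ShiftedWaves

open PowerSeries

variable {a b : Fin 2} {B : Time → Band PS} {S T : ∀ a, Op a PS}

/-- The coefficient of `z^k` in `A(t - [z]_a)`. -/
def miwaOp (a : Fin 2) (k : ℕ) : Op b PS →+ Op b PS where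
  toFun A := ⟨fun n j => coeff k (miwaHom (tder a) (-1) (A n j)), by
    obtain ⟨c, hc⟩ := A.2
    exact ⟨c, fun n j h => by simp only [hc n j h, map_zero]⟩⟩
  map_zero' := Op.ext fun n j => by simp
  map_add' A B := Op.ext fun n j => by simp

theorem miwaOp_apply (k : ℕ) (A : Op b PS) (n j : ℤ) :
    miwaOp a k A n j = coeff k (miwaHom (tder a) (-1) (A n j)) := rfl

theorem miwaOp_zero (A : Op b PS) : miwaOp a 0 A = A := Op.ext fun n j => by
  rw [miwaOp_apply, coeff_zero_miwaHom]

theorem OrdLE.miwaOp {c : ℤ} {A : Op b PS} (h : OrdLE b c A) (k : ℕ) :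
    OrdLE b c (miwaOp a k A) := fun n j hj => by
  rw [miwaOp_apply, h n j hj, map_zero, map_zero]

theorem Op.sum_apply {ι : Type*} (s : Finset ι) (f : ι → Op b PS) (n j : ℤ) :
    (∑ i ∈ s, f i) n j = ∑ i ∈ s, f i n j :=
  map_sum (⟨⟨fun A : Op b PS => A n j, rfl⟩, fun _ _ => rfl⟩ : Op b PS →+ PS) _ _

theorem miwaOp_succ (k : ℕ) (A : Op b PS) : (k + 1) • miwaOp a (k + 1) A =
    -∑ p ∈ Finset.HasAntidiagonal.antidiagonal k, opDt (a, p.1.succPNat) (miwaOp a p.2 A) := by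
  refine Op.ext fun n j => ?_
  have h := miwaHom_succ (tder a) (-1) (A n j) k
  rw [neg_one_smul] at h
  rw [Op.neg_apply, Op.sum_apply]
  change (k + 1) • (miwaOp a (k + 1) A n j : PS) = _
  rw [nsmul_eq_mul, mul_comm, Nat.cast_add, Nat.cast_one]
  exact h

/-- The coefficients of `A(t - [z]_a) (1 - z Λ^{±1})`, with the second factor only for the type `a`. -/
def waveShift (a : Fin 2) (A : Op b PS) : ℕ → Op b PS
  | 0 => A
  | k + 1 => miwaOp a (k + 1) A - if a = b then miwaOp a k A * Op.shift b PS (sg b) else 0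

/-- Multiplication by the geometric series in `z Λ^{±1}` undoes the factor `1 - z Λ^{±1}`. -/
theorem sum_waveShift (A : Op b PS) (k : ℕ) : ∑ p ∈ Finset.HasAntidiagonal.antidiagonal k,
    waveShift b A p.2 * Op.shift b PS (sg b * ((p.1 : ℤ) + 1)) =
      miwaOp b k A * Op.shift b PS (sg b) := by
  induction k with
  | zero => simp [waveShift, miwaOp_zero]
  | succ k ih =>
    have e (p : ℕ × ℕ) : waveShift b A p.2 * Op.shift b PS (sg b * (((p.1 + 1 : ℕ) : ℤ) + 1)) =
        (waveShift b A p.2 * Op.shift b PS (sg b * ((p.1 : ℤ) + 1))) * Op.shift b PS (sg b) := by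
      rw [mul_assoc, Op.shift_mul_shift]
      congr 2
      push_cast
      ring
    rw [Finset.Nat.antidiagonal_succ, Finset.sum_cons, Finset.sum_map]
    simp only [Function.Embedding.prodMap, Function.Embedding.coeFn_mk, Prod.map,
      Function.Embedding.refl_apply, Nat.succ_eq_add_one, e]
    rw [← Finset.sum_mul, ih, waveShift, if_pos rfl]
    simp [sub_mul]

/-- Since `1 - z Λ^{±1} = exp(-∑ z^p Λ^{±p} / p)`, this is the recursion for the shift by `-[z]_a`
with `∂_p` replaced by `∂_p` plus right multiplication by `Λ^{±p}`, that is, for the wave function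
including its exponential. -/
theorem waveShift_succ (A : Op b PS) (k : ℕ) : (k + 1) • waveShift a A (k + 1) =
    -∑ p ∈ Finset.HasAntidiagonal.antidiagonal k, (opDt (a, p.1.succPNat) (waveShift a A p.2) +
      if a = b then waveShift a A p.2 * Op.shift b PS (sg b * ((p.1 : ℤ) + 1)) else 0) := by
  by_cases hab : a = b
  · subst hab
    simp only [if_true]
    rw [Finset.sum_add_distrib, sum_waveShift, waveShift, if_pos rfl, smul_sub, miwaOp_succ,
      succ_nsmul, ← smul_mul_assoc]
    cases k with
    | zero =>
      simp [waveShift, miwaOp_zero]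
      abel
    | succ k =>
      have hd (s : Time) (X : Op a PS) : opDt s (X * Op.shift a PS (sg a)) =
          opDt s X * Op.shift a PS (sg a) := by
        rw [opDt, Op.der_mul, Op.der_shift, mul_zero, add_zero]
      rw [miwaOp_succ, Finset.Nat.antidiagonal_succ', Finset.sum_cons, Finset.sum_map,
        Finset.sum_cons, Finset.sum_map]
      simp only [Function.Embedding.prodMap, Function.Embedding.coeFn_mk, Prod.map,
        Function.Embedding.refl_apply, Nat.succ_eq_add_one, waveShift, if_true, map_sub, hd,
        Finset.sum_sub_distrib, miwaOp_zero, ← Finset.sum_mul, neg_mul]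
      abel
  · simp only [if_neg hab, add_zero]
    have e : waveShift a A = fun k => miwaOp a k A := by
      funext k
      cases k with
      | zero => rw [waveShift, miwaOp_zero]
      | succ k => rw [waveShift, if_neg hab, sub_zero]
    rw [e, miwaOp_succ]

theorem IsDressed.opDt_inv (h : IsDressed B S T) (b : Fin 2) (s : Time) : opDt s (T b) =
    -(T b * (B s).op b) + if s.1 = b then Op.shift b PS (sg b * s.2) * T b else 0 := by
  rw [opDt, Op.der_inv _ (h.mul_inv b) (h.inv_mul b)]
  change -(T b * opDt s (S b) * T b) = _
  rw [h.evol]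
  have e1 : T b * ((B s).op b * S b) * T b = T b * (B s).op b := by
    rw [mul_assoc, mul_assoc, h.mul_inv, mul_one]
  split_ifs
  · rw [mul_sub, sub_mul, e1, ← mul_assoc, h.inv_mul, one_mul]
    abel
  · rw [sub_zero, e1, add_zero]

/-- Multiplication by `T b` cancels the shifts against those in `∂T`. Only the bands remain in the
recursion, and they have the same entries for both types. -/
theorem IsDressed.waveShift_mul_succ (h : IsDressed B S T) (b : Fin 2) (k : ℕ) :
    (k + 1) • (waveShift a (S b) (k + 1) * T b) =
      -∑ p ∈ Finset.HasAntidiagonal.antidiagonal k,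
        (opDt (a, p.1.succPNat) (waveShift a (S b) p.2 * T b) +
          waveShift a (S b) p.2 * T b * (B (a, p.1.succPNat)).op b) := by
  rw [← smul_mul_assoc, waveShift_succ, neg_mul, Finset.sum_mul]
  congr 1
  refine Finset.sum_congr rfl fun p _ => ?_
  have e : opDt (a, p.1.succPNat) (waveShift a (S b) p.2 * T b) =
      opDt (a, p.1.succPNat) (waveShift a (S b) p.2) * T b +
        waveShift a (S b) p.2 * opDt (a, p.1.succPNat) (T b) := Op.der_mul _ _ _
  rw [e, h.opDt_inv]
  have e2 : ((p.1.succPNat : ℕ+) : ℤ) = (p.1 : ℤ) + 1 := by simp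
  by_cases hab : a = b
  · simp only [hab, if_true, e2]
    noncomm_ring
  · simp only [hab, if_false]
    noncomm_ring

/-- Quotients of shifted wave operators by wave operators do not depend on the type. -/
theorem IsDressed.waveShift_mul_val (h : IsDressed B S T) (a : Fin 2) (k : ℕ) :
    (waveShift a (S 0) k * T 0).val = (waveShift a (S 1) k * T 1).val := by
  induction k using Nat.strong_induction_on with
  | _ k ih =>
    cases k with
    | zero =>
      rw [waveShift, waveShift, h.mul_inv, h.mul_inv]
      funext n j
      rw [Op.one_apply, Op.one_apply]
    | succ k =>
      funext n j
      have h0 := congrArg (fun A : Op 0 PS => A n j) (h.waveShift_mul_succ (a := a) 0 k)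
      have h1 := congrArg (fun A : Op 1 PS => A n j) (h.waveShift_mul_succ (a := a) 1 k)
      rw [Op.neg_apply, Op.sum_apply] at h0 h1
      have e : ∀ p ∈ Finset.HasAntidiagonal.antidiagonal k,
          (opDt (a, p.1.succPNat) (waveShift a (S 0) p.2 * T 0) +
            waveShift a (S 0) p.2 * T 0 * (B (a, p.1.succPNat)).op 0) n j =
          (opDt (a, p.1.succPNat) (waveShift a (S 1) p.2 * T 1) +
            waveShift a (S 1) p.2 * T 1 * (B (a, p.1.succPNat)).op 1) n j := by
        intro p hp
        have hp' : p.2 < k + 1 := by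
          have := Finset.HasAntidiagonal.mem_antidiagonal.1 hp
          omega
        have e1 := ih p.2 hp'
        rw [Op.add_apply, Op.add_apply, Op.coe_mul (_ * T 0), Op.coe_mul (_ * T 1), e1]
        congr 1
        exact congrArg (fun f => dt (a, p.1.succPNat) (f n j)) e1
      rw [Finset.sum_congr rfl e, ← h1] at h0
      change (k + 1) • ((waveShift a (S 0) (k + 1) * T 0) n j : PS) =
        (k + 1) • ((waveShift a (S 1) (k + 1) * T 1) n j : PS) at h0
      rw [nsmul_eq_mul, nsmul_eq_mul, mul_comm, mul_comm _ ((waveShift a (S 1) (k + 1) * T 1).val n j),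
        Nat.cast_add, Nat.cast_one] at h0
      exact cast_succ_mul_cancel k h0

theorem OrdLE.waveShift {A : Op b PS} (hA : OrdLE b 0 A) (k : ℕ) :
    OrdLE b (if a = b then 1 else 0) (waveShift a A k) := by
  have h1 : (0 : ℤ) ≤ if a = b then 1 else 0 := by split_ifs <;> omega
  cases k with
  | zero => exact hA.mono h1
  | succ k =>
    refine ((hA.miwaOp _).mono h1).sub ?_
    split_ifs
    · have := (hA.miwaOp (a := a) k).mul (ordLE_shift (R := PS) (sg b))
      rwa [sg_mul_self, zero_add] at this
    · exact OrdLE.zero _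

theorem sg_one_sub (a : Fin 2) : sg (1 - a) = -sg a := by
  revert a
  decide

/-- The wave functions with shifted times are combinations of two neighbouring wave functions. -/
theorem IsDressed.exists_shift_eq (h : IsDressed B S T) (a : Fin 2) (n : ℤ) :
    ∃ d₀ d₁ : PS⟦X⟧,
      (∀ j, miwaHom (tder a) (-1) (S a n j) - X * miwaHom (tder a) (-1) (S a n (j - sg a)) =
        d₀ * C (S a n j) + d₁ * C (S a (n + sg a) j)) ∧
      ∀ j, miwaHom (tder a) (-1) (S (1 - a) n j) =
        d₀ * C (S (1 - a) n j) + d₁ * C (S (1 - a) (n + sg a) j) := by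
  set D : ℕ → ℤ → ℤ → PS := fun k => (waveShift a (S 0) k * T 0).val with hD
  have hDb (b : Fin 2) (k : ℕ) : (waveShift a (S b) k * T b).val = D k := by
    fin_cases b
    · rfl
    · exact (h.waveShift_mul_val a k).symm
  -- As a matrix of type `a`, `D k` has order at most `1`; as one of type `1 - a`, order at most `0`
  -- in the opposite direction. Two diagonals are left.
  have hord (k : ℕ) (m j : ℤ) (hj : sg a * (j - m) ≠ 0) (hj1 : sg a * (j - m) ≠ 1) :
      D k m j = 0 := by
    by_cases hlt : 0 < sg a * (j - m)
    · have := ((h.ordS a).waveShift (a := a) k).mul (h.ordT a)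
      rw [if_pos rfl, add_zero, hDb] at this
      exact this m j (by omega)
    · have := ((h.ordS (1 - a)).waveShift (a := a) k).mul (h.ordT (1 - a))
      rw [if_neg (one_sub_ne a).symm, add_zero, hDb] at this
      exact this m j (by rw [sg_one_sub, neg_mul]; omega)
  have hmul (b : Fin 2) (k : ℕ) (j : ℤ) :
      waveShift a (S b) k n j = D k n n * S b n j + D k n (n + sg a) * S b (n + sg a) j := by
    have h1 : waveShift a (S b) k = waveShift a (S b) k * T b * S b := by
      rw [mul_assoc, h.inv_mul, mul_one]
    rw [h1, Op.mul_apply, hDb, ← finsum_mem_univ]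
    rw [finsum_mem_univ, finsum_eq_sum_of_support_subset (s := {n, n + sg a})]
    · rw [Finset.sum_pair]
      intro h0
      have := sg_mul_self a
      rw [left_eq_add] at h0
      rw [h0] at this
      omega
    · intro i hi
      by_contra hi'
      simp only [Finset.coe_insert, Finset.coe_singleton, Set.mem_insert_iff,
        Set.mem_singleton_iff, not_or] at hi'
      refine hi ?_
      have h2 : sg a * (i - n) ≠ 0 := fun h0 => hi'.1 (by
        have := sg_mul_sg_mul a (i - n)
        rw [h0, mul_zero] at this
        omega)
      have h3 : sg a * (i - n) ≠ 1 := fun h0 => hi'.2 (by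
        have := sg_mul_sg_mul a (i - n)
        rw [h0, mul_one] at this
        omega)
      change D k n i * _ = 0
      rw [hord k n i h2 h3, zero_mul]
  refine ⟨PowerSeries.mk fun k => D k n n, PowerSeries.mk fun k => D k n (n + sg a),
    fun j => ?_, fun j => ?_⟩
  · ext1 k
    rw [map_add, coeff_mul_C, coeff_mul_C, coeff_mk, coeff_mk, ← hmul, map_sub]
    cases k with
    | zero => simp [waveShift]
    | succ k =>
      rw [coeff_succ_X_mul, waveShift, if_pos rfl, Op.sub_apply, Op.mul_shift_apply, miwaOp_apply,
        miwaOp_apply]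
  · ext1 k
    rw [map_add, coeff_mul_C, coeff_mul_C, coeff_mk, coeff_mk, ← hmul]
    cases k with
    | zero => simp [waveShift]
    | succ k =>
      rw [waveShift, if_neg (one_sub_ne a).symm, sub_zero, miwaOp_apply]

end ShiftedWaves

end GBMT

namespace GBMT

/-! ### Potentials of compatible families of series -/

section Potential

open PowerSeries

/-- The exchange of the variables of a series in two variables. -/
def swapVar (A : Type*) [CommRing A] : A⟦X⟧⟦X⟧ →+* A⟦X⟧⟦X⟧ where
  toFun F := PowerSeries.mk fun k => PowerSeries.mk fun u => coeff k (coeff u F)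
  map_zero' := by ext; simp
  map_one' := by
    ext k u
    simp only [coeff_mk, coeff_one]
    split_ifs <;> simp_all [coeff_one]
  map_add' F G := by ext; simp
  map_mul' F G := by
    ext k u
    simp only [coeff_mk, coeff_mul, map_sum]
    rw [Finset.sum_comm]

section Swap

variable {A : Type*} [CommRing A]

theorem coeff_swapVar (F : A⟦X⟧⟦X⟧) (k u : ℕ) :
    coeff u (coeff k (swapVar A F)) = coeff k (coeff u F) := by
  simp [swapVar]

@[simp] theorem swapVar_swapVar (F : A⟦X⟧⟦X⟧) : swapVar A (swapVar A F) = F := by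
  ext k u
  rw [coeff_swapVar, coeff_swapVar]

@[simp] theorem swapVar_C (F : A⟦X⟧) : swapVar A (C F) = PowerSeries.map C F := by
  ext k u
  rw [coeff_swapVar, coeff_map, coeff_C, coeff_C]
  split_ifs <;> simp

@[simp] theorem swapVar_map_C (F : A⟦X⟧) : swapVar A (PowerSeries.map C F) = C F := by
  rw [← swapVar_C, swapVar_swapVar]

@[simp] theorem swapVar_X : swapVar A X = C X := by
  rw [← swapVar_swapVar (C X), swapVar_C, map_X]

@[simp] theorem swapVar_C_X : swapVar A (C X) = X := by
  rw [swapVar_C, map_X]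

variable [Algebra ℂ A]

/-- With derivations acting on coefficients the shift variable is the outer one, while
`PowerSeries.map` makes it the inner one; `swapVar` translates between the two. -/
theorem miwaHom_coeffDer (d : ℕ → Derivation ℂ A A) (F : A⟦X⟧) :
    miwaHom (fun i => coeffDer (d i)) (-1) F = swapVar A (PowerSeries.map (miwaHom d (-1)) F) := by
  refine (eq_miwaHom ?_ ?_).symm
  · ext k u
    have h := congrArg (coeff k) (miwaDer_miwaHom d (-1) (coeff u F))
    rw [coeff_miwaDer, neg_one_smul] at h
    have e : coeff u ((k : A⟦X⟧) + 1) = if u = 0 then (k : A) + 1 else 0 := by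
      have : ((k : A⟦X⟧) + 1) = C ((k : A) + 1) := by simp
      rw [this, coeff_C]
    have e2 : (k : A⟦X⟧) + 1 = C ((k : A) + 1) := by simp
    rw [coeff_miwaDer, neg_one_smul, map_sub, e2, coeff_mul_C, coeff_swapVar, coeff_map, map_neg,
      map_sum, map_zero, map_zero]
    simp only [coeff_coeffDer, coeff_swapVar, coeff_map]
    rw [h, map_zero]
  · ext u
    rw [coeff_swapVar, coeff_map, coeff_zero_miwaHom]

theorem miwaDer_map {A' : Type*} [CommRing A'] [Algebra ℂ A'] {d : ℕ → Derivation ℂ A A}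
    {d' : ℕ → Derivation ℂ A' A'} {φ : A →+* A'} (hφ : ∀ i f, d' i (φ f) = φ (d i f)) (F : A⟦X⟧) :
    miwaDer d' (-1) (PowerSeries.map φ F) = PowerSeries.map φ (miwaDer d (-1) F) := by
  ext k
  rw [coeff_miwaDer, coeff_map, coeff_map, coeff_miwaDer, neg_one_smul, neg_one_smul]
  simp only [coeff_map, hφ]
  simp

theorem coeff_miwaDer_C (d : ℕ → Derivation ℂ A A) (f : A) (k : ℕ) :
    coeff k (miwaDer d (-1) (C f)) = d k f := by
  rw [coeff_miwaDer, coeff_C, if_neg (Nat.succ_ne_zero k), zero_mul, neg_one_smul, zero_sub,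
    neg_neg, Finset.sum_eq_single (k, 0), coeff_zero_C]
  · rintro ⟨i, j⟩ hij hne
    have : j ≠ 0 := by
      rintro rfl
      have := Finset.HasAntidiagonal.mem_antidiagonal.1 hij
      exact hne (by simpa using this)
    rw [coeff_C, if_neg this, map_zero]
  · intro h
    exact absurd (Finset.HasAntidiagonal.mem_antidiagonal.2 (by simp)) h

end Swap

theorem tder_comm (a b : Fin 2) (i j : ℕ) (f : PS) :
    tder a i (tder b j f) = tder b j (tder a i f) := pderiv_comm _ _ _

/-- A family of series with compatible shifts comes from a potential. -/
theorem exists_potential (W : Fin 2 → PS⟦X⟧) (h0 : ∀ a, coeff 0 (W a) = 1)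
    (h : ∀ a b, PowerSeries.map (miwaHom (tder b) (-1)) (W a) * C (W b) =
      PowerSeries.map C (W a) * swapVar PS (PowerSeries.map (miwaHom (tder a) (-1)) (W b))) :
    ∃ τ : PS, IsUnit τ ∧ ∀ a, W a * C τ = miwaHom (tder a) (-1) τ := by
  have hne (a : Fin 2) : W a ≠ 0 := fun h1 => by
    have := h0 a
    rw [h1, map_zero] at this
    exact zero_ne_one this
  have hu (a : Fin 2) : IsUnit (W a) := by
    rw [PowerSeries.isUnit_iff_constantCoeff, ← coeff_zero_eq_constantCoeff_apply, h0]
    exact isUnit_one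
  choose ω hω using fun a => (hu a).exists_right_inv
  -- The logarithmic derivative of `W a`. For `W a = τ(t - [w]_a) / τ(t)` its coefficients are `-∂_p
  -- τ / τ`, so they are candidates for the gradient of `-log τ`.
  set f : Fin 2 → PS⟦X⟧ := fun a => miwaDer (tder a) (-1) (W a) * ω a with hf
  have hfW (a : Fin 2) : miwaDer (tder a) (-1) (W a) = f a * W a := by
    rw [hf]
    linear_combination -miwaDer (tder a) (-1) (W a) * hω a
  -- The logarithmic derivative of the compatibility relation in the variable of the shift of type
  -- `a`: the shifted `W b` is annihilated by `miwaDer` and drops out.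
  have h1 (a b : Fin 2) (p : ℕ) : coeffDer (tder a p) (W b) =
      (C (coeff p (f a)) - miwaHom (tder b) (-1) (coeff p (f a))) * W b := by
    have h2 := congrArg (miwaDer (fun i => coeffDer (tder a i)) (-1)) (h a b)
    have hm : miwaDer (fun i => coeffDer (tder a i)) (-1)
        (PowerSeries.map (miwaHom (tder b) (-1)) (W a)) =
        PowerSeries.map (miwaHom (tder b) (-1)) (f a) *
          PowerSeries.map (miwaHom (tder b) (-1)) (W a) := by
      rw [miwaDer_map (d := tder a) fun i f =>
        (miwaHom_der (d := tder b) (fun j g => tder_comm _ _ _ _ g) _ f).symm, hfW, map_mul]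
    have hC : miwaDer (fun i => coeffDer (tder a i)) (-1) (PowerSeries.map C (W a)) =
        PowerSeries.map C (f a) * PowerSeries.map C (W a) := by
      rw [miwaDer_map (d := tder a) fun i f => coeffDer_C _ f, hfW, map_mul]
    rw [← miwaHom_coeffDer, Derivation.leibniz, Derivation.leibniz, miwaDer_miwaHom, hm, hC,
      smul_zero, smul_eq_mul, smul_eq_mul, smul_eq_mul] at h2
    have h3 := h a b
    rw [← miwaHom_coeffDer] at h3
    have h4 : PowerSeries.map (miwaHom (tder b) (-1)) (W a) ≠ 0 := fun h5 => by
      have := congrArg (coeff 0) h5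
      rw [coeff_map, h0, map_one, map_zero] at this
      exact one_ne_zero this
    have h5 : miwaDer (fun i => coeffDer (tder a i)) (-1) (C (W b)) =
        (PowerSeries.map C (f a) - PowerSeries.map (miwaHom (tder b) (-1)) (f a)) * C (W b) :=
      mul_left_cancel₀ h4 (by linear_combination h2 - PowerSeries.map C (f a) * h3)
    have h6 := congrArg (coeff p) h5
    rwa [coeff_miwaDer_C, coeff_mul_C, map_sub, coeff_map, coeff_map] at h6
  -- Closedness of the gradient, from differentiating `miwaDer (W b) = f b * W b` and cancelling `W
  -- b`.
  have h2 (a b : Fin 2) (p q : ℕ) : tder a p (coeff q (f b)) = tder b q (coeff p (f a)) := by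
    have h3 := congrArg (coeffDer (tder a p)) (hfW b)
    rw [← miwaDer_coeffDer (fun j g => tder_comm _ _ _ _ g), h1, Derivation.leibniz,
      Derivation.leibniz, h1, map_sub, miwaDer_miwaHom, hfW] at h3
    simp only [smul_eq_mul] at h3
    have h4 : coeffDer (tder a p) (f b) = miwaDer (tder b) (-1) (C (coeff p (f a))) :=
      mul_left_cancel₀ (hne b) (by linear_combination -h3)
    have h5 := congrArg (coeff q) h4
    rwa [coeff_coeffDer, coeff_miwaDer_C] at h5
  set c : Time → PS := fun s => -coeff s.2.natPred (f s.1) with hc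
  have hs (s : Time) : s = (s.1, s.2.natPred.succPNat) := by simp
  have hdc (s r : Time) : dt s (c r) = dt r (c s) := by
    have := h2 s.1 r.1 s.2.natPred r.2.natPred
    unfold tder at this
    rw [← hs, ← hs] at this
    rw [hc, dt, dt, map_neg, map_neg, this]
  obtain ⟨x, hx, hx0⟩ := exists_solution (ι := Unit) (D := fun _ _ => {()})
    (A := fun s _ _ => c s) (fun s r x => by
      funext i
      simp only [cov, Finset.sum_singleton, dt, map_sub, Derivation.leibniz, smul_eq_mul]
      have e1 := pderiv_comm s r (x i)
      have e2 := hdc s r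
      unfold dt at e2
      linear_combination e1 - x () * e2) 1
  simp only [Finset.sum_singleton] at hx
  refine ⟨x (), isUnit_of_constantCoeff ?_, fun a => eq_miwaHom ?_ ?_⟩
  · rw [hx0]
    simp
  · have e : miwaDer (tder a) (-1) (C (x ())) = -f a * C (x ()) := by
      ext1 k
      rw [coeff_miwaDer_C, coeff_mul_C, map_neg]
      have := hx (a, k.succPNat) ()
      simp only [hc, Nat.natPred_succPNat] at this
      exact this
    rw [Derivation.leibniz, e, hfW, smul_eq_mul, smul_eq_mul]
    ring
  · rw [coeff_mul_C, h0, one_mul]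

end Potential

end GBMT

namespace GBMT

/-! ### Existence of tau functions -/

section TauExistence

open PowerSeries

variable {a : Fin 2} {B : Time → Band PS} {S T : ∀ a, Op a PS}

theorem coeff_rowSeries (A : Op a PS) (n : ℤ) (u : ℕ) :
    coeff u (rowSeries A n) = A n (n - sg a * u) := coeff_mk _ _

theorem coeff_zero_rowSeries (A : Op a PS) (n : ℤ) : coeff 0 (rowSeries A n) = A n n := by
  rw [coeff_rowSeries, Nat.cast_zero, mul_zero, sub_zero]

theorem IsDressed.lead (h : IsDressed B S T) (a : Fin 2) (n : ℤ) : IsUnit (S a n n) := by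
  have := (lead_of_mul_eq_one (b := 0) (h.ordS a) (by simpa using h.ordT a) (h.mul_inv a)
    (h.inv_mul a)).1.unit n
  simpa using this

/-- The relations between shifted and neighbouring wave functions in two variables: the inner one
belongs to the shift and the outer one to the wave functions. -/
theorem IsDressed.exists_rowSeries_eq (h : IsDressed B S T) (a : Fin 2) (n : ℤ) :
    ∃ d₀ d₁ : PS⟦X⟧,
      (X - C X) * PowerSeries.map (miwaHom (tder a) (-1)) (rowSeries (S a) n) =
        X * (C d₀ * PowerSeries.map C (rowSeries (S a) n)) +
          C d₁ * PowerSeries.map C (rowSeries (S a) (n + sg a)) ∧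
      PowerSeries.map (miwaHom (tder a) (-1)) (rowSeries (S (1 - a)) n) =
        C d₀ * PowerSeries.map C (rowSeries (S (1 - a)) n) +
          X * (C d₁ * PowerSeries.map C (rowSeries (S (1 - a)) (n + sg a))) ∧
      X * d₀ * rowSeries (S a) n + d₁ * rowSeries (S a) (n + sg a) = 0 ∧
      d₀ * C (S (1 - a) n n) = miwaHom (tder a) (-1) (S (1 - a) n n) ∧
      d₁ * C (S a (n + sg a) (n + sg a)) = -X * miwaHom (tder a) (-1) (S a n n) := by
  obtain ⟨d₀, d₁, ha, hb⟩ := h.exists_shift_eq a n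
  have h0 : S a n (n + sg a) = 0 := h.ordS a _ _ (by simp)
  have h1 : S (1 - a) (n + sg a) n = 0 := h.ordS _ _ _ (by simp [sg_one_sub])
  have hRa : (X - C X) * PowerSeries.map (miwaHom (tder a) (-1)) (rowSeries (S a) n) =
        X * (C d₀ * PowerSeries.map C (rowSeries (S a) n)) +
          C d₁ * PowerSeries.map C (rowSeries (S a) (n + sg a)) := by
    ext1 u
    cases u with
    | zero =>
      have := ha (n + sg a)
      rw [add_sub_cancel_right, h0, map_zero, map_zero, mul_zero, zero_add, zero_sub] at this
      rw [sub_mul, map_sub, map_add, coeff_zero_X_mul, coeff_zero_X_mul, coeff_C_mul, coeff_C_mul,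
        coeff_map, coeff_map, coeff_zero_rowSeries, coeff_zero_rowSeries, zero_sub, zero_add, this]
    | succ u =>
      rw [sub_mul, map_sub, map_add, coeff_succ_X_mul, coeff_succ_X_mul, coeff_C_mul, coeff_C_mul,
        coeff_C_mul, coeff_map, coeff_map, coeff_map, coeff_map, coeff_rowSeries, coeff_rowSeries,
        coeff_rowSeries]
      have := ha (n - sg a * u)
      rw [show n - sg a * (u : ℤ) - sg a = n - sg a * ((u + 1 : ℕ) : ℤ) by push_cast; ring] at this
      rw [this]
      congr 4
      push_cast
      ring
  refine ⟨d₀, d₁, hRa, ?_, ?_, ?_, ?_⟩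
  · ext1 u
    cases u with
    | zero =>
      rw [map_add, coeff_zero_X_mul, coeff_C_mul, coeff_map, coeff_map, coeff_zero_rowSeries, hb,
        h1, map_zero, mul_zero]
    | succ u =>
      rw [map_add, coeff_succ_X_mul, coeff_C_mul, coeff_C_mul, coeff_map, coeff_map, coeff_map,
        coeff_rowSeries, coeff_rowSeries, hb]
      congr 4
      rw [sg_one_sub]
      push_cast
      ring
  -- Equating the two variables removes the left-hand side, which has the factor `X - C X`.
  · have h2 := congrArg evalDiag hRa
    rw [sub_mul, map_sub, map_add, evalDiag_X_mul, evalDiag_X_mul, evalDiag_C_mul, evalDiag_C_mul,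
      evalDiag_C_mul, evalDiag_map_C, evalDiag_map_C, sub_self] at h2
    rw [h2]
    ring
  · have := hb n
    rw [h1, map_zero, mul_zero, add_zero] at this
    exact this.symm
  · have := ha (n + sg a)
    rw [add_sub_cancel_right, h0, map_zero, map_zero, mul_zero, zero_add, zero_sub] at this
    rw [← this, neg_mul]

/-- Elimination of `d₀` and `d₁` by means of the leading entries. It shows how rows at neighbouring
positions are proportional, which moves tau functions from one position to the next. -/
theorem IsDressed.neighbour_eq (h : IsDressed B S T) (a : Fin 2) (n : ℤ) :
    miwaHom (tder a) (-1) (S (1 - a) n n) * C (S a (n + sg a) (n + sg a)) * rowSeries (S a) n =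
      miwaHom (tder a) (-1) (S a n n) * C (S (1 - a) n n) * rowSeries (S a) (n + sg a) := by
  obtain ⟨d₀, d₁, -, -, h1, h2, h3⟩ := h.exists_rowSeries_eq a n
  refine mul_left_cancel₀ (X_ne_zero (R := PS)) ?_
  linear_combination C (S (1 - a) n n) * C (S a (n + sg a) (n + sg a)) * h1 -
    X * rowSeries (S a) n * C (S a (n + sg a) (n + sg a)) * h2 -
    C (S (1 - a) n n) * rowSeries (S a) (n + sg a) * h3

/-- The form matters: `X - C X` and the bracket on the right both change sign under the exchange of
the two variables, so after normalisation the rest is symmetric. This is the compatibility of two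
shifts of the same type. -/
theorem IsDressed.diagonal_eq (h : IsDressed B S T) (a : Fin 2) (n : ℤ) :
    (X - C X) * PowerSeries.map (miwaHom (tder a) (-1)) (rowSeries (S a) n) *
        C (rowSeries (S a) n) * C (C (S a (n + sg a) (n + sg a))) =
      C (miwaHom (tder a) (-1) (S a n n)) *
        (X * C (rowSeries (S a) (n + sg a)) * PowerSeries.map C (rowSeries (S a) n) -
          C X * PowerSeries.map C (rowSeries (S a) (n + sg a)) * C (rowSeries (S a) n)) := by
  obtain ⟨d₀, d₁, h0, -, h1, -, h3⟩ := h.exists_rowSeries_eq a n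
  have h1' := congrArg (C (R := PS⟦X⟧)) h1
  have h3' := congrArg (C (R := PS⟦X⟧)) h3
  simp only [map_add, map_mul, map_neg, map_zero] at h1' h3'
  have hX : (C X : PS⟦X⟧⟦X⟧) ≠ 0 :=
    (map_ne_zero_iff _ C_injective).2 X_ne_zero
  refine mul_left_cancel₀ hX ?_
  linear_combination C X * C (rowSeries (S a) n) * C (C (S a (n + sg a) (n + sg a))) * h0 +
    C (C (S a (n + sg a) (n + sg a))) * X * PowerSeries.map C (rowSeries (S a) n) * h1' +
    (C X * PowerSeries.map C (rowSeries (S a) (n + sg a)) * C (rowSeries (S a) n) -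
      X * C (rowSeries (S a) (n + sg a)) * PowerSeries.map C (rowSeries (S a) n)) * h3'

/-- For `a = 0` at `n` and for `a = 1` at `n + 1` the brackets on the right are exchanged by
`swapVar`. Comparing the two cases gives the compatibility of shifts of different types. -/
theorem IsDressed.mixed_eq (h : IsDressed B S T) (a : Fin 2) (n : ℤ) :
    PowerSeries.map (miwaHom (tder a) (-1)) (rowSeries (S (1 - a)) n) *
        C (rowSeries (S a) (n + sg a)) * C (C (S (1 - a) n n)) =
      C (miwaHom (tder a) (-1) (S (1 - a) n n)) *
        (PowerSeries.map C (rowSeries (S (1 - a)) n) * C (rowSeries (S a) (n + sg a)) -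
          X * C X * PowerSeries.map C (rowSeries (S (1 - a)) (n + sg a)) *
            C (rowSeries (S a) n)) := by
  obtain ⟨d₀, d₁, -, h0, h1, h2, -⟩ := h.exists_rowSeries_eq a n
  have h1' := congrArg (C (R := PS⟦X⟧)) h1
  have h2' := congrArg (C (R := PS⟦X⟧)) h2
  simp only [map_add, map_mul, map_zero] at h1' h2'
  linear_combination C (rowSeries (S a) (n + sg a)) * C (C (S (1 - a) n n)) * h0 +
    C (C (S (1 - a) n n)) * X * PowerSeries.map C (rowSeries (S (1 - a)) (n + sg a)) * h1' +
    (PowerSeries.map C (rowSeries (S (1 - a)) n) * C (rowSeries (S a) (n + sg a)) -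
      X * C X * PowerSeries.map C (rowSeries (S (1 - a)) (n + sg a)) * C (rowSeries (S a) n)) * h2'

/-- A potential for the wave functions at neighbouring positions. -/
theorem IsDressed.exists_local_tau (h : IsDressed B S T) (n : ℤ) : ∃ τ : PS, IsUnit τ ∧
    rowSeries (S 0) (n + 1) * C τ = C (S 0 (n + 1) (n + 1)) * miwaHom (tder 0) (-1) τ ∧
    rowSeries (S 1) n * C τ = C (S 1 n n) * miwaHom (tder 1) (-1) τ := by
  choose v hv using fun a m => (h.lead a m).exists_right_inv
  -- The numerators of `Ψ_1` at `n + 1` and of `Ψ_2` at `n` are shifts of the same function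
  -- `τ_{0,n+1}`.
  set k : Fin 2 → ℤ := fun a => if a = 0 then n + 1 else n with hk
  have k0 : k 0 = n + 1 := rfl
  have k1 : k 1 = n := rfl
  obtain ⟨W, hW0, hWs⟩ : ∃ W : Fin 2 → PS⟦X⟧, (∀ a, coeff 0 (W a) = 1) ∧
      ∀ a, W a * C (S a (k a) (k a)) = rowSeries (S a) (k a) := by
    refine ⟨fun a => rowSeries (S a) (k a) * C (v a (k a)), fun a => ?_, fun a => ?_⟩
    · rw [coeff_mul_C, coeff_zero_rowSeries, hv]
    · rw [mul_assoc, ← map_mul, mul_comm (v a _), hv, map_one, mul_one]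
  have hs (a : Fin 2) (m : ℤ) : (C (C (S a m m)) : PS⟦X⟧⟦X⟧) ≠ 0 := by
    rw [map_ne_zero_iff _ C_injective, map_ne_zero_iff _ C_injective]
    exact (h.lead a m).ne_zero
  have hms (b a : Fin 2) (m : ℤ) : (C (miwaHom (tder b) (-1) (S a m m)) : PS⟦X⟧⟦X⟧) ≠ 0 := by
    rw [map_ne_zero_iff _ C_injective]
    intro h1
    have := congrArg (coeff 0) h1
    rw [coeff_zero_miwaHom, map_zero] at this
    exact (h.lead a m).ne_zero this
  have hm (b a : Fin 2) : PowerSeries.map (miwaHom (tder b) (-1)) (W a) *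
      C (miwaHom (tder b) (-1) (S a (k a) (k a))) =
      PowerSeries.map (miwaHom (tder b) (-1)) (rowSeries (S a) (k a)) := by
    rw [← hWs, map_mul, PowerSeries.map_C]
  have hC (a : Fin 2) : PowerSeries.map C (W a) * C (C (S a (k a) (k a))) =
      PowerSeries.map C (rowSeries (S a) (k a)) := by
    rw [← hWs, map_mul, PowerSeries.map_C]
  have hC' (a : Fin 2) : C (W a) * C (C (S a (k a) (k a))) = C (rowSeries (S a) (k a)) := by
    rw [← hWs, map_mul]
  -- the two shifts in the same direction
  have hdiag (a : Fin 2) : PowerSeries.map (miwaHom (tder a) (-1)) (W a) * C (W a) =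
      PowerSeries.map C (W a) * swapVar PS (PowerSeries.map (miwaHom (tder a) (-1)) (W a)) := by
    set Q : PS⟦X⟧⟦X⟧ := X * C (rowSeries (S a) (k a + sg a)) *
      PowerSeries.map C (rowSeries (S a) (k a)) -
      C X * PowerSeries.map C (rowSeries (S a) (k a + sg a)) * C (rowSeries (S a) (k a)) with hQ
    set L : PS⟦X⟧⟦X⟧ := PowerSeries.map (miwaHom (tder a) (-1)) (W a) * C (W a) with hL
    set s : PS⟦X⟧⟦X⟧ := C (C (S a (k a) (k a))) * C (C (S a (k a + sg a) (k a + sg a))) with hs'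
    have e1 : (X - C X) * L * s = Q := by
      have := h.diagonal_eq a (k a)
      rw [← hm, ← hC'] at this
      refine mul_left_cancel₀ (hms a a (k a)) ?_
      rw [hQ, ← hC', hL, hs']
      linear_combination this
    have e2 : swapVar PS Q = -Q := by
      rw [hQ]
      simp only [map_sub, map_mul, swapVar_C, swapVar_map_C, swapVar_X, map_X]
      ring
    have e3 : swapVar PS s = s := by
      rw [hs']
      simp only [map_mul, swapVar_C, PowerSeries.map_C]
    have e4 := congrArg (swapVar PS) e1
    rw [map_mul, map_mul, map_sub, swapVar_X, swapVar_C_X, e2, e3] at e4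
    have e5 : swapVar PS L =
        PowerSeries.map C (W a) * swapVar PS (PowerSeries.map (miwaHom (tder a) (-1)) (W a)) := by
      rw [hL, map_mul, swapVar_C, mul_comm]
    rw [← e5]
    have hne : (X - C X : PS⟦X⟧⟦X⟧) ≠ 0 := by
      intro h1
      have := congrArg (coeff 1) h1
      rw [map_sub, coeff_one_X, coeff_C, if_neg one_ne_zero, sub_zero, map_zero] at this
      exact one_ne_zero this
    refine mul_left_cancel₀ (mul_ne_zero hne (mul_ne_zero (hs a (k a)) (hs a (k a + sg a)))) ?_
    linear_combination e1 + e4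
  have hmixed : PowerSeries.map (miwaHom (tder 0) (-1)) (W 1) * C (W 0) =
      PowerSeries.map C (W 1) * swapVar PS (PowerSeries.map (miwaHom (tder 1) (-1)) (W 0)) := by
    have e1 := h.mixed_eq 0 n
    have e2 := h.mixed_eq 1 (n + 1)
    have g0 : sg 0 = 1 := rfl
    have g1 : sg 1 = -1 := rfl
    rw [show (1 : Fin 2) - 0 = 1 from rfl, g0] at e1
    rw [show (1 : Fin 2) - 1 = 0 from rfl, g1, add_neg_cancel_right] at e2
    have e3 := congrArg (swapVar PS) e2
    have a1 := hm 0 1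
    have a2 := congrArg (swapVar PS) (hm 1 0)
    have a3 := hC 1
    have a4 := hC' 0
    rw [k0] at a2 a4
    rw [k1] at a1 a3
    simp only [map_sub, map_mul, swapVar_C, swapVar_map_C, swapVar_X, PowerSeries.map_C,
      map_X] at e3 a2
    have ht0 := hms 0 1 n
    have ht1 : (PowerSeries.map C (miwaHom (tder 1) (-1) (S 0 (n + 1) (n + 1))) : PS⟦X⟧⟦X⟧) ≠ 0 := by
      rw [← swapVar_C]
      intro h1
      have := congrArg (swapVar PS) h1
      rw [swapVar_swapVar, map_zero] at this
      exact hms 1 0 (n + 1) this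
    refine mul_left_cancel₀ (mul_ne_zero (mul_ne_zero ht0 ht1)
      (mul_ne_zero (hs 0 (n + 1)) (hs 1 n))) ?_
    rw [← a1, ← a4] at e1
    rw [← a2, ← a3] at e3
    linear_combination PowerSeries.map C (miwaHom (tder 1) (-1) (S 0 (n + 1) (n + 1))) * e1 -
      C (miwaHom (tder 0) (-1) (S 1 n n)) * e3 + C (miwaHom (tder 0) (-1) (S 1 n n)) *
        PowerSeries.map C (miwaHom (tder 1) (-1) (S 0 (n + 1) (n + 1))) *
        (PowerSeries.map C (rowSeries (S 1) n) * a4 - C (rowSeries (S 0) (n + 1)) * a3)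
  have hcompat (a b : Fin 2) : PowerSeries.map (miwaHom (tder b) (-1)) (W a) * C (W b) =
      PowerSeries.map C (W a) * swapVar PS (PowerSeries.map (miwaHom (tder a) (-1)) (W b)) := by
    by_cases hab : a = b
    · subst hab
      exact hdiag a
    · fin_cases a <;> fin_cases b <;> first | exact absurd rfl hab | skip
      · have := congrArg (swapVar PS) hmixed
        rw [map_mul, map_mul, swapVar_swapVar, swapVar_map_C, swapVar_C] at this
        simpa [mul_comm] using this.symm
      · exact hmixed
  obtain ⟨τ, hτ, h2⟩ := exists_potential W hW0 hcompat
  · refine ⟨τ, hτ, ?_, ?_⟩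
    · rw [← h2, ← k0, ← hWs]
      ring
    · rw [← h2, ← k1, ← hWs]
      ring

theorem exists_cumulative_prod {G : Type*} [CommGroup G] (u : ℤ → G) :
    ∃ c : ℤ → G, ∀ n, c (n + 1) = c n * u n := by
  refine ⟨fun n => (∏ i ∈ Finset.range n.toNat, u i) *
    (∏ i ∈ Finset.range (-n).toNat, u (-(i + 1)))⁻¹, fun n => ?_⟩
  dsimp only
  obtain ⟨k, rfl | rfl⟩ := n.eq_nat_or_neg
  · rw [show ((k : ℤ) + 1).toNat = k + 1 by omega, show (-((k : ℤ) + 1)).toNat = 0 by omega,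
      show (-(k : ℤ)).toNat = 0 by omega, Int.toNat_natCast, Finset.prod_range_succ]
    simp
  · cases k with
    | zero => simp
    | succ k =>
      rw [show (-((k + 1 : ℕ) : ℤ) + 1).toNat = 0 by omega,
        show (-(-((k + 1 : ℕ) : ℤ) + 1)).toNat = k by omega,
        show (-((k + 1 : ℕ) : ℤ)).toNat = 0 by omega,
        show (- -((k + 1 : ℕ) : ℤ)).toNat = k + 1 by omega, Finset.prod_range_succ]
      simp

theorem miwaHom_ne_zero {d : ℕ → Derivation ℂ PS PS} {ε : ℂ} {f : PS} (hf : f ≠ 0) :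
    miwaHom d ε f ≠ 0 := fun h => hf (by rw [← coeff_zero_miwaHom d ε f, h, map_zero])

/-- The equations for tau functions propagate to the neighbouring position. -/
theorem IsDressed.tau_step (h : IsDressed B S T) {n : ℤ} {τ τ' : PS}
    (hτ : τ' * S 0 n n = τ * S 1 n n) :
    (rowSeries (S 0) n * C τ = C (S 0 n n) * miwaHom (tder 0) (-1) τ ∧
      rowSeries (S 1) (n - 1) * C τ = C (S 1 (n - 1) (n - 1)) * miwaHom (tder 1) (-1) τ) ↔
    (rowSeries (S 0) (n + 1) * C τ' = C (S 0 (n + 1) (n + 1)) * miwaHom (tder 0) (-1) τ' ∧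
      rowSeries (S 1) n * C τ' = C (S 1 n n) * miwaHom (tder 1) (-1) τ') := by
  have hs (a : Fin 2) (m : ℤ) : (C (S a m m) : PS⟦X⟧) ≠ 0 :=
    (map_ne_zero_iff _ C_injective).2 (h.lead a m).ne_zero
  have hm (b a : Fin 2) (m : ℤ) : miwaHom (tder b) (-1) (S a m m) ≠ 0 :=
    miwaHom_ne_zero (h.lead a m).ne_zero
  have n0 := h.neighbour_eq 0 n
  have n1 := h.neighbour_eq 1 n
  rw [show (1 : Fin 2) - 0 = 1 from rfl, show sg 0 = 1 from rfl] at n0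
  rw [show (1 : Fin 2) - 1 = 0 from rfl, show sg 1 = -1 from rfl, ← sub_eq_add_neg] at n1
  have hC := congrArg (C (R := PS)) hτ
  have h0 := congrArg (miwaHom (tder 0) (-1)) hτ
  have h1 := congrArg (miwaHom (tder 1) (-1)) hτ
  rw [map_mul, map_mul] at hC h0 h1
  refine and_congr ⟨fun e => ?_, fun e => ?_⟩ ⟨fun e => ?_, fun e => ?_⟩
  · refine mul_left_cancel₀ (mul_ne_zero (hs 0 n) (hm 0 0 n)) ?_
    linear_combination rowSeries (S 0) (n + 1) * miwaHom (tder 0) (-1) (S 0 n n) * hC -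
      C τ * n0 + miwaHom (tder 0) (-1) (S 1 n n) * C (S 0 (n + 1) (n + 1)) * e -
      C (S 0 (n + 1) (n + 1)) * C (S 0 n n) * h0
  · refine mul_left_cancel₀ (mul_ne_zero (hm 0 1 n) (hs 0 (n + 1))) ?_
    linear_combination -rowSeries (S 0) (n + 1) * miwaHom (tder 0) (-1) (S 0 n n) * hC +
      C τ * n0 + C (S 0 n n) * miwaHom (tder 0) (-1) (S 0 n n) * e +
      C (S 0 (n + 1) (n + 1)) * C (S 0 n n) * h0
  · refine mul_left_cancel₀ (mul_ne_zero (mul_ne_zero (hm 1 0 n) (hs 1 (n - 1))) (hs 0 n)) ?_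
    linear_combination miwaHom (tder 1) (-1) (S 0 n n) * C (S 1 (n - 1) (n - 1)) *
      rowSeries (S 1) n * hC + C (S 1 n n) * C τ * n1 +
      miwaHom (tder 1) (-1) (S 1 n n) * C (S 0 n n) * C (S 1 n n) * e -
      C (S 1 n n) * C (S 1 (n - 1) (n - 1)) * C (S 0 n n) * h1
  · refine mul_left_cancel₀ (mul_ne_zero (mul_ne_zero (hm 1 1 n) (hs 0 n)) (hs 1 n)) ?_
    linear_combination -miwaHom (tder 1) (-1) (S 0 n n) * C (S 1 (n - 1) (n - 1)) *
      rowSeries (S 1) n * hC - C (S 1 n n) * C τ * n1 +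
      miwaHom (tder 1) (-1) (S 0 n n) * C (S 1 (n - 1) (n - 1)) * C (S 0 n n) * e +
      C (S 1 n n) * C (S 1 (n - 1) (n - 1)) * C (S 0 n n) * h1

/-- In a tau pair the leading entries are `S 0 n n = τ_{0,n} / τ_{1,n}` and `S 1 n n = τ_{0,n+1} /
τ_{1,n}`. Their quotient prescribes `τ_{0,n+1} / τ_{0,n}`, and `tau_step` propagates a potential
found at one position to all `n`; then `τ_1` is `τ_0` divided by `S 0 n n`. -/
theorem IsDressed.exists_tau (h : IsDressed B S T) : ∃ τ0 τ1 : ℤ → PS,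
    (∀ n, IsUnit (τ0 n)) ∧ (∀ n, IsUnit (τ1 n)) ∧
      IsTauSeries S (fun a => T a * half a PS) τ0 τ1 := by
  choose u hu using h.lead
  obtain ⟨c, hc⟩ := exists_cumulative_prod fun n => u 1 n * (u 0 n)⁻¹
  obtain ⟨τ, ⟨x, rfl⟩, h0, h1⟩ := h.exists_local_tau (-1)
  rw [neg_add_cancel] at h0
  set t : ℤ → PSˣ := fun n => x * (c 0)⁻¹ * c n with ht
  have ht0 : (t 0 : PS) = x := by simp [ht]
  have hstep (n : ℤ) : (t (n + 1) : PS) * S 0 n n = t n * S 1 n n := by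
    rw [← hu, ← hu, ← Units.val_mul, ← Units.val_mul, ht]
    dsimp only
    rw [hc]
    congr 1
    rw [mul_assoc, mul_assoc (c n), inv_mul_cancel_right]
    simp only [mul_assoc]
  have key (n : ℤ) : rowSeries (S 0) n * C (t n : PS) =
        C (S 0 n n) * miwaHom (tder 0) (-1) (t n) ∧
      rowSeries (S 1) (n - 1) * C (t n : PS) =
        C (S 1 (n - 1) (n - 1)) * miwaHom (tder 1) (-1) (t n) := by
    induction n using Int.induction_on with
    | zero =>
      rw [ht0]
      exact ⟨h0, h1⟩
    | succ k ih =>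
      rw [add_sub_cancel_right]
      exact (h.tau_step (hstep k)).1 ih
    | pred k ih =>
      refine (h.tau_step (hstep (-k - 1))).2 ?_
      rw [sub_add_cancel]
      exact ih
  have hrow (a : Fin 2) (n : ℤ) : rowSeries (S a) n * C ((t n * (u 0 n)⁻¹ : PSˣ) : PS) =
      miwaHom (tder a) (-1) (t (n + kap a) : PS) := by
    fin_cases a
    · change rowSeries (S 0) n * _ = miwaHom (tder 0) (-1) (t (n + 0) : PS)
      rw [add_zero, Units.val_mul, map_mul, ← mul_assoc, (key n).1, ← hu, mul_right_comm, ← map_mul,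
        Units.mul_inv, map_one, one_mul]
    · change rowSeries (S 1) n * _ = miwaHom (tder 1) (-1) (t (n + 1) : PS)
      have e : t n * (u 0 n)⁻¹ = t (n + 1) * (u 1 n)⁻¹ := by
        have := hstep n
        rw [← hu, ← hu, ← Units.val_mul, ← Units.val_mul, Units.val_inj] at this
        rw [mul_inv_eq_iff_eq_mul, mul_right_comm, this, mul_inv_cancel_right]
      have k1 := (key (n + 1)).2
      rw [add_sub_cancel_right] at k1
      rw [e, Units.val_mul, map_mul, ← mul_assoc, k1, ← hu, mul_right_comm, ← map_mul,
        Units.mul_inv, map_one, one_mul]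
  refine ⟨fun n => t n, fun n => (t n * (u 0 n)⁻¹ : PSˣ), fun n => (t n).isUnit,
    fun n => Units.isUnit _, hrow, fun a n => ?_⟩
  -- The opposite shift turns the right-hand side back into `τ_0`; multiplication by the dual wave
  -- function, inverse to the shifted row, gives the column relation.
  have e := congrArg (miwaFull (tder a) 1) (hrow a n)
  rw [miwaFull_mul_C, miwaFull_miwaHom fun i j f => tder_comm a a i j f] at e
  rw [← e, ← mul_assoc, h.star_mul_row, one_mul]

end TauExistence

end GBMT

namespace GBMT

/-! ### Lax operators of a tau function -/

section FromTau

/-- The bilinear pairing of the rows of `A` at `t` with the columns of `K` at `t'`. -/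
def opPairing (A K : ∀ a, Op a PS) (n n' : ℤ) : PS2 :=
  pairing 0 (fun i => atT (A 0 n i)) (fun i => atT' (K 0 (-i) n')) (dT 0) +
    pairing 1 (fun i => atT (A 1 n i)) (fun i => atT' (K 1 (-i) n')) (dT 1)

theorem diag_opPairing (A K : ∀ a, Op a PS) (n n' : ℤ) :
    diag (opPairing A K n n') = (A 0 * K 0) n n' + (A 1 * K 1) n n' := by
  rw [opPairing, map_add, diag_pairing (bdd_atT (bdd_row _ _)) (bdd_atT' (bdd_col _ _)) (wtd_dT _)
    (diag_dT _), diag_pairing (bdd_atT (bdd_row _ _)) (bdd_atT' (bdd_col _ _)) (wtd_dT _)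
    (diag_dT _)]
  simp only [diag_atT, diag_atT', neg_neg]
  rfl

/-- The derivative of `A e^{ξ}`, up to the factor `e^{ξ}`. -/
def leftDt (s : Time) (A : ∀ a, Op a PS) (a : Fin 2) : Op a PS :=
  opDt s (A a) + if s.1 = a then A a * Op.shift a PS (sg a * s.2) else 0

/-- The derivative of `e^{-ξ} K`, up to the factor `e^{-ξ}`. -/
def rightDt (s : Time) (K : ∀ a, Op a PS) (a : Fin 2) : Op a PS :=
  opDt s (K a) - if s.1 = a then Op.shift a PS (sg a * s.2) * K a else 0

theorem pderiv_inl_opPairing (s : Time) (A K : ∀ a, Op a PS) (n n' : ℤ) :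
    MvPowerSeries.pderiv ℂ (Sum.inl s) (opPairing A K n n') = opPairing (leftDt s A) K n n' := by
  obtain ⟨b, q⟩ := s
  have key (a : Fin 2) : MvPowerSeries.pderiv ℂ (Sum.inl (b, q))
      (pairing a (fun i => atT (A a n i)) (fun i => atT' (K a (-i) n')) (dT a)) =
      pairing a (fun i => atT (leftDt (b, q) A a n i)) (fun i => atT' (K a (-i) n')) (dT a) := by
    rw [pderiv_pairing (bdd_atT (bdd_row _ _)) (bdd_atT' (bdd_col _ _)) (wtd_dT _)
      (fun j => pderiv_inl_atT' _ _) fun p => pderiv_inl_dT a b p q]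
    congr 1
    ext1 i
    rw [pderiv_inl_atT, leftDt, Op.add_apply]
    change _ = atTHom (_ + _)
    rw [map_add]
    by_cases h : b = a
    · subst h
      simp only [if_true, one_mul, Op.mul_shift_apply]
      rfl
    · simp only [if_neg h, if_neg (Ne.symm h), zero_mul, Op.zero_apply, map_zero]
      rfl
  rw [opPairing, opPairing, map_add, key, key]

theorem pderiv_inr_opPairing (s : Time) (A K : ∀ a, Op a PS) (n n' : ℤ) :
    MvPowerSeries.pderiv ℂ (Sum.inr s) (opPairing A K n n') = opPairing A (rightDt s K) n n' := by
  obtain ⟨b, q⟩ := s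
  have key (a : Fin 2) : MvPowerSeries.pderiv ℂ (Sum.inr (b, q))
      (pairing a (fun i => atT (A a n i)) (fun i => atT' (K a (-i) n')) (dT a)) =
      pairing a (fun i => atT (A a n i)) (fun i => atT' (rightDt (b, q) K a (-i) n')) (dT a) := by
    rw [pairing_comm, pderiv_pairing (bdd_atT' (bdd_col _ _)) (bdd_atT (bdd_row _ _)) (wtd_dT _)
      (fun j => pderiv_inr_atT _ _) fun p => pderiv_inr_dT a b p q, pairing_comm]
    congr 1
    ext1 i
    rw [pderiv_inr_atT', rightDt, Op.sub_apply]
    change _ = atTHom' (_ - _)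
    rw [map_sub]
    by_cases h : b = a
    · subst h
      simp only [if_true, neg_one_mul, Op.shift_mul_apply, neg_sub, ← sub_eq_add_neg]
      rw [show -i + sg b * (q : ℤ) = sg b * (q : ℤ) - i by ring]
      rfl
    · simp only [if_neg h, if_neg (Ne.symm h), neg_zero, zero_mul, Op.zero_apply, map_zero, add_zero,
        sub_zero]
      rfl
  rw [opPairing, opPairing, map_add, key, key]

variable {a : Fin 2} {S T : ∀ a, Op a PS}

/-- A matrix that is built from series in the way the wave operators are built from tau functions. -/
def rowOp (a : Fin 2) (f : ℤ → PS) (x : ℤ → PSˣ) : Op a PS :=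
  Op.ofOrdLE (b := 0) (fun n j => shiftCoeff a (-1) (f (n + kap a)) (j - n) * ↑(x n)⁻¹)
    fun n j h => by
      dsimp only
      rw [shiftCoeff, if_neg (by omega), zero_mul]

theorem ordLE_rowOp (f : ℤ → PS) (x : ℤ → PSˣ) : OrdLE a 0 (rowOp a f x) := fun n j h => by
  change shiftCoeff _ _ _ _ * _ = 0
  rw [shiftCoeff, if_neg (by omega), zero_mul]

theorem rowSeries_rowOp (f : ℤ → PS) (x : ℤ → PSˣ) (n : ℤ) :
    rowSeries (rowOp a f x) n * PowerSeries.C (x n : PS) =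
      miwaHom (tder a) (-1) (f (n + kap a)) := by
  refine (row_mul_iff (ordLE_rowOp f x)).2 fun j => ?_
  change shiftCoeff _ _ _ _ * _ * _ = _
  rw [Units.inv_mul_cancel_right]

/-- A matrix that is built from series in the way the dual wave operators are built from tau
functions. -/
def colOpOfTau (a : Fin 2) (g : ℤ → PS) (y : ℤ → PSˣ) : Op a PS :=
  Op.ofOrdLE (b := -kap a)
    (fun i n' => shiftCoeff a 1 (g (n' - kap a)) (-i + (n' - kap a)) * ↑(y n')⁻¹)
    fun i n' h => by
      have h1 := kap_eq a
      have h2 : sg a * (-i + (n' - kap a)) = sg a * (n' - i) - sg a * kap a := by ring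
      dsimp only
      rw [shiftCoeff, if_neg (by omega), zero_mul]

theorem ordLE_colOpOfTau (g : ℤ → PS) (y : ℤ → PSˣ) : OrdLE a (-kap a) (colOpOfTau a g y) :=
  fun i n' h => by
    have h1 := kap_eq a
    have h2 : sg a * (-i + (n' - kap a)) = sg a * (n' - i) - sg a * kap a := by ring
    change shiftCoeff _ _ _ _ * _ = 0
    rw [shiftCoeff, if_neg (by omega), zero_mul]

theorem colSeries_colOpOfTau (g : ℤ → PS) (y : ℤ → PSˣ) (n : ℤ) :
    colSeries (colOpOfTau a g y) n * PowerSeries.C (y (n + kap a) : PS) =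
      miwaHom (tder a) 1 (g n) := by
  refine (col_mul_iff (ordLE_colOpOfTau g y)).2 fun j => ?_
  change shiftCoeff _ _ _ _ * _ * _ = _
  rw [Units.inv_mul_cancel_right, neg_neg, add_sub_cancel_right]

theorem tauPairing_eq_opPairing (f g : ℤ → PS) (x y : ℤ → PSˣ) (e : Fin 2 → ℤ) (n n' : ℤ) :
    tauPairing (e 0) (e 1) f g n n' = atT (x n : PS) * atT' (y n' : PS) *
      opPairing (fun a => rowOp a f x * Op.shift a PS (e a)) (fun a => colOpOfTau a g y) n n' :=
  tauPairing_eq (fun _ => ordLE_rowOp f x) (fun _ => ordLE_colOpOfTau g y)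
    (x := fun n => x n) (y := fun n => y n)
    (fun _ n => rowSeries_rowOp f x n) (fun _ n => colSeries_colOpOfTau g y n) _ _ n n'

/-- Two matrices of different types with opposite products with the half matrices are equal. -/
theorem val_eq_of_mul_half_add {X : ∀ a, Op a PS}
    (h : ∀ n k, (X 0 * half 0 PS) n k + (X 1 * half 1 PS) n k = 0) :
    (X 0).val = (X 1).val ∧ ∀ n, (Function.support ((X 0) n)).Finite ∧ ∑ᶠ k, X 0 n k = 0 := by
  have e (a : Fin 2) (n k : ℤ) :
      X a n k = sg a • ((X a * half a PS) n k - (X a * half a PS) n (k + 1)) := by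
    rw [← mul_halfInv_apply, mul_assoc, half_mul_halfInv, mul_one]
  have hval : (X 0).val = (X 1).val := by
    funext n k
    rw [e 0, e 1, eq_neg_of_add_eq_zero_left (h n k), eq_neg_of_add_eq_zero_left (h n (k + 1))]
    simp [sg]
    abel
  have hfin (n : ℤ) : (Function.support ((X 0) n)).Finite := by
    obtain ⟨b, hb⟩ := (X 0).exists_ordLE
    obtain ⟨c, hc⟩ := (X 1).exists_ordLE
    refine finite_row_of_ordLE (b := max b c) (fun a => ?_) n
    fin_cases a
    · exact hb.mono (le_max_left _ _)
    · rw [hval]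
      exact hc.mono (le_max_right _ _)
  refine ⟨hval, fun n => ⟨hfin n, ?_⟩⟩
  -- Any column would do: the two halves add up to ones there, so the identity becomes the vanishing
  -- of the row sum.
  have h1 := h n 0
  have hs (a : Fin 2) : (X a * half a PS) n 0 = ∑ k ∈ (hfin n).toFinset, X 0 n k * half a PS k 0 := by
    have hv : (X a).val = (X 0).val := by
      fin_cases a
      · rfl
      · exact hval.symm
    rw [Op.mul_apply, hv]
    refine finsum_eq_sum_of_support_subset _ fun k hk => ?_
    rw [Set.Finite.coe_toFinset]
    exact fun h => hk (by simp [h])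
  rw [hs, hs, ← Finset.sum_add_distrib] at h1
  simp only [← mul_add, half_add_half, mul_one] at h1
  rw [← h1]
  exact finsum_eq_sum_of_support_subset _ (by rw [Set.Finite.coe_toFinset])

/-- Matrices with complementary triangular shapes whose entries add up to `1`. -/
theorem eq_half_of_add_eq_one {X : ∀ a, Op a PS} (h0 : ∀ a, OrdLE a (-kap a) (X a))
    (h : ∀ n k, X 0 n k + X 1 n k = 1) (a : Fin 2) : X a = half a PS := by
  refine Op.ext fun n k => ?_
  have e0 (hk : n < k) : X 0 n k = 0 := h0 0 n k (by simp [sg, kap]; omega)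
  have e1 (hk : k ≤ n) : X 1 n k = 0 := h0 1 n k (by simp [sg, kap]; omega)
  have h1 := h n k
  fin_cases a
  · change X 0 n k = half 0 PS n k
    rw [half_zero_apply]
    split_ifs with hk
    · rwa [e1 hk, add_zero] at h1
    · exact e0 (by omega)
  · change X 1 n k = half 1 PS n k
    rw [half_one_apply]
    split_ifs with hk
    · rwa [e0 hk, zero_add] at h1
    · exact e1 (by omega)

/-- A band that agrees with `A` above the diagonal and vanishes below is the truncation of `A`. -/
theorem trunc_val_eq (A : Op a PS) {Y : ℤ → ℤ → PS} (hfin : ∀ n, (Function.support (Y n)).Finite)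
    (hsum : ∀ n, ∑ᶠ k, Y n k = 0) (h1 : ∀ n k, 1 ≤ sg a * (k - n) → Y n k = A n k)
    (h0 : ∀ n k, sg a * (k - n) < 0 → Y n k = 0) : A.trunc.val = Y := by
  have hoff (n k : ℤ) (hk : k ≠ n) : A.trunc.val n k = Y n k := by
    rw [Op.trunc_val]
    split_ifs with h
    · exact (h1 n k h).symm
    · refine (h0 n k ?_).symm
      have : sg a * (k - n) ≠ 0 := fun h' => hk (by
        have := sg_mul_sg_mul a (k - n)
        rw [h', mul_zero] at this
        omega)
      omega
  funext n k
  by_cases hk : k = n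
  · subst hk
    have h2 : ∑ᶠ j, (A.trunc.val k j - Y k j) = 0 := by
      rw [finsum_sub_distrib (A.trunc.finite_row k) (hfin k), A.trunc.rowSum, hsum, sub_zero]
    rw [finsum_eq_single _ k fun j hj => by rw [hoff k j hj, sub_self]] at h2
    exact sub_eq_zero.1 h2
  · exact hoff n k hk

/-- The Lax operators of dressing operators. -/
theorem IsDressed.isLaxPair {L : ∀ a, Op a PS} (h : IsDressed (laxBand L) S T)
    (hL : ∀ a, L a = S a * Op.shift a PS (sg a) * T a) : IsLaxPair L := by
  have hlead (a : Fin 2) : Lead 1 (L a) := by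
    obtain ⟨h1, h2⟩ := lead_of_mul_eq_one (b := 0) (h.ordS a) (by simpa using h.ordT a)
      (h.mul_inv a) (h.inv_mul a)
    have h3 := (h1.mul (lead_shift (R := PS) (a := a) (sg a))).mul h2
    rwa [sg_mul_self, zero_add, neg_zero, add_zero, ← hL] at h3
  refine ⟨fun a => (hlead a).ord, fun a n => ?_, fun a s => ?_⟩
  · have := (hlead a).unit n
    rw [mul_one] at this
    exact this.ne_zero
  · have e1 : opDt s (S a * Op.shift a PS (sg a) * T a) =
        opDt s (S a) * Op.shift a PS (sg a) * T a +
          S a * Op.shift a PS (sg a) * opDt s (T a) := by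
      rw [Op.der_mul, Op.der_mul, Op.der_shift, mul_zero, add_zero]
    rw [hL a, e1, h.evol, h.opDt_inv]
    split_ifs
    · have e2 : S a * Op.shift a PS (sg a * s.2) * Op.shift a PS (sg a) =
          S a * Op.shift a PS (sg a) * Op.shift a PS (sg a * s.2) := by
        rw [mul_assoc, mul_assoc, Op.shift_mul_shift, Op.shift_mul_shift, add_comm]
      rw [sub_mul, sub_mul, e2]
      noncomm_ring
    · noncomm_ring

/-- Sato equations from a bilinear identity. -/
theorem isDressed_of_opPairing {L : ∀ a, Op a PS} (hS : ∀ a, OrdLE a 0 (S a))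
    (hT : ∀ a, OrdLE a 0 (T a)) (hST : ∀ a, S a * T a = 1) (hTS : ∀ a, T a * S a = 1)
    (hL : ∀ a, L a = S a * Op.shift a PS (sg a) * T a)
    (h : ∀ n n', opPairing S (fun a => T a * half a PS) n n' = 1) : IsDressed (laxBand L) S T := by
  refine ⟨hS, hT, hST, hTS, ?_⟩
  have key (s : Time) (a : Fin 2) :
      (laxBand L s).op a = leftDt s S a * T a := by
    -- The derivative in `t` of the constant `1`, taken at `t' = t`, gives opposite products with
    -- the two halves.
    obtain ⟨hval, hrow⟩ := val_eq_of_mul_half_add (X := fun a => leftDt s S a * T a) fun n k => by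
      have h1 := congrArg (fun x => diag (MvPowerSeries.pderiv ℂ (Sum.inl s) x)) (h n k)
      rwa [pderiv_inl_opPairing, diag_opPairing, Derivation.map_one_eq_zero, map_zero,
        ← mul_assoc, ← mul_assoc] at h1
    have hv (b : Fin 2) : (leftDt s S b * T b).val = (leftDt s S 0 * T 0).val := by
      fin_cases b
      · rfl
      · exact hval.symm
    have hord (b : Fin 2) : OrdLE b 0 (opDt s (S b) * T b) := by
      simpa using OrdLE.mul ((hS b).der _) (hT b)
    refine Op.val_injective ?_
    rw [hv]
    change (L s.1 ^ (s.2 : ℕ)).trunc.val = _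
    -- Seen as a matrix of the type of `s`, the operator agrees with `S Λ^{±p} T = L^p` beyond the
    -- diagonal; seen as one of the other type, it is `∂S * T` and vanishes on the opposite side.
    -- With zero row sums this makes it the truncation of `L^p`.
    refine trunc_val_eq _ (fun n => (hrow n).1) (fun n => (hrow n).2) (fun n k hk => ?_)
      fun n k hk => ?_
    · rw [← hv s.1, leftDt, if_pos rfl, add_mul, Op.add_apply, hord _ n k (by omega), zero_add,
        dressed_pow (hL s.1) (hST _) (hTS _), mul_comm (sg s.1)]
    · rw [← hv (1 - s.1), leftDt, if_neg (one_sub_ne s.1).symm, add_zero]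
      exact hord _ n k (by rw [sg_one_sub, neg_mul]; omega)
  intro a s
  rw [key, mul_assoc, hTS, mul_one, leftDt, add_sub_cancel_right]

variable {B : Time → Band PS}

theorem IsDressed.leftDt_eq (h : IsDressed B S T) (s : Time) (a : Fin 2) :
    leftDt s S a = (B s).op a * S a := by
  rw [leftDt, h.evol, sub_add_cancel]

theorem IsDressed.rightDt_eq (h : IsDressed B S T) (s : Time) (a : Fin 2) :
    rightDt s (fun a => T a * half a PS) a =
      -(T a * half a PS * (halfInv a PS * (B s).op a * half a PS)) := by
  rw [rightDt, h.evol_star, add_sub_cancel_right]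

/-- Functions that are reproduced by pairings with wave functions are eigenfunctions. -/
theorem IsDressed.isEigen_of_opPairing (h : IsDressed B S T) {K : ∀ a, Op a PS} {q : ℤ → PS}
    (hq : ∀ n, opPairing S K n 0 = atT (q n)) : IsEigen B q := by
  intro s n
  have h1 := congrArg (fun x => diag (MvPowerSeries.pderiv ℂ (Sum.inl s) x)) (hq n)
  have h2 (k : ℤ) := congrArg diag (hq k)
  simp only [diag_opPairing, diag_atT] at h2
  rw [pderiv_inl_opPairing, diag_opPairing, pderiv_inl_atT, diag_atT, h.leftDt_eq, h.leftDt_eq,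
    mul_assoc, mul_assoc, Band.op_mul_apply, Band.op_mul_apply, ← Finset.sum_add_distrib] at h1
  rw [← h1]
  simp only [← mul_add, h2]

/-- Functions that are reproduced by pairings with dual wave functions are adjoint
eigenfunctions. -/
theorem IsDressed.isAdjEigen_of_opPairing (h : IsDressed B S T) {A : ∀ a, Op a PS} {r : ℤ → PS}
    (hr : ∀ n', opPairing A (fun a => T a * half a PS) 0 n' = atT' (r n')) : IsAdjEigen B r := by
  intro s n
  have h1 := congrArg (fun x => diag (MvPowerSeries.pderiv ℂ (Sum.inr s) x)) (hr n)
  have h2 (k : ℤ) := congrArg diag (hr k)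
  simp only [diag_opPairing, diag_atT'] at h2
  rw [pderiv_inr_opPairing, diag_opPairing, pderiv_inr_atT', diag_atT', h.rightDt_eq,
    h.rightDt_eq, mul_neg, mul_neg, Op.neg_apply, Op.neg_apply, ← mul_assoc (A 0),
    ← mul_assoc (A 1), Band.mul_conj_apply, Band.mul_conj_apply, ← neg_add,
    ← Finset.sum_add_distrib] at h1
  rw [← h1]
  simp only [← mul_add, h2]

/-- A solution of the bilinear equations for tau functions gives dressing operators. -/
theorem exists_isDressed_of_isTauSolution {M N m : ℕ} {τ0 τ1 : ℤ → PS} {ρ σ : Fin m → ℤ → PS}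
    (hu0 : ∀ n, IsUnit (τ0 n)) (hu1 : ∀ n, IsUnit (τ1 n)) (h : IsTauSolution M N τ0 τ1 ρ σ) :
    ∃ (L S T : ∀ a, Op a PS) (q r : Fin m → ℤ → PS), IsDressed (laxBand L) S T ∧
      (∀ a, L a = S a * Op.shift a PS (sg a) * T a) ∧
      (∀ i, IsEigen (laxBand L) (q i)) ∧ (∀ i, IsAdjEigen (laxBand L) (r i)) ∧
      (∀ n n', (L 0 ^ M * half 0 PS) n n' + (L 1 ^ N * half 1 PS) n n' = ∑ i, q i n * r i n') ∧
      IsTauSeries S (fun a => T a * half a PS) τ0 τ1 ∧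
      (∀ i n, ρ i n = q i n * τ1 n) ∧ ∀ i n, σ i n = r i n * τ0 n := by
  choose y hy using hu0
  choose x hx using hu1
  have hat (f : PSˣ) : IsUnit (atT (f : PS)) := f.isUnit.map atTHom
  have hat' (f : PSˣ) : IsUnit (atT' (f : PS)) := f.isUnit.map atTHom'
  have hmul (f g : PS) : atT (f * g) = atT f * atT g := map_mul atTHom f g
  have hmul' (f g : PS) : atT' (f * g) = atT' f * atT' g := map_mul atTHom' f g
  have hpair (f g : ℤ → PS) (n n' : ℤ) : tauPairing 0 0 f g n n' = atT (x n : PS) * atT' (y n' : PS) *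
      opPairing (fun a => rowOp a f x) (fun a => colOpOfTau a g y) n n' := by
    have := tauPairing_eq_opPairing f g x y 0 n n'
    simp only [Pi.zero_apply, Op.shift_zero, mul_one] at this
    exact this
  have hcancel (n n' : ℤ) {F G : PS2} (e : atT (x n : PS) * atT' (y n' : PS) * F =
      atT (x n : PS) * atT' (y n' : PS) * G) : F = G :=
    ((hat (x n)).mul (hat' (y n'))).mul_left_cancel e
  set S : ∀ a, Op a PS := fun a => rowOp a τ0 x with hS
  set P : ∀ a, Op a PS := fun a => colOpOfTau a τ1 y with hP
  set q : Fin m → ℤ → PS := fun i n => ρ i n * ↑(x n)⁻¹ with hq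
  set r : Fin m → ℤ → PS := fun i n => σ i n * ↑(y n)⁻¹ with hr
  have hρ (i : Fin m) (n : ℤ) : ρ i n = q i n * x n := by rw [hq, Units.inv_mul_cancel_right]
  have hσ (i : Fin m) (n : ℤ) : σ i n = r i n * y n := by rw [hr, Units.inv_mul_cancel_right]
  have hone (n n' : ℤ) : opPairing S P n n' = 1 := hcancel n n' (by
    rw [← hpair, h.mToda, ← hx, ← hy, mul_one])
  -- At equal times the pairing says only that the two products add up to the matrix of ones; their
  -- complementary triangular shapes separate them.
  have hSP (a : Fin 2) : S a * P a = half a PS :=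
    eq_half_of_add_eq_one (X := fun a => S a * P a)
      (fun a => ordLE_mul_half (ordLE_rowOp τ0 x) (ordLE_colOpOfTau τ1 y)) (fun n k => by
        have := congrArg diag (hone n k)
        rwa [diag_opPairing, map_one] at this) a
  have hlead (a : Fin 2) : Lead 0 (S a) := by
    refine ⟨ordLE_rowOp τ0 x, fun n => ?_⟩
    have e := congrArg (PowerSeries.coeff 0) (rowSeries_rowOp (a := a) τ0 x n)
    rw [PowerSeries.coeff_mul_C, coeff_zero_rowSeries, coeff_zero_miwaHom, ← hy] at e
    rw [mul_zero, add_zero]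
    exact isUnit_of_mul_isUnit_left (e ▸ (y (n + kap a)).isUnit)
  choose T hT hST hTS using fun a => (hlead a).exists_inv
  simp only [neg_zero] at hT
  have hPT : P = fun a => T a * half a PS := by
    funext a
    rw [← hSP, ← mul_assoc, hTS, one_mul]
  set L : ∀ a, Op a PS := fun a => S a * Op.shift a PS (sg a) * T a with hL
  have hd : IsDressed (laxBand L) S T := isDressed_of_opPairing (fun a => (hlead a).ord) hT hST hTS
    (fun _ => rfl) fun n n' => hPT ▸ hone n n'
  refine ⟨L, S, T, q, r, hd, fun _ => rfl, fun i => ?_, fun i => ?_, fun n n' => ?_, ?_,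
    fun i n => ?_, fun i n => ?_⟩
  -- The equation for `ρ` at a single value of `n'` is enough: its derivative in `t` at equal times
  -- is the flow of `q`.
  · refine hd.isEigen_of_opPairing (K := fun a => colOpOfTau a (ρ i) y) fun n => hcancel n 0 ?_
    rw [← hpair, h.rho, hρ, hmul, ← hy]
    ring
  · refine hd.isAdjEigen_of_opPairing (A := fun a => rowOp a (σ i) x) fun n' => hcancel 0 n' ?_
    rw [← hPT, ← hpair, h.sigma, hσ, hmul', ← hx]
    ring
  · have e1 := h.constraint n n'
    have e2 : opPairing (fun a => S a * Op.shift a PS ((![(M : ℤ), -N] : Fin 2 → ℤ) a)) P n n' =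
        ∑ i, atT (q i n) * atT' (r i n') := hcancel n n' (by
      rw [← tauPairing_eq_opPairing]
      refine e1.trans ?_
      rw [Finset.mul_sum]
      refine Finset.sum_congr rfl fun i _ => ?_
      rw [hρ, hσ, hmul, hmul']
      ring)
    have e3 := congrArg diag e2
    simp only [diag_opPairing, map_sum, map_mul, diag_atT, diag_atT', hPT, ← mul_assoc] at e3
    rw [← e3, dressed_pow (j := sg 0) (X := L 0) rfl (hST 0) (hTS 0),
      dressed_pow (j := sg 1) (X := L 1) rfl (hST 1) (hTS 1)]
    simp [sg]
  · refine ⟨fun a n => ?_, fun a n => ?_⟩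
    · rw [← hx]
      exact rowSeries_rowOp τ0 x n
    · rw [← hy, ← show P a = T a * half a PS from congrFun hPT a]
      exact colSeries_colOpOfTau τ1 y n
  · rw [hρ, hx]
  · rw [hσ, hy]

end FromTau

end GBMT

end

/-! ### Equivalence of the Lax and the bilinear formulation -/

theorem mainTheorem4 (M N m : ℕ) (hM : 1 ≤ M) (hN : 1 ≤ N) :
    (∀ (L1 L2 : GBMT.ShiftOp) (q r : Fin m → ℤ → GBMT.PS),
      GBMT.IsLaxSolution M N L1 L2 q r →
        (∃ W : GBMT.WaveOps, GBMT.IsWaveOps L1 L2 W) ∧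
        ∀ W : GBMT.WaveOps, GBMT.IsWaveOps L1 L2 W →
          (∀ i, GBMT.WaveIdentityQ W (q i)) ∧
          (∀ i, GBMT.WaveIdentityR W (r i)) ∧
          GBMT.WaveIdentityConstraint M N W q r ∧
          (∃ τ0 τ1 : ℤ → GBMT.PS, GBMT.IsTauPair W τ0 τ1) ∧
          ∀ τ0 τ1 : ℤ → GBMT.PS, GBMT.IsTauPair W τ0 τ1 →
            GBMT.IsTauSolution M N τ0 τ1
              (fun i n => q i n * τ1 n) (fun i n => r i n * τ0 n)) ∧
    (∀ (τ0 τ1 : ℤ → GBMT.PS) (ρ σ : Fin m → ℤ → GBMT.PS),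
      (∀ n, IsUnit (τ0 n)) → (∀ n, IsUnit (τ1 n)) →
      GBMT.IsTauSolution M N τ0 τ1 ρ σ →
        ∃ (L1 L2 : GBMT.ShiftOp) (q r : Fin m → ℤ → GBMT.PS) (W : GBMT.WaveOps),
          GBMT.IsLaxSolution M N L1 L2 q r ∧ GBMT.IsWaveOps L1 L2 W ∧
          GBMT.IsTauPair W τ0 τ1 ∧
          (∀ i n, ρ i n = q i n * τ1 n) ∧ (∀ i n, σ i n = r i n * τ0 n)) := by
  refine ⟨fun L1 L2 q r h => ?_, fun τ0 τ1 ρ σ hu0 hu1 h => ?_⟩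
  · obtain ⟨L, h0, h1⟩ := h.exists_ops
    obtain ⟨hL, hq, hr, hc⟩ := (GBMT.isLaxSolution_iff h0 h1).1 h
    refine ⟨?_, fun W hW => ?_⟩
    · choose S T hS hT hST hTS hevol hdress using hL.exists_dressing
      exact ⟨⟨GBMT.unmat (S 0), GBMT.unmat (T 0), GBMT.unmat (S 1), GBMT.unmat (T 1)⟩,
        (GBMT.isWaveOps_iff (S := S) (T := T) h0 h1 (GBMT.mat_unmat _).symm
          (GBMT.mat_unmat _).symm (GBMT.mat_unmat _).symm (GBMT.mat_unmat _).symm).2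
          ⟨⟨hS, hT, hST, hTS, hevol⟩, hdress⟩⟩
    · obtain ⟨S, T, ⟨hS0, hS1⟩, hT0, hT1⟩ := hW.exists_ops
      obtain ⟨hd, hdress⟩ := (GBMT.isWaveOps_iff h0 h1 hS0 hS1 hT0 hT1).1 hW
      have hc' (n n' : ℤ) : (S 0 * GBMT.Op.shift 0 GBMT.PS M * (T 0 * GBMT.half 0 GBMT.PS)) n n' +
          (S 1 * GBMT.Op.shift 1 GBMT.PS (-N) * (T 1 * GBMT.half 1 GBMT.PS)) n n' =
            ∑ i, q i n * r i n' := by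
        rw [← hc, GBMT.dressed_pow (hdress 0) (hd.mul_inv 0) (hd.inv_mul 0),
          GBMT.dressed_pow (hdress 1) (hd.mul_inv 1) (hd.inv_mul 1)]
        simp [GBMT.sg, mul_assoc]
      refine ⟨fun i => hd.waveIdentityQ hS0 hS1 hT0 hT1 (hq i),
        fun i => hd.waveIdentityR hS0 hS1 hT0 hT1 (hr i),
        hd.waveIdentityConstraint hS0 hS1 hT0 hT1 hq hc', ?_, fun τ0 τ1 hτ => ?_⟩
      · obtain ⟨τ0, τ1, hτ⟩ := hd.exists_tau
        exact ⟨τ0, τ1, (GBMT.isTauPair_iff hd hS0 hS1 hT0 hT1).2 hτ⟩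
      · exact hd.isTauSolution hq hr hc' ((GBMT.isTauPair_iff hd hS0 hS1 hT0 hT1).1 hτ).2.2
  · obtain ⟨L, S, T, q, r, hd, hdress, hq, hr, hc, hτ, hρ, hσ⟩ :=
      GBMT.exists_isDressed_of_isTauSolution hu0 hu1 h
    have h0 : (L 0).val = GBMT.mat (GBMT.unmat (L 0)) := (GBMT.mat_unmat _).symm
    have h1 : (L 1).val = GBMT.mat (GBMT.unmat (L 1)) := (GBMT.mat_unmat _).symm
    set W : GBMT.WaveOps :=
      ⟨GBMT.unmat (S 0), GBMT.unmat (T 0), GBMT.unmat (S 1), GBMT.unmat (T 1)⟩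
    have hS0 : (S 0).val = GBMT.mat W.S1 := (GBMT.mat_unmat _).symm
    have hS1 : (S 1).val = GBMT.mat W.S2 := (GBMT.mat_unmat _).symm
    have hT0 : (T 0).val = GBMT.mat W.T1 := (GBMT.mat_unmat _).symm
    have hT1 : (T 1).val = GBMT.mat W.T2 := (GBMT.mat_unmat _).symm
    exact ⟨GBMT.unmat (L 0), GBMT.unmat (L 1), q, r, W,
      (GBMT.isLaxSolution_iff h0 h1).2 ⟨hd.isLaxPair hdress, hq, hr, hc⟩,
      (GBMT.isWaveOps_iff h0 h1 hS0 hS1 hT0 hT1).2 ⟨hd, hdress⟩,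
      (GBMT.isTauPair_iff hd hS0 hS1 hT0 hT1).2 ⟨hu0, hu1, hτ⟩, hρ, hσ⟩
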